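/- Let $w\colon\mathbb Z\to\mathbb R$ be a normalized weight, that is, $w_n=w_{-n}\ge 1$ for all $n$ (also written $w(n)=w_n$), which is strictly superexponential: $\log w(n)/n\to\infty$ as $n\to\infty$. Let $q=\sum_{n\in\mathbb Z}q_n e^{2n\pi i x}\in L^2(\mathbb R/\mathbb Z,\mathbb C)$ be a complex $1$-periodic potential with $\|q\|_w^2=\sum_{n\in\mathbb Z}w_n^2|q_n|^2<\infty$. Consider $L=-\frac{d^2}{dx^2}+q$ on $[0,1]$ with periodic or antiperiodic boundary conditions. Its eigenvalues for both kinds of boundary conditions together, repeated according to algebraic multiplicity, can be listed in lexicographic order $\preceq$ (first by real part, then by imaginary part) as $$\lambda_0\preceq\lambda_1^-\preceq\lambda_1^+\preceq\dots\preceq\lambda_n^-\preceq\lambda_n^+\preceq\cdots;$$ let $\gamma_n(q)=\lambda_n^+-\lambda_n^-$ for $n\ge1$ denote the gap lengths of $q$. For $r>0$ let $$\psi(r)=\min_{m\ge1}\frac{\log\bigl(r\,w(m)\bigr)}{m},$$ where $m$ ranges over the positive integers; this minimum exists. Then $$|\gamma_n(q)|\le 2n\exp\bigl(-n\,\psi(\tilde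 n)\bigr),\qquad \tilde n=\frac{n}{4\|q\|_w},$$ for all integers $n\ge1$ with $n\ge4\|q\|_w$. (For $q=0$, where $\tilde n=\infty$, the right-hand side is read as $0$, that is, $\gamma_n(0)=0$ for all $n\ge1$.) -/

import Mathlib

open MeasureTheory Filter Topology

noncomputable section

/-- Complex 1-periodic square integrable potentials, `L²(S¹, ℂ)` with `S¹ = ℝ / ℤ`. -/
abbrev Potential : Type := Lp ℂ 2 (AddCircle.haarAddCircle : Measure UnitAddCircle)

/-- A normalized weight: `w_n = w_{-n} ≥ 1` for all integers `n`. -/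
def IsNormalizedWeight (w : ℤ → ℝ) : Prop :=
  ∀ n : ℤ, w n = w (-n) ∧ 1 ≤ w n

/-- A strictly superexponential weight: `log w(n) / n → ∞` as `n → ∞`. -/
def IsStrictlySuperexponential (w : ℤ → ℝ) : Prop :=
  Tendsto (fun n : ℕ => Real.log (w (n : ℤ)) / (n : ℝ)) atTop atTop

/-- The weighted space `H^w` of all potentials `q = ∑ q_n e^{2 n π i x}` with
`∑ w_n² |q_n|² < ∞`. -/
def weightedSpace (w : ℤ → ℝ) : Set Potential :=
  {q | Summable fun n : ℤ => (w n) ^ 2 * ‖fourierCoeff (q : UnitAddCircle → ℂ) n‖ ^ 2}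

/-- The `w`-norm `‖q‖_w = (∑ w_n² |q_n|²)^{1/2}` (used for `q` in `H^w`). -/
def weightedNorm (w : ℤ → ℝ) (q : Potential) : ℝ :=
  Real.sqrt (∑' n : ℤ, (w n) ^ 2 * ‖fourierCoeff (q : UnitAddCircle → ℂ) n‖ ^ 2)

/-- `f` belongs to the domain of `L = -d²/dx² + q` on `[0,1]` with the boundary conditions
`f(1) = σ f(0)`, `f'(1) = σ f'(0)`, and `L f = g` almost everywhere. A function on `[0,1]` is
represented by its extension to the line with `f(x + 1) = σ f(x)`; `f` lies in `H²`: it is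
differentiable and `f'` is an indefinite integral of a square integrable function `h = f''`.
The periodic and antiperiodic cases are `σ = 1` and `σ = -1`. -/
structure IsHillImage (q : Potential) (σ : ℂ) (f g : ℝ → ℂ) : Prop where
  quasiperiodic : ∀ x : ℝ, f (x + 1) = σ * f x
  differentiable : Differentiable ℝ f
  equation : ∃ h : ℝ → ℂ, MemLp h 2 (volume.restrict (Set.Ioc (0 : ℝ) 1)) ∧
    (∀ x ∈ Set.Icc (0 : ℝ) 1, deriv f x = deriv f 0 + ∫ t in (0 : ℝ)..x, h t) ∧
    ∀ᵐ x ∂(volume.restrict (Set.Ioc (0 : ℝ) 1)),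
      -h x + q (x : UnitAddCircle) * f x = g x

theorem IsHillImage.zero (q : Potential) (σ : ℂ) : IsHillImage q σ 0 0 where
  quasiperiodic x := by simp
  differentiable := differentiable_const 0
  equation := ⟨0, MemLp.zero, by simp, by simp⟩

theorem IsHillImage.add {q : Potential} {σ : ℂ} {f₁ g₁ f₂ g₂ : ℝ → ℂ}
    (h₁ : IsHillImage q σ f₁ g₁) (h₂ : IsHillImage q σ f₂ g₂) :
    IsHillImage q σ (f₁ + f₂) (g₁ + g₂) := by
  obtain ⟨p₁, d₁, k₁, m₁, i₁, e₁⟩ := h₁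
  obtain ⟨p₂, d₂, k₂, m₂, i₂, e₂⟩ := h₂
  have int : ∀ {k : ℝ → ℂ}, MemLp k 2 (volume.restrict (Set.Ioc (0 : ℝ) 1)) →
      ∀ x ∈ Set.Icc (0 : ℝ) 1, IntervalIntegrable k volume 0 x := by
    intro k hk x hx
    rw [intervalIntegrable_iff_integrableOn_Ioc_of_le hx.1]
    exact IntegrableOn.mono_set (hk.integrable (by norm_num)) (Set.Ioc_subset_Ioc_right hx.2)
  refine ⟨fun x => ?_, d₁.add d₂, k₁ + k₂, m₁.add m₂, fun x hx => ?_, ?_⟩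
  · simp only [Pi.add_apply, p₁ x, p₂ x]
    ring
  · rw [deriv_add (d₁ x) (d₂ x), deriv_add (d₁ 0) (d₂ 0), i₁ x hx, i₂ x hx]
    simp only [Pi.add_apply]
    rw [intervalIntegral.integral_add (int m₁ x hx) (int m₂ x hx)]
    ring
  · filter_upwards [e₁, e₂] with x hx₁ hx₂
    simp only [Pi.add_apply, ← hx₁, ← hx₂]
    ring

theorem IsHillImage.smul {q : Potential} {σ : ℂ} {f g : ℝ → ℂ} (c : ℂ)
    (h : IsHillImage q σ f g) : IsHillImage q σ (c • f) (c • g) := by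
  obtain ⟨p, d, k, m, i, e⟩ := h
  refine ⟨fun x => ?_, d.const_smul c, c • k, m.const_smul c, fun x hx => ?_, ?_⟩
  · simp only [Pi.smul_apply, smul_eq_mul, p x]
    ring
  · rw [deriv_const_smul c (d x), deriv_const_smul c (d 0), i x hx]
    simp only [Pi.smul_apply]
    rw [intervalIntegral.integral_smul, smul_add]
  · filter_upwards [e] with x hx
    simp only [Pi.smul_apply, smul_eq_mul, ← hx]
    ring

/-- The kernel of `(L - z)^k` for the boundary conditions given by `σ`. -/
def hillKernel (q : Potential) (σ z : ℂ) : ℕ → Submodule ℂ (ℝ → ℂ)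
  | 0 => ⊥
  | k + 1 =>
    { carrier := {f | ∃ g ∈ hillKernel q σ z k, IsHillImage q σ f (z • f + g)}
      zero_mem' := ⟨0, Submodule.zero_mem _, by simpa using IsHillImage.zero q σ⟩
      add_mem' := by
        rintro f₁ f₂ ⟨g₁, hg₁, h₁⟩ ⟨g₂, hg₂, h₂⟩
        refine ⟨g₁ + g₂, Submodule.add_mem _ hg₁ hg₂, ?_⟩
        have h := h₁.add h₂
        rwa [add_add_add_comm, ← smul_add] at h
      smul_mem' := by
        rintro c f ⟨g, hg, h⟩
        refine ⟨c • g, Submodule.smul_mem _ c hg, ?_⟩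
        have h' := h.smul c
        rwa [smul_add, smul_comm c z f] at h' }

/-- The root space (generalized eigenspace) `⋃_k ker (L - z)^k`. -/
def hillRootSpace (q : Potential) (σ z : ℂ) : Submodule ℂ (ℝ → ℂ) :=
  ⨆ k : ℕ, hillKernel q σ z k

/-- The algebraic multiplicity of `z` as a periodic or antiperiodic eigenvalue of `q`
(zero if `z` is no eigenvalue). -/
def periodicMultiplicity (q : Potential) (z : ℂ) : Cardinal :=
  Module.rank ℂ (hillRootSpace q 1 z) + Module.rank ℂ (hillRootSpace q (-1) z)

/-- The lexicographic order on `ℂ`: first by real part, then by imaginary part. -/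
def LexLE (z z' : ℂ) : Prop :=
  z.re < z'.re ∨ (z.re = z'.re ∧ z.im ≤ z'.im)

/-- `lam` is the lexicographically ordered sequence of all periodic and antiperiodic eigenvalues
of `q`, each repeated according to its algebraic multiplicity. In the usual labelling,
`lam 0 = λ₀`, `lam (2 n - 1) = λ_n⁻` and `lam (2 n) = λ_n⁺` for `n ≥ 1`. -/
def IsPeriodicEigenvalueSequence (q : Potential) (lam : ℕ → ℂ) : Prop :=
  (∀ j k : ℕ, j ≤ k → LexLE (lam j) (lam k)) ∧
    ∀ z : ℂ, Cardinal.mk {k : ℕ // lam k = z} = periodicMultiplicity q z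

/-- The gap length `γ_n = λ_n⁺ - λ_n⁻`, `n ≥ 1`, read off from the sequence of eigenvalues. -/
def gapLength (lam : ℕ → ℂ) (n : ℕ) : ℂ :=
  lam (2 * n) - lam (2 * n - 1)

/-- The set of the numbers `log (r w(m)) / m` for integers `m ≥ 1`. -/
def psiValues (w : ℤ → ℝ) (r : ℝ) : Set ℝ :=
  {y | ∃ m : ℕ, 1 ≤ m ∧ y = Real.log (r * w (m : ℤ)) / (m : ℝ)}

/-- `ψ(r) = min_{m ≥ 1} log (r w(m)) / m`. -/
def psi (w : ℤ → ℝ) (r : ℝ) : ℝ :=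
  sInf (psiValues w r)

end

/-! On Fourier coefficients `L` acts as `D + V`. Here `D` is diagonal with entries `π² (2 m + s)²`,
where `s = 0` stands for periodic and `s = 1` for antiperiodic functions, and `V` is convolution
with the coefficients of `q`. These are absolutely summable, so all the analysis takes place in
`ℓ¹(ℤ)`.

Let `z` lie in the strip `|Re z - n² π²| ≤ 4 n`. Off the two modes `±n`, the operator `(D - z)⁻¹ V`
has norm at most `1/4`, also in exponentially weighted norms of rate `α`, as soon as `∑ (e^{α|k|}
|q_k|)² ≤ n² / 16`. The choice `α = ψ(ñ)` is made for this, since `e^{ψ(r)|k|} ≤ r w_k` for `r ≥ 1`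
(`exp_psi_le`). Solving the equation off `±n` (`exists_quasimode`) leaves a 2 × 2 system whose
off-diagonal entries are at most `(n/3) e^{-α n}`. For the bilinear pairing `∫ u w` the operator `V`
is symmetric, which forces the two diagonal entries to coincide. At an eigenvalue the determinant
vanishes, so this common entry `β(z)` is exponentially small as well. The same pairing gives `β(z₁)
- β(z₂) = (z₂ - z₁) ∫ u w` with `|∫ u w| ≥ 8/9`, so no derivative of `β` is needed: two eigenvalues
in one strip are exponentially close (`norm_sub_le_of_eigenvalues`).

That `λ_n^±` do lie in the strip is a count with algebraic multiplicities. For `0 ≤ t ≤ 1` no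
eigenvalue of `D + t V` meets the lines `Re z = n² π² ± 4 n`. Over a large finite set of low modes,
`D + t V` has an invariant graph depending continuously on `t` (`exists_invariantGraph`); at `t = 1`
it carries all root spaces to the left of the line (`hillKernel_eq_map`). The number of matrix
eigenvalues left of the line is therefore constant in `t` (`rootCountBelow_charpoly_eq`), and at `t
= 0` it is a count of integers, with totals `2 n + 1` and `2 n - 1`. -/

noncomputable section

/-! ### Eigenvalue counts along continuous families of matrices -/

/-- The number of roots, with multiplicity, in an open left half plane. -/
def rootCountBelow (p : Polynomial ℂ) (c : ℝ) : ℕ :=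
  p.roots.countP (fun z => z.re < c)

/-- Gershgorin's theorem. It confines the roots of a compact family of matrices to one ball. -/
theorem norm_le_of_isRoot_charpoly {ι : Type*} [Fintype ι] [DecidableEq ι]
    {A : Matrix ι ι ℂ} {B : ℝ} (hB : ∀ i, ∑ j, ‖A i j‖ ≤ B) {z : ℂ} (hz : A.charpoly.IsRoot z) :
    ‖z‖ ≤ B := by
  have hz' : Module.End.HasEigenvalue (Matrix.toLin' A) z := by
    rw [Module.End.hasEigenvalue_iff_mem_spectrum, Matrix.spectrum_toLin',
      Matrix.mem_spectrum_iff_isRoot_charpoly]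
    exact hz
  obtain ⟨k, hk⟩ := eigenvalue_mem_ball hz'
  rw [mem_closedBall_iff_norm] at hk
  calc ‖z‖ = ‖(z - A k k) + A k k‖ := by ring_nf
    _ ≤ ‖z - A k k‖ + ‖A k k‖ := norm_add_le _ _
    _ ≤ ∑ j ∈ Finset.univ.erase k, ‖A k j‖ + ‖A k k‖ := by gcongr
    _ = ∑ j, ‖A k j‖ := Finset.sum_erase_add _ _ (Finset.mem_univ k)
    _ ≤ B := hB k

theorem exists_roots_charpoly {ι : Type*} [Fintype ι] [DecidableEq ι] (A : Matrix ι ι ℂ) :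
    ∃ z : ι → ℂ, A.charpoly.roots = Finset.univ.val.map z := by
  have hcard : Multiset.card A.charpoly.roots = Fintype.card ι := by
    rw [← Matrix.charpoly_natDegree_eq_dim A]
    exact (IsAlgClosed.splits A.charpoly).natDegree_eq_card_roots.symm
  obtain ⟨l, hl⟩ := Quot.exists_rep A.charpoly.roots
  have hl' : (l : Multiset ℂ) = A.charpoly.roots := hl
  have hlen : l.length = Fintype.card ι := by
    rw [← hcard, ← hl']; rfl
  let e : ι ≃ Fin l.length := (Fintype.equivFin ι).trans (finCongr hlen.symm)
  refine ⟨fun i => l.get (e i), ?_⟩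
  have h1 : Finset.univ.val.map (fun i => l.get (e i)) =
      (Finset.univ.val.map e).map l.get := by
    rw [Multiset.map_map]; rfl
  have h2 : (Finset.univ : Finset ι).val.map e = (Finset.univ : Finset (Fin l.length)).val := by
    have := Finset.map_univ_equiv e
    exact congrArg Finset.val this
  rw [h1, h2, ← hl', Fin.univ_val_map]
  congr 1
  exact (List.ofFn_get l).symm

theorem charpoly_eq_of_eval {ι : Type*} [Fintype ι] [DecidableEq ι] {A : Matrix ι ι ℂ}
    {z : ι → ℂ} (h : ∀ x : ℂ, (Matrix.scalar ι x - A).det = ∏ i, (x - z i)) :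
    A.charpoly.roots = Finset.univ.val.map z := by
  have : A.charpoly = ∏ i, (Polynomial.X - Polynomial.C (z i)) := by
    apply Polynomial.funext
    intro x
    rw [Matrix.eval_charpoly, h x, Polynomial.eval_prod]
    simp
  rw [this]
  have h2 := Polynomial.roots_multiset_prod_X_sub_C (Finset.univ.val.map z)
  rw [Multiset.map_map] at h2
  exact h2

theorem eval_charpoly_of_roots {ι : Type*} [Fintype ι] [DecidableEq ι] {A : Matrix ι ι ℂ}
    {z : ι → ℂ} (h : A.charpoly.roots = Finset.univ.val.map z) (x : ℂ) :
    (Matrix.scalar ι x - A).det = ∏ i, (x - z i) := by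
  rw [← Matrix.eval_charpoly]
  conv_lhs => rw [(IsAlgClosed.splits A.charpoly).eq_prod_roots_of_monic A.charpoly_monic]
  rw [h, Multiset.map_map, Polynomial.eval_multiset_prod, Multiset.map_map]
  simp only [Function.comp_def, Polynomial.eval_sub, Polynomial.eval_X, Polynomial.eval_C]
  rfl

/-- If no eigenvalue of a continuous family of matrices meets a vertical line, then the number of
eigenvalues on its left side is constant. -/
theorem rootCountBelow_charpoly_eq {ι : Type*} [Fintype ι] [DecidableEq ι]
    {T : Type*} [TopologicalSpace T] [CompactSpace T] [T2Space T] [PreconnectedSpace T]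
    {G : T → Matrix ι ι ℂ} (hG : Continuous G) {c : ℝ}
    (hc : ∀ t z, (G t).charpoly.IsRoot z → z.re ≠ c) (t t' : T) :
    rootCountBelow (G t).charpoly c = rootCountBelow (G t').charpoly c := by
  classical
  have hGe : ∀ i j, Continuous fun t => G t i j := fun i j => hG.matrix_elem i j
  obtain ⟨B, hB⟩ : ∃ B : ℝ, ∀ t, ∀ i, ∑ j, ‖G t i j‖ ≤ B := by
    have hcont : Continuous fun t => ∑ i, ∑ j, ‖G t i j‖ := by fun_prop
    obtain ⟨B, hB⟩ := (isCompact_range hcont).bddAbove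
    refine ⟨B, fun t i => le_trans ?_ (hB ⟨t, rfl⟩)⟩
    exact Finset.single_le_sum (f := fun i => ∑ j, ‖G t i j‖)
      (fun i _ => Finset.sum_nonneg fun j _ => norm_nonneg _) (Finset.mem_univ i)
  -- A pair in `C A` is a parameter with a labelling of its roots, the labels in `A` weakly left of
  -- the line and the others weakly right. Weak inequalities make `C A` compact; `hc` makes them
  -- strict, so that the count is `A.card`.
  let C : Finset ι → Set (T × (ι → ℂ)) := fun A =>
    {p | p.2 ∈ Metric.closedBall (0 : ι → ℂ) (max B 0) ∧ (∀ i ∈ A, (p.2 i).re ≤ c) ∧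
      (∀ i ∈ Aᶜ, c ≤ (p.2 i).re) ∧
      ∀ x : ℂ, (Matrix.scalar ι x - G p.1).det = ∏ i, (x - p.2 i)}
  have hCcomp : ∀ A, IsCompact (C A) := by
    intro A
    refine IsCompact.of_isClosed_subset
      (isCompact_univ.prod (isCompact_closedBall (0 : ι → ℂ) (max B 0))) ?_
      (fun p hp => ⟨Set.mem_univ _, hp.1⟩)
    have hCA : C A = (Prod.snd ⁻¹' Metric.closedBall (0 : ι → ℂ) (max B 0)) ∩
        ((⋂ i ∈ A, {p : T × (ι → ℂ) | (p.2 i).re ≤ c}) ∩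
        ((⋂ i ∈ Aᶜ, {p : T × (ι → ℂ) | c ≤ (p.2 i).re}) ∩
        ⋂ x : ℂ, {p : T × (ι → ℂ) |
          (Matrix.scalar ι x - G p.1).det = ∏ i, (x - p.2 i)})) := by
      ext p
      simp [C]
    rw [hCA]
    refine (Metric.isClosed_closedBall.preimage continuous_snd).inter
      (IsClosed.inter ?_ (IsClosed.inter ?_ ?_))
    · exact isClosed_biInter fun i _ =>
        isClosed_le (Complex.continuous_re.comp ((continuous_apply i).comp continuous_snd))
          continuous_const
    · exact isClosed_biInter fun i _ =>
        isClosed_le continuous_const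
          (Complex.continuous_re.comp ((continuous_apply i).comp continuous_snd))
    · refine isClosed_iInter fun x => isClosed_eq ?_ ?_
      · exact (continuous_const.sub (hG.comp continuous_fst)).matrix_det
      · fun_prop
  have hclosed : ∀ A, IsClosed (Prod.fst '' C A) := fun A =>
    ((hCcomp A).image continuous_fst).isClosed
  have hmem : ∀ t, ∃ A, t ∈ Prod.fst '' C A := by
    intro t
    obtain ⟨z, hz⟩ := exists_roots_charpoly (G t)
    refine ⟨Finset.univ.filter fun i => (z i).re < c, ⟨(t, z), ⟨?_, ?_, ?_, ?_⟩, rfl⟩⟩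
    · rw [mem_closedBall_zero_iff]
      refine (pi_norm_le_iff_of_nonneg (le_max_right _ _)).2 fun i => le_max_of_le_left ?_
      refine norm_le_of_isRoot_charpoly (hB t) (Polynomial.isRoot_of_mem_roots (p := (G t).charpoly) ?_)
      rw [hz]
      exact Multiset.mem_map_of_mem z (Finset.mem_univ i)
    · intro i hi
      exact (Finset.mem_filter.1 hi).2.le
    · intro i hi
      simpa using hi
    · exact eval_charpoly_of_roots hz
  have hcount : ∀ t A, t ∈ Prod.fst '' C A → rootCountBelow (G t).charpoly c = A.card := by
    rintro t A ⟨⟨t, z⟩, ⟨-, h1, h2, h3⟩, rfl⟩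
    have hr := charpoly_eq_of_eval h3
    have hroot : ∀ i, (G t).charpoly.IsRoot (z i) := fun i => by
      refine Polynomial.isRoot_of_mem_roots (p := (G t).charpoly) ?_
      rw [hr]
      exact Multiset.mem_map_of_mem z (Finset.mem_univ i)
    rw [rootCountBelow, hr, Multiset.countP_map]
    have : A = Finset.univ.filter fun i => (z i).re < c := by
      ext i
      simp only [Finset.mem_filter, Finset.mem_univ, true_and]
      constructor
      · intro hi
        exact lt_of_le_of_ne (h1 i hi) (hc t _ (hroot i))
      · intro hi
        by_contra hA
        exact absurd (h2 i (Finset.mem_compl.2 hA)) (not_le.2 hi)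
    rw [this]
    rfl
  -- Preimages are finite unions of the closed projections of the sets `C A`, so the count is
  -- continuous into the discrete space `ℕ`.
  have hcont : Continuous fun t => rootCountBelow (G t).charpoly c := by
    rw [continuous_iff_isClosed]
    intro S _
    have : (fun t => rootCountBelow (G t).charpoly c) ⁻¹' S =
        ⋃ A ∈ {A : Finset ι | A.card ∈ S}, Prod.fst '' C A := by
      ext t
      simp only [Set.mem_preimage, Set.mem_iUnion, Set.mem_ofPred_eq, exists_prop]
      constructor
      · intro h
        obtain ⟨A, hA⟩ := hmem t
        exact ⟨A, by rwa [← hcount t A hA], hA⟩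
      · rintro ⟨A, hA, htA⟩
        rwa [hcount t A htA]
    rw [this]
    exact (Set.toFinite _).isClosed_biUnion fun A _ => hclosed A
  exact PreconnectedSpace.constant inferInstance hcont

end

/-! ### Convolution on `ℓ¹(ℤ)` and bounds for the free resolvent -/

noncomputable section

/-- Convolution of two sequences on `ℤ`. -/
def seqConv (a u : ℤ → ℂ) (m : ℤ) : ℂ := ∑' j : ℤ, a (m - j) * u j

/-- The eigenvalues of the free operator for the parity `s`. -/
def freeEigenvalue (s m : ℤ) : ℝ := Real.pi ^ 2 * ((2 * m + s : ℤ) : ℝ) ^ 2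

/-- The shear `(m, j) ↦ (m - j, j)`. -/
def shearEquiv : ℤ × ℤ ≃ ℤ × ℤ where
  toFun p := (p.1 - p.2, p.2)
  invFun p := (p.1 + p.2, p.2)
  left_inv p := by ext <;> simp
  right_inv p := by ext <;> simp

theorem Summable.bounded_norm {a : ℤ → ℂ} (ha : Summable fun k => ‖a k‖) (k : ℤ) :
    ‖a k‖ ≤ ∑' j, ‖a j‖ := ha.le_tsum k fun _ _ => norm_nonneg _

theorem summable_norm_conv_terms {a u : ℤ → ℂ} (ha : Summable fun k => ‖a k‖)
    (hu : Summable fun k => ‖u k‖) (m : ℤ) : Summable fun j => ‖a (m - j) * u j‖ := by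
  refine Summable.of_nonneg_of_le (fun j => norm_nonneg _) (fun j => ?_)
    (hu.mul_left (∑' j, ‖a j‖))
  rw [norm_mul]
  exact mul_le_mul_of_nonneg_right (ha.bounded_norm _) (norm_nonneg _)

theorem norm_seqConv_le {a u : ℤ → ℂ} (ha : Summable fun k => ‖a k‖)
    (hu : Summable fun k => ‖u k‖) (m : ℤ) : ‖seqConv a u m‖ ≤ ∑' j, ‖a (m - j)‖ * ‖u j‖ := by
  have h := norm_tsum_le_tsum_norm (summable_norm_conv_terms ha hu m)
  simp only [norm_mul] at h
  exact h

theorem summable_norm_mul_norm_prod {u w : ℤ → ℂ} (hu : Summable fun k => ‖u k‖)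
    (hw : Summable fun k => ‖w k‖) : Summable fun p : ℤ × ℤ => ‖u p.1‖ * ‖w p.2‖ :=
  Summable.mul_of_nonneg (f := fun k => ‖u k‖) (g := fun k => ‖w k‖) hu hw
    (fun _ => norm_nonneg _) (fun _ => norm_nonneg _)

theorem summable_norm_seqConv_prod {a u : ℤ → ℂ} (ha : Summable fun k => ‖a k‖)
    (hu : Summable fun k => ‖u k‖) :
    Summable fun p : ℤ × ℤ => ‖a (p.1 - p.2)‖ * ‖u p.2‖ := by
  have h : Summable fun p : ℤ × ℤ => ‖a p.1‖ * ‖u p.2‖ :=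
    summable_norm_mul_norm_prod ha hu
  exact (shearEquiv.summable_iff (f := fun p : ℤ × ℤ => ‖a p.1‖ * ‖u p.2‖)).2 h

theorem summable_norm_seqConv {a u : ℤ → ℂ} (ha : Summable fun k => ‖a k‖)
    (hu : Summable fun k => ‖u k‖) : Summable fun m => ‖seqConv a u m‖ :=
  Summable.of_nonneg_of_le (fun _ => norm_nonneg _) (norm_seqConv_le ha hu)
    (summable_norm_seqConv_prod ha hu).prod

theorem tsum_norm_seqConv_le {a u : ℤ → ℂ} (ha : Summable fun k => ‖a k‖)
    (hu : Summable fun k => ‖u k‖) :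
    ∑' m, ‖seqConv a u m‖ ≤ (∑' k, ‖a k‖) * ∑' k, ‖u k‖ := by
  have h := summable_norm_seqConv_prod ha hu
  calc ∑' m, ‖seqConv a u m‖ ≤ ∑' m, ∑' j, ‖a (m - j)‖ * ‖u j‖ :=
        (summable_norm_seqConv ha hu).tsum_le_tsum (norm_seqConv_le ha hu) h.prod
    _ = ∑' p : ℤ × ℤ, ‖a (p.1 - p.2)‖ * ‖u p.2‖ := h.tsum_prod.symm
    _ = ∑' p : ℤ × ℤ, ‖a p.1‖ * ‖u p.2‖ :=
        shearEquiv.tsum_eq (fun p : ℤ × ℤ => ‖a p.1‖ * ‖u p.2‖)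
    _ = (∑' k, ‖a k‖) * ∑' k, ‖u k‖ :=
        (ha.tsum_mul_tsum hu (summable_norm_mul_norm_prod ha hu)).symm

theorem seqConv_add {a u v : ℤ → ℂ} (ha : Summable fun k => ‖a k‖)
    (hu : Summable fun k => ‖u k‖) (hv : Summable fun k => ‖v k‖) :
    seqConv a (u + v) = seqConv a u + seqConv a v := by
  ext m
  simp only [seqConv, Pi.add_apply, mul_add]
  exact (summable_norm_conv_terms ha hu m).of_norm.tsum_add
    (summable_norm_conv_terms ha hv m).of_norm

theorem seqConv_smul (a u : ℤ → ℂ) (c : ℂ) : seqConv a (c • u) = c • seqConv a u := by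
  ext m
  simp only [seqConv, Pi.smul_apply, smul_eq_mul, ← tsum_mul_left]
  congr 1; ext j; ring

/-- A dual form of Young's inequality, with weights. -/
theorem weighted_seqConv_bound {a u : ℤ → ℂ} (ha : Summable fun k => ‖a k‖)
    (hu : Summable fun k => ‖u k‖) {v b r : ℤ → ℝ} {θ : ℝ}
    (hv0 : ∀ k, 0 ≤ v k) (hr : ∀ k, 0 ≤ r k)
    (hvb : ∀ k j, v k * ‖a (k - j)‖ ≤ b (k - j) * v j)
    (hvu : Summable fun k => v k * ‖u k‖)
    (hrb : ∀ j, Summable fun k => r k * b (k - j))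
    (hb : ∀ k, 0 ≤ b k)
    (hθ : ∀ j, ∑' k, r k * b (k - j) ≤ θ) :
    (Summable fun k => r k * (v k * ‖seqConv a u k‖)) ∧
      ∑' k, r k * (v k * ‖seqConv a u k‖) ≤ θ * ∑' k, v k * ‖u k‖ := by
  have hvu0 : ∀ k, 0 ≤ v k * ‖u k‖ := fun k => mul_nonneg (hv0 _) (norm_nonneg _)
  have hrb0 : ∀ k j, 0 ≤ r k * b (k - j) := fun k j => mul_nonneg (hr _) (hb _)
  obtain ⟨x, hx⟩ : ∃ x : ℤ → ℝ, ∀ k, v k * ‖u k‖ = x k := ⟨_, fun _ => rfl⟩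
  simp only [hx] at hvu hvu0 ⊢
  have hF : Summable fun p : ℤ × ℤ => (r p.2 * b (p.2 - p.1)) * x p.1 := by
    rw [summable_prod_of_nonneg (fun p => mul_nonneg (hrb0 p.2 p.1) (hvu0 p.1))]
    refine ⟨fun j => Summable.mul_right (f := fun k => r k * b (k - j)) (x j) (hrb j), ?_⟩
    have hle : ∀ j, ∑' k, (r k * b (k - j)) * x j ≤ θ * x j := fun j => by
      rw [tsum_mul_right]
      exact mul_le_mul_of_nonneg_right (hθ j) (hvu0 j)
    exact Summable.of_nonneg_of_le
      (fun j => tsum_nonneg fun k => mul_nonneg (hrb0 k j) (hvu0 j)) hle (hvu.mul_left θ)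
  have hF' : Summable fun p : ℤ × ℤ => (r p.1 * b (p.1 - p.2)) * x p.2 :=
    (Equiv.prodComm ℤ ℤ).summable_iff
      (f := fun p : ℤ × ℤ => (r p.2 * b (p.2 - p.1)) * x p.1) |>.2 hF
  have hP : Summable fun k => ∑' j, (r k * b (k - j)) * x j := hF'.prod
  have hP' : Summable fun j => ∑' k, (r k * b (k - j)) * x j := hF.prod
  have hfac : ∀ k, Summable fun j => (r k * b (k - j)) * x j := fun k => hF'.prod_factor k
  have hle : ∀ k, r k * (v k * ‖seqConv a u k‖) ≤
      ∑' j, (r k * b (k - j)) * x j := by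
    intro k
    have h1 : ‖seqConv a u k‖ ≤ _ := norm_seqConv_le ha hu k
    have hs : Summable fun j => ‖a (k - j)‖ * ‖u j‖ := by
      simpa only [norm_mul] using summable_norm_conv_terms ha hu k
    calc r k * (v k * ‖seqConv a u k‖) ≤ r k * (v k * ∑' j, ‖a (k - j)‖ * ‖u j‖) := by
          have := hr k; have := hv0 k; gcongr
      _ = ∑' j, r k * (v k * (‖a (k - j)‖ * ‖u j‖)) := by rw [tsum_mul_left, tsum_mul_left]
      _ ≤ ∑' j, (r k * b (k - j)) * x j := by
          have hs' : Summable fun j => r k * (v k * (‖a (k - j)‖ * ‖u j‖)) :=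
            (hs.mul_left (v k)).mul_left (r k)
          refine Summable.tsum_le_tsum (fun j => ?_) hs' (hfac k)
          have := mul_le_mul_of_nonneg_right (hvb k j) (norm_nonneg (u j))
          rw [mul_assoc (b (k - j)), hx, mul_assoc (v k)] at this
          rw [mul_assoc]
          exact mul_le_mul_of_nonneg_left this (hr k)
  have hS : Summable fun k => r k * (v k * ‖seqConv a u k‖) :=
    Summable.of_nonneg_of_le (fun k => mul_nonneg (hr _) (mul_nonneg (hv0 _) (norm_nonneg _)))
      hle hP
  refine ⟨hS, ?_⟩
  calc ∑' k, r k * (v k * ‖seqConv a u k‖)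
      ≤ ∑' k, ∑' j, (r k * b (k - j)) * x j := hS.tsum_le_tsum hle hP
    -- After the exchange of sums the column bound `hθ` applies, uniformly in `j`.
    _ = ∑' j, ∑' k, (r k * b (k - j)) * x j :=
        (Summable.tsum_comm (f := fun k j => (r k * b (k - j)) * x j) hF').symm
    _ ≤ ∑' j, θ * x j := by
        refine Summable.tsum_le_tsum (fun j => ?_) hP' (hvu.mul_left θ)
        rw [tsum_mul_right]
        exact mul_le_mul_of_nonneg_right (hθ j) (hvu0 j)
    _ = θ * ∑' k, x k := tsum_mul_left

/-- The reflection `k ↦ -k - s`, which exchanges the modes `2 k + s` and `-(2 k + s)`. -/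
def reflectEquiv (s : ℤ) : ℤ ≃ ℤ where
  toFun k := -k - s
  invFun k := -k - s
  left_inv k := by ring
  right_inv k := by ring

/-- Multiplication by a function is symmetric for the bilinear form `∫ f g`, which in coefficients
pairs the modes `2 k + s` and `-(2 k + s)`. No conjugate occurs, so complex potentials are covered.
-/
theorem seqConv_pairing {a u w : ℤ → ℂ} (ha : Summable fun k => ‖a k‖)
    (hu : Summable fun k => ‖u k‖) (hw : Summable fun k => ‖w k‖) (s : ℤ) :
    ∑' k, seqConv a u k * w (-k - s) = ∑' k, u k * seqConv a w (-k - s) := by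
  have hw' : Summable fun k => ‖w (-k - s)‖ := by
    exact (reflectEquiv s).summable_iff (f := fun k => ‖w k‖) |>.2 hw
  have hF : Summable fun p : ℤ × ℤ => a (p.1 - p.2) * u p.2 * w (-p.1 - s) := by
    refine Summable.of_norm_bounded
      (g := fun p : ℤ × ℤ => (∑' j, ‖a j‖) * (‖w (-p.1 - s)‖ * ‖u p.2‖)) ?_ fun p => ?_
    · exact (summable_norm_mul_norm_prod (u := fun k => w (-k - s)) hw' hu).mul_left _
    · rw [norm_mul, norm_mul]
      calc _ ≤ (∑' j, ‖a j‖) * ‖u p.2‖ * ‖w (-p.1 - s)‖ := by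
            gcongr; exact ha.bounded_norm _
        _ = _ := by ring
  have e : ∀ k, u k * seqConv a w (-k - s) = ∑' m, a (m - k) * u k * w (-m - s) := by
    intro k
    rw [seqConv, ← tsum_mul_left]
    rw [← (reflectEquiv s).tsum_eq (fun j => u k * (a (-k - s - j) * w j))]
    congr 1; ext m
    have : -k - s - (-m - s) = m - k := by ring
    simp only [reflectEquiv, Equiv.coe_fn_mk, this]
    ring
  simp_rw [e]
  refine Eq.trans ?_ (Summable.tsum_comm (f := fun m k => a (m - k) * u k * w (-m - s)) hF).symm
  congr 1; ext k
  rw [seqConv, tsum_mul_right]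

/-- The equation and the weighted Young inequality give `‖u‖₁ ≤ ‖u‖₁ / 4`. The alternative `u k = 0`
accounts for modes where `d k` may be small. -/
theorem eq_zero_of_resolvent_bound {a u : ℤ → ℂ} (ha : Summable fun k => ‖a k‖)
    (hu : Summable fun k => ‖u k‖) {d : ℤ → ℂ} {r : ℤ → ℝ} {t : ℂ} (ht : ‖t‖ ≤ 1)
    (hr : ∀ k, 0 ≤ r k)
    (hrb : ∀ j, Summable fun k => r k * ‖a (k - j)‖)
    (hθ : ∀ j, ∑' k, r k * ‖a (k - j)‖ ≤ 1 / 4)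
    (hd : ∀ k, u k = 0 ∨ (1 ≤ r k * ‖d k‖ ∧ d k * u k + t * seqConv a u k = 0)) : u = 0 := by
  obtain ⟨h1, h2⟩ := weighted_seqConv_bound ha hu (v := fun _ => 1) (b := fun k => ‖a k‖) (r := r)
    (θ := 1 / 4) (fun _ => zero_le_one) hr (fun k j => by simp) (by simpa using hu) hrb
    (fun _ => norm_nonneg _) hθ
  simp only [one_mul] at h1 h2
  have hle : ∀ k, ‖u k‖ ≤ r k * ‖seqConv a u k‖ := by
    intro k
    rcases hd k with h | ⟨h, h'⟩
    · rw [h, norm_zero]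
      exact mul_nonneg (hr k) (norm_nonneg _)
    · have e : ‖d k‖ * ‖u k‖ = ‖t‖ * ‖seqConv a u k‖ := by
        rw [← norm_mul, ← norm_mul, eq_neg_of_add_eq_zero_left h', norm_neg]
      calc ‖u k‖ ≤ (r k * ‖d k‖) * ‖u k‖ := le_mul_of_one_le_left (norm_nonneg _) h
        _ = r k * (‖t‖ * ‖seqConv a u k‖) := by rw [mul_assoc, e]
        _ ≤ r k * (1 * ‖seqConv a u k‖) := by have := hr k; gcongr
        _ = _ := by ring
  have h3 : ∑' k, ‖u k‖ ≤ 1 / 4 * ∑' k, ‖u k‖ := (hu.tsum_le_tsum hle h1).trans h2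
  have h4 : ∑' k, ‖u k‖ = 0 :=
    le_antisymm (by linarith) (tsum_nonneg fun _ => norm_nonneg _)
  ext k
  have := (hasSum_zero_iff_of_nonneg (f := fun k => ‖u k‖) (fun _ => norm_nonneg _)).1
    (h4 ▸ hu.hasSum)
  simpa using congrFun this k

/-! ### Resolvent sums -/

theorem hasSum_int_inv_sq : HasSum (fun j : ℤ => 1 / (j : ℝ) ^ 2) (Real.pi ^ 2 / 3) := by
  have h := hasSum_zeta_two
  have h1 : HasSum (fun n : ℕ => 1 / ((n : ℤ) : ℝ) ^ 2) (Real.pi ^ 2 / 6) := by simpa using h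
  have h2 : HasSum (fun n : ℕ => 1 / ((-(n : ℤ) : ℤ) : ℝ) ^ 2) (Real.pi ^ 2 / 6) := by
    simpa using h
  have := HasSum.of_nat_of_neg (f := fun j : ℤ => 1 / (j : ℝ) ^ 2) h1 h2
  have e : Real.pi ^ 2 / 6 + Real.pi ^ 2 / 6 - 1 / ((0 : ℤ) : ℝ) ^ 2 = Real.pi ^ 2 / 3 := by
    norm_num; ring
  rwa [e] at this

/-- These are terms of the sum of `1 / j²` over all integers, which is `π² / 3 < 4`; the term at `0`
counts as `1 / 0 = 0`. -/
theorem summable_shifted_inv_sq (p : ℤ) :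
    (Summable fun k : ℤ => 1 / ((2 * k + p : ℤ) : ℝ) ^ 2) ∧
      ∑' k : ℤ, 1 / ((2 * k + p : ℤ) : ℝ) ^ 2 ≤ 4 := by
  have hinj : Function.Injective fun k : ℤ => 2 * k + p := fun x y h => by
    have h' : 2 * x + p = 2 * y + p := h
    omega
  refine ⟨hasSum_int_inv_sq.summable.comp_injective hinj, ?_⟩
  have h := tsum_comp_le_tsum_of_inj hasSum_int_inv_sq.summable
    (fun j => by positivity) hinj
  rw [hasSum_int_inv_sq.tsum_eq] at h
  refine le_trans h ?_
  nlinarith [Real.pi_lt_d2, Real.pi_pos]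

/-- With `x = 2 k + s - n` and `y = 2 k + s + n`, the distance of the free eigenvalue to `n² π²` is
`π² |x y|`. As `x` and `y` are nonzero integers with `y - x = 2 n`, one has `|x y| ≥ n`, so the loss
of `4 n` from the width of the strip still leaves `(9 - 4) |x y|`. Finally `x² + y² ≥ n²` splits `1
/ (x y)²` into two summable pieces. -/
theorem inv_norm_freeEigenvalue_sub_sq_le {n : ℕ} (hn : 1 ≤ n) {s k : ℤ} {z : ℂ}
    (hz : |z.re - (n : ℝ) ^ 2 * Real.pi ^ 2| ≤ 4 * n)
    (h1 : 2 * k + s ≠ n) (h2 : 2 * k + s ≠ -n) :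
    0 < ‖(freeEigenvalue s k : ℂ) - z‖ ∧ (‖(freeEigenvalue s k : ℂ) - z‖⁻¹) ^ 2 ≤
      1 / (25 * (n : ℝ) ^ 2) *
        (1 / ((2 * k + (s - n) : ℤ) : ℝ) ^ 2 + 1 / ((2 * k + (s + n) : ℤ) : ℝ) ^ 2) := by
  set x : ℤ := 2 * k + (s - n) with hx
  set y : ℤ := 2 * k + (s + n) with hy
  have hx0 : x ≠ 0 := by omega
  have hy0 : y ≠ 0 := by omega
  have hn' : (1 : ℝ) ≤ n := by exact_mod_cast hn
  have hyx : (y : ℝ) - x = 2 * n := by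
    have : y - x = 2 * n := by omega
    exact_mod_cast this
  have hx1 : (1 : ℝ) ≤ |(x : ℝ)| := by exact_mod_cast Int.one_le_abs hx0
  have hy1 : (1 : ℝ) ≤ |(y : ℝ)| := by exact_mod_cast Int.one_le_abs hy0
  have hmax : (n : ℝ) ≤ |(x : ℝ)| ∨ (n : ℝ) ≤ |(y : ℝ)| := by
    by_contra! h
    have : |(y : ℝ) - x| ≤ |(y : ℝ)| + |(x : ℝ)| := abs_sub _ _
    rw [hyx, abs_of_nonneg (by positivity)] at this
    linarith
  have hprod : (n : ℝ) ≤ |(x : ℝ)| * |(y : ℝ)| := by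
    rcases hmax with h | h <;> nlinarith
  have hfe : freeEigenvalue s k - (n : ℝ) ^ 2 * Real.pi ^ 2 = Real.pi ^ 2 * (x * y) := by
    have : ((2 * k + s : ℤ) : ℝ) ^ 2 - (n : ℝ) ^ 2 = x * y := by
      rw [hx, hy]; push_cast; ring
    rw [freeEigenvalue, ← this]; ring
  have hpi : (9 : ℝ) ≤ Real.pi ^ 2 := by nlinarith [Real.pi_gt_three]
  have hlow : 5 * (|(x : ℝ)| * |(y : ℝ)|) ≤ ‖(freeEigenvalue s k : ℂ) - z‖ := by
    have hre : |freeEigenvalue s k - z.re| ≤ ‖(freeEigenvalue s k : ℂ) - z‖ := by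
      have := Complex.abs_re_le_norm ((freeEigenvalue s k : ℂ) - z)
      simpa using this
    refine le_trans ?_ hre
    have h3 : |freeEigenvalue s k - (n : ℝ) ^ 2 * Real.pi ^ 2| ≤
        |freeEigenvalue s k - z.re| + |z.re - (n : ℝ) ^ 2 * Real.pi ^ 2| :=
      abs_sub_le _ _ _
    rw [hfe, abs_mul, abs_mul, abs_of_nonneg (by positivity : (0 : ℝ) ≤ Real.pi ^ 2)] at h3
    nlinarith [mul_nonneg (abs_nonneg (x : ℝ)) (abs_nonneg (y : ℝ))]
  have hxy : 0 < |(x : ℝ)| * |(y : ℝ)| := by positivity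
  refine ⟨by linarith, ?_⟩
  have h5 : (‖(freeEigenvalue s k : ℂ) - z‖⁻¹) ^ 2 ≤ ((5 * (|(x : ℝ)| * |(y : ℝ)|))⁻¹) ^ 2 := by
    gcongr
  refine h5.trans ?_
  have hxx : (0 : ℝ) < (x : ℝ) ^ 2 := by positivity
  have hyy : (0 : ℝ) < (y : ℝ) ^ 2 := by positivity
  have e1 : ((5 * (|(x : ℝ)| * |(y : ℝ)|))⁻¹) ^ 2 = 1 / (25 * ((x : ℝ) ^ 2 * (y : ℝ) ^ 2)) := by
    rw [inv_pow, mul_pow, mul_pow, sq_abs, sq_abs]; norm_num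
  have e2 : 1 / (25 * (n : ℝ) ^ 2) * (1 / (x : ℝ) ^ 2 + 1 / (y : ℝ) ^ 2) =
      ((x : ℝ) ^ 2 + (y : ℝ) ^ 2) / (25 * (n : ℝ) ^ 2 * ((x : ℝ) ^ 2 * (y : ℝ) ^ 2)) := by
    field_simp; ring
  rw [e1, e2, div_le_div_iff₀ (by positivity) (by positivity)]
  have hsum : (n : ℝ) ^ 2 ≤ (x : ℝ) ^ 2 + (y : ℝ) ^ 2 := by
    have : (2 * n : ℝ) ^ 2 ≤ 2 * ((x : ℝ) ^ 2 + (y : ℝ) ^ 2) := by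
      rw [← hyx]; nlinarith [sq_nonneg ((x : ℝ) + y)]
    nlinarith
  nlinarith [mul_pos hxx hyy]

/-- The reduced resolvent weights: the modes `±n` are left out. -/
def reducedResolvent (n : ℕ) (s : ℤ) (z : ℂ) (k : ℤ) : ℝ :=
  if 2 * k + s = n ∨ 2 * k + s = -n then 0 else ‖(freeEigenvalue s k : ℂ) - z‖⁻¹

theorem reducedResolvent_nonneg (n : ℕ) (s : ℤ) (z : ℂ) (k : ℤ) :
    0 ≤ reducedResolvent n s z k := by
  unfold reducedResolvent; split_ifs <;> positivity

theorem summable_reducedResolvent_sq {n : ℕ} (hn : 1 ≤ n) (s : ℤ) {z : ℂ}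
    (hz : |z.re - (n : ℝ) ^ 2 * Real.pi ^ 2| ≤ 4 * n) :
    (Summable fun k => reducedResolvent n s z k ^ 2) ∧
      ∑' k, reducedResolvent n s z k ^ 2 ≤ 8 / (25 * (n : ℝ) ^ 2) := by
  obtain ⟨h1, h1'⟩ := summable_shifted_inv_sq (s - n)
  obtain ⟨h2, h2'⟩ := summable_shifted_inv_sq (s + n)
  have hle : ∀ k, reducedResolvent n s z k ^ 2 ≤ 1 / (25 * (n : ℝ) ^ 2) *
        (1 / ((2 * k + (s - n) : ℤ) : ℝ) ^ 2 + 1 / ((2 * k + (s + n) : ℤ) : ℝ) ^ 2) := by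
    intro k
    unfold reducedResolvent
    split_ifs with h
    · rw [zero_pow two_ne_zero]; positivity
    · rw [not_or] at h
      exact (inv_norm_freeEigenvalue_sub_sq_le hn hz h.1 h.2).2
  have hS := Summable.of_nonneg_of_le (fun k => sq_nonneg _) hle ((h1.add h2).mul_left _)
  refine ⟨hS, (hS.tsum_le_tsum hle ((h1.add h2).mul_left _)).trans ?_⟩
  rw [tsum_mul_left, h1.tsum_add h2]
  calc 1 / (25 * (n : ℝ) ^ 2) * _ ≤ 1 / (25 * (n : ℝ) ^ 2) * (4 + 4) := by gcongr
    _ = _ := by ring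

/-- The Cauchy–Schwarz inequality in the form `r b ≤ (n² / 4) r² + b² / n²`; the two sums contribute
`1/8` and `1/16`. -/
theorem schur_bound_of_sq {n : ℕ} (hn : 1 ≤ n) {r b : ℤ → ℝ} (hr : ∀ k, 0 ≤ r k)
    (hb : ∀ k, 0 ≤ b k) (hrs : Summable fun k => r k ^ 2)
    (hrn : ∑' k, r k ^ 2 ≤ 1 / (2 * (n : ℝ) ^ 2))
    (hbs : Summable fun k => b k ^ 2) (hbn : ∑' k, b k ^ 2 ≤ (n : ℝ) ^ 2 / 16) (j : ℤ) :
    (Summable fun k => r k * b (k - j)) ∧ ∑' k, r k * b (k - j) ≤ 1 / 4 := by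
  have hn' : (1 : ℝ) ≤ n := by exact_mod_cast hn
  have hle : ∀ k, r k * b (k - j) ≤ (n : ℝ) ^ 2 / 4 * r k ^ 2 + 1 / (n : ℝ) ^ 2 * b (k - j) ^ 2 := by
    intro k
    have h : 0 ≤ ((n : ℝ) / 2 * r k - 1 / (n : ℝ) * b (k - j)) ^ 2 := sq_nonneg _
    have e : ((n : ℝ) / 2 * r k - 1 / (n : ℝ) * b (k - j)) ^ 2 =
      (n : ℝ) ^ 2 / 4 * r k ^ 2 + 1 / (n : ℝ) ^ 2 * b (k - j) ^ 2 - r k * b (k - j) := by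
      field_simp; ring
    linarith
  have hbj : Summable fun k => b (k - j) ^ 2 :=
    (Equiv.subRight j).summable_iff (f := fun k => b k ^ 2) |>.2 hbs
  have hbj' : ∑' k, b (k - j) ^ 2 = ∑' k, b k ^ 2 :=
    (Equiv.subRight j).tsum_eq (fun k => b k ^ 2)
  have hG := (hrs.mul_left ((n : ℝ) ^ 2 / 4)).add (hbj.mul_left (1 / (n : ℝ) ^ 2))
  have hS := Summable.of_nonneg_of_le (fun k => mul_nonneg (hr k) (hb (k - j))) hle hG
  refine ⟨hS, (hS.tsum_le_tsum hle hG).trans ?_⟩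
  rw [(hrs.mul_left _).tsum_add (hbj.mul_left _), tsum_mul_left, tsum_mul_left, hbj']
  calc _ ≤ (n : ℝ) ^ 2 / 4 * (1 / (2 * (n : ℝ) ^ 2)) + 1 / (n : ℝ) ^ 2 * ((n : ℝ) ^ 2 / 16) := by
        gcongr
    _ = 3 / 16 := by field_simp; norm_num
    _ ≤ 1 / 4 := by norm_num

end

/-! ### Reduction to the two modes `±n` and closeness of eigenvalues in a strip -/

noncomputable section

/-- Absolutely summable sequences on `ℤ`. -/
abbrev SeqSpace : Type := lp (fun _ : ℤ => ℂ) 1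

theorem SeqSpace.summable (u : SeqSpace) : Summable fun k => ‖u k‖ := by
  simpa using (lp.memℓp u).summable (by simp)

theorem SeqSpace.norm_eq (u : SeqSpace) : ‖u‖ = ∑' k, ‖u k‖ := by
  rw [lp.norm_eq_tsum_rpow (by simp) u]; simp

/-- An absolutely summable sequence as an element of `SeqSpace`. -/
def SeqSpace.mk (f : ℤ → ℂ) (hf : Summable fun k => ‖f k‖) : SeqSpace :=
  ⟨f, memℓp_gen (by simpa using hf)⟩

@[simp] theorem SeqSpace.mk_apply (f : ℤ → ℂ) (hf : Summable fun k => ‖f k‖) (k : ℤ) :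
    SeqSpace.mk f hf k = f k := rfl

/-- Convolution by an absolutely summable sequence. -/
def convCLM (a : ℤ → ℂ) (ha : Summable fun k => ‖a k‖) : SeqSpace →L[ℂ] SeqSpace :=
  LinearMap.mkContinuous
    { toFun := fun u => SeqSpace.mk (seqConv a u) (summable_norm_seqConv ha u.summable)
      map_add' := fun u v => by
        ext k
        exact congrFun (seqConv_add ha u.summable v.summable) k
      map_smul' := fun c u => by
        ext k
        exact congrFun (seqConv_smul a u c) k } (∑' k, ‖a k‖) fun u => by
    rw [SeqSpace.norm_eq, SeqSpace.norm_eq]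
    exact tsum_norm_seqConv_le ha u.summable

@[simp] theorem convCLM_apply (a : ℤ → ℂ) (ha : Summable fun k => ‖a k‖) (u : SeqSpace) (k : ℤ) :
    convCLM a ha u k = seqConv a u k := rfl

theorem norm_convCLM_le (a : ℤ → ℂ) (ha : Summable fun k => ‖a k‖) (u : SeqSpace) :
    ‖convCLM a ha u‖ ≤ (∑' k, ‖a k‖) * ‖u‖ := by
  rw [SeqSpace.norm_eq, SeqSpace.norm_eq]
  exact tsum_norm_seqConv_le ha u.summable

theorem summable_norm_mul_bounded {g : ℤ → ℂ} {C : ℝ} (hg : ∀ k, ‖g k‖ ≤ C) {u : ℤ → ℂ}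
    (hu : Summable fun k => ‖u k‖) : Summable fun k => ‖g k * u k‖ :=
  Summable.of_nonneg_of_le (fun _ => norm_nonneg _)
    (fun k => by rw [norm_mul]; exact mul_le_mul_of_nonneg_right (hg k) (norm_nonneg _))
    (hu.mul_left C)

/-- Multiplication by a bounded sequence. -/
def diagCLM (g : ℤ → ℂ) (C : ℝ) (hg : ∀ k, ‖g k‖ ≤ C) : SeqSpace →L[ℂ] SeqSpace :=
  LinearMap.mkContinuous
    { toFun := fun u => SeqSpace.mk (fun k => g k * u k) (summable_norm_mul_bounded hg u.summable)
      map_add' := fun u v => by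
        ext k
        exact mul_add _ _ _
      map_smul' := fun c u => by
        ext k
        exact mul_left_comm _ _ _ } C fun u => by
    rw [SeqSpace.norm_eq, SeqSpace.norm_eq, ← tsum_mul_left]
    refine Summable.tsum_le_tsum (fun k => ?_) (summable_norm_mul_bounded hg u.summable)
      (u.summable.mul_left C)
    change ‖g k * u k‖ ≤ _
    rw [norm_mul]; exact mul_le_mul_of_nonneg_right (hg k) (norm_nonneg _)

@[simp] theorem diagCLM_apply (g : ℤ → ℂ) (C : ℝ) (hg : ∀ k, ‖g k‖ ≤ C) (u : SeqSpace) (k : ℤ) :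
    diagCLM g C hg u k = g k * u k := rfl

theorem norm_diagCLM_le (g : ℤ → ℂ) (C : ℝ) (hC : 0 ≤ C) (hg : ∀ k, ‖g k‖ ≤ C) :
    ‖diagCLM g C hg‖ ≤ C := LinearMap.mkContinuous_norm_le _ hC _

/-- A solution of the eigenvalue equation off the modes `±n`, normalized at the mode `m₀`. -/
structure IsQuasimode (a : ℤ → ℂ) (s : ℤ) (n : ℕ) (z : ℂ) (m₀ : ℤ) (u : ℤ → ℂ) : Prop where
  summable : Summable fun k => ‖u k‖
  eq_one : u m₀ = 1
  eq_zero : u (-m₀ - s) = 0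
  equation : ∀ k, 2 * k + s ≠ n → 2 * k + s ≠ -n →
    ((freeEigenvalue s k : ℂ) - z) * u k + seqConv a u k = 0
  tsum_le : ∑' k, ‖u k‖ ≤ 4 / 3

theorem reducedResolvent_sq_le {n : ℕ} (hn : 1 ≤ n) (s : ℤ) {z : ℂ}
    (hz : |z.re - (n : ℝ) ^ 2 * Real.pi ^ 2| ≤ 4 * n) :
    ∑' k, reducedResolvent n s z k ^ 2 ≤ 1 / (2 * (n : ℝ) ^ 2) := by
  refine (summable_reducedResolvent_sq hn s hz).2.trans ?_
  have : (1 : ℝ) ≤ n := by exact_mod_cast hn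
  rw [div_le_div_iff₀ (by positivity) (by positivity)]
  nlinarith [sq_nonneg (n : ℝ)]

theorem reducedResolvent_le_one {n : ℕ} (hn : 1 ≤ n) (s : ℤ) {z : ℂ}
    (hz : |z.re - (n : ℝ) ^ 2 * Real.pi ^ 2| ≤ 4 * n) (k : ℤ) :
    reducedResolvent n s z k ≤ 1 := by
  have h1 := (summable_reducedResolvent_sq hn s hz).1.le_tsum k fun _ _ => sq_nonneg _
  have h2 := reducedResolvent_sq_le hn s hz
  have hn' : (1 : ℝ) ≤ n := by exact_mod_cast hn
  have h3 : 1 / (2 * (n : ℝ) ^ 2) ≤ 1 := by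
    rw [div_le_one (by positivity)]; nlinarith
  have h4 := reducedResolvent_nonneg n s z k
  nlinarith

section Weights

variable {a : ℤ → ℂ} {α : ℝ} {n : ℕ}

theorem norm_le_exp_mul_norm (hα : 0 ≤ α) (a : ℤ → ℂ) (k : ℤ) :
    ‖a k‖ ≤ Real.exp (α * |(k : ℝ)|) * ‖a k‖ :=
  le_mul_of_one_le_left (norm_nonneg _) (Real.one_le_exp (by positivity))

theorem summable_sq_of_exp (hα : 0 ≤ α)
    (hb : Summable fun k : ℤ => (Real.exp (α * |(k : ℝ)|) * ‖a k‖) ^ 2)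
    (hbn : ∑' k : ℤ, (Real.exp (α * |(k : ℝ)|) * ‖a k‖) ^ 2 ≤ (n : ℝ) ^ 2 / 16) :
    (Summable fun k => ‖a k‖ ^ 2) ∧ ∑' k, ‖a k‖ ^ 2 ≤ (n : ℝ) ^ 2 / 16 := by
  have hle : ∀ k, ‖a k‖ ^ 2 ≤ (Real.exp (α * |(k : ℝ)|) * ‖a k‖) ^ 2 := fun k => by
    have := norm_le_exp_mul_norm hα a k
    gcongr
  have hs := Summable.of_nonneg_of_le (fun k => sq_nonneg ‖a k‖) hle hb
  exact ⟨hs, (hs.tsum_le_tsum hle hb).trans hbn⟩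

/-- The quasimode is the fixed point of `u = δ_{m₀} + T u` with `‖T‖ ≤ 1/4`. The same estimate in a
weighted norm shows that its coupling to the opposite mode is exponentially small. -/
theorem exists_quasimode (ha : Summable fun k => ‖a k‖) (hα : 0 ≤ α) (hn : 1 ≤ n) {s m₀ : ℤ}
    (hm₀ : 2 * m₀ + s = n ∨ 2 * m₀ + s = -n) {z : ℂ}
    (hz : |z.re - (n : ℝ) ^ 2 * Real.pi ^ 2| ≤ 4 * n)
    (hb : Summable fun k : ℤ => (Real.exp (α * |(k : ℝ)|) * ‖a k‖) ^ 2)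
    (hbn : ∑' k : ℤ, (Real.exp (α * |(k : ℝ)|) * ‖a k‖) ^ 2 ≤ (n : ℝ) ^ 2 / 16) :
    ∃ u, IsQuasimode a s n z m₀ u ∧
      Real.exp (α * n) * ‖seqConv a u (-m₀ - s)‖ ≤ (n : ℝ) / 3 := by
  have hn' : (1 : ℝ) ≤ n := by exact_mod_cast hn
  obtain ⟨ha2, han⟩ := summable_sq_of_exp hα hb hbn
  obtain ⟨hr2, -⟩ := summable_reducedResolvent_sq hn s hz
  have hrn := reducedResolvent_sq_le hn s hz
  have hr0 := reducedResolvent_nonneg n s z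
  -- The multiplier vanishes at both modes `±n`, which fixes the values `1` and `0` of the fixed
  -- point there.
  set g : ℤ → ℂ := fun k => if 2 * k + s = n ∨ 2 * k + s = -n then 0 else
    -((freeEigenvalue s k : ℂ) - z)⁻¹ with hg
  have hgr : ∀ k, ‖g k‖ = reducedResolvent n s z k := by
    intro k
    simp only [hg, reducedResolvent]
    split_ifs <;> simp
  have hg1 : ∀ k, ‖g k‖ ≤ 1 := fun k => (hgr k).trans_le (reducedResolvent_le_one hn s hz k)
  set T : SeqSpace →L[ℂ] SeqSpace := (diagCLM g 1 hg1).comp (convCLM a ha) with hT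
  have hTn : ‖T‖ ≤ 1 / 4 := by
    refine T.opNorm_le_bound (by norm_num) fun u => ?_
    obtain ⟨h1, h2⟩ := weighted_seqConv_bound ha u.summable (v := fun _ => 1)
      (b := fun k => ‖a k‖) (r := reducedResolvent n s z)
      (θ := 1 / 4) (fun _ => zero_le_one) hr0 (fun k j => by simp) (by simpa using u.summable)
      (fun j => (schur_bound_of_sq hn hr0 (fun _ => norm_nonneg _) hr2 hrn ha2 han j).1)
      (fun _ => norm_nonneg _)
      (fun j => (schur_bound_of_sq hn hr0 (fun _ => norm_nonneg _) hr2 hrn ha2 han j).2)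
    simp only [one_mul] at h1 h2
    rw [SeqSpace.norm_eq, SeqSpace.norm_eq]
    refine le_of_eq_of_le (tsum_congr fun k => ?_) h2
    change ‖g k * seqConv a u k‖ = _
    rw [norm_mul, hgr]
  have hcontr : ContractingWith (1 / 4 : NNReal) fun u : SeqSpace => lp.single 1 m₀ 1 + T u := by
    refine ⟨by
      rw [← NNReal.coe_lt_coe]; norm_num, LipschitzWith.of_dist_le_mul fun u v => ?_⟩
    rw [dist_add_left, dist_eq_norm, dist_eq_norm, ← map_sub]
    refine (T.le_opNorm _).trans ?_
    gcongr
    simpa using hTn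
  set u := ContractingWith.fixedPoint _ hcontr with hu_def
  have hu : lp.single 1 m₀ 1 + T u = u := hcontr.fixedPoint_isFixedPt
  have huk : ∀ k, u k = (if k = m₀ then 1 else 0) + g k * seqConv a u k := by
    intro k
    conv_lhs => rw [← hu]
    rw [lp.coeFn_add, Pi.add_apply, lp.single_apply]
    congr 1
    by_cases h : k = m₀
    · subst h; simp
    · simp [h]
  have hm₁ : 2 * (-m₀ - s) + s = n ∨ 2 * (-m₀ - s) + s = -n := by omega
  have hne : -m₀ - s ≠ m₀ := by omega
  -- The weight grows exponentially away from `m₀`; it is `1` at `m₀` and `e^{α n}` at the opposite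
  -- index `-m₀ - s`, at distance `n`. The truncation by `n` keeps it bounded, so weighted sums
  -- converge a priori, and preserves `v k ≤ e^{α|k - j|} v j`.
  set v : ℤ → ℝ := fun k => Real.exp (α * min |(k : ℝ) - m₀| n) with hv
  have hv0 : ∀ k, 0 ≤ v k := fun k => (Real.exp_pos _).le
  have hvm : v m₀ = 1 := by simp [hv]
  have hvb : ∀ k j, v k * ‖a (k - j)‖ ≤
      (Real.exp (α * |((k - j : ℤ) : ℝ)|) * ‖a (k - j)‖) * v j := by
    intro k j
    have h1 : min |(k : ℝ) - m₀| n ≤ |((k - j : ℤ) : ℝ)| + min |(j : ℝ) - m₀| n := by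
      rw [← min_add_add_left]
      refine min_le_min ?_ (le_add_of_nonneg_left (abs_nonneg _))
      push_cast
      exact abs_sub_le _ _ _
    have h2 : v k ≤ Real.exp (α * |((k - j : ℤ) : ℝ)|) * v j := by
      rw [hv]
      simp only
      rw [← Real.exp_add, ← mul_add]
      gcongr
    calc v k * ‖a (k - j)‖ ≤ (Real.exp (α * |((k - j : ℤ) : ℝ)|) * v j) * ‖a (k - j)‖ := by gcongr
      _ = _ := by ring
  have hvu : Summable fun k => v k * ‖u k‖ := by
    refine Summable.of_nonneg_of_le (fun k => mul_nonneg (hv0 k) (norm_nonneg _)) (fun k => ?_)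
      (u.summable.mul_left (Real.exp (α * n)))
    have : v k ≤ Real.exp (α * n) := by
      rw [hv]
      simp only
      gcongr
      exact min_le_right _ _
    gcongr
  have hb0 : ∀ k : ℤ, 0 ≤ Real.exp (α * |(k : ℝ)|) * ‖a k‖ := fun k => by positivity
  obtain ⟨h1, h2⟩ := weighted_seqConv_bound ha u.summable (v := v)
      (b := fun k : ℤ => Real.exp (α * |(k : ℝ)|) * ‖a k‖) (r := reducedResolvent n s z)
      (θ := 1 / 4) hv0 hr0 hvb hvu
      (fun j => (schur_bound_of_sq hn hr0 hb0 hr2 hrn hb hbn j).1)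
      hb0
      (fun j => (schur_bound_of_sq hn hr0 hb0 hr2 hrn hb hbn j).2)
  -- The weighted norm `S` satisfies `S ≤ 1 + S / 4`.
  have hS : ∑' k, v k * ‖u k‖ ≤ 4 / 3 := by
    have hle : ∀ k, v k * ‖u k‖ ≤
        (if k = m₀ then 1 else 0) + reducedResolvent n s z k * (v k * ‖seqConv a u k‖) := by
      intro k
      have hk : ‖u k‖ ≤ (if k = m₀ then 1 else 0) + reducedResolvent n s z k * ‖seqConv a u k‖ := by
        rw [huk k]
        refine (norm_add_le _ _).trans (add_le_add ?_ ?_)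
        · split_ifs <;> simp
        · rw [norm_mul, hgr]
      calc v k * ‖u k‖ ≤ v k * _ := mul_le_mul_of_nonneg_left hk (hv0 k)
        _ = (if k = m₀ then v k else 0) +
            reducedResolvent n s z k * (v k * ‖seqConv a u k‖) := by
          split_ifs <;> ring
        _ = _ := by
          congr 1
          split_ifs with h
          · rw [h, hvm]
          · rfl
    have hd : Summable fun k : ℤ => if k = m₀ then (1 : ℝ) else 0 := (hasSum_ite_eq m₀ 1).summable
    have := hvu.tsum_le_tsum hle (hd.add h1)
    rw [hd.tsum_add h1, tsum_ite_eq] at this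
    linarith
  refine ⟨u, ⟨u.summable, ?_, ?_, ?_, ?_⟩, ?_⟩
  · rw [huk m₀]
    simp [hg, hm₀]
  · rw [huk (-m₀ - s)]
    simp [hg, hm₁, hne]
  · intro k hk1 hk2
    have hpos := (inv_norm_freeEigenvalue_sub_sq_le hn hz hk1 hk2).1
    have hkm : k ≠ m₀ := by rintro rfl; tauto
    have := huk k
    rw [if_neg hkm, zero_add] at this
    have hgk : g k = -((freeEigenvalue s k : ℂ) - z)⁻¹ := by
      simp only [hg]
      rw [if_neg (by tauto)]
    rw [hgk] at this
    rw [this, neg_mul, mul_neg, mul_inv_cancel_left₀ (norm_pos_iff.1 hpos), neg_add_cancel]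
  · refine le_trans (u.summable.tsum_le_tsum (fun k => ?_) hvu) hS
    exact le_mul_of_one_le_left (norm_nonneg _) (Real.one_le_exp (by positivity))
  · have hvm₁ : v (-m₀ - s) = Real.exp (α * n) := by
      rw [hv]
      simp only
      congr 2
      apply min_eq_right
      have : |((-m₀ - s : ℤ) : ℝ) - m₀| = n := by
        have h : |(-m₀ - s) - m₀| = (n : ℤ) := by
          rcases hm₀ with h | h
          · rw [show -m₀ - s - m₀ = -(n : ℤ) by omega]; simp
          · rw [show -m₀ - s - m₀ = (n : ℤ) by omega]; simp
        exact_mod_cast h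
      rw [this]
    -- Each weighted coefficient is at most `n / 4` by the square sum bound; multiplied by `S ≤ 4 /
    -- 3` this gives `n / 3`.
    have hbk : ∀ k : ℤ, Real.exp (α * |(k : ℝ)|) * ‖a k‖ ≤ n / 4 := fun k => by
      refine abs_le_of_sq_le_sq' ?_ (by positivity) |>.2
      have := hb.le_tsum k fun _ _ => sq_nonneg _
      linarith [this.trans hbn, div_pow (n : ℝ) 4 2]
    have hterm : Summable fun j => ‖a (-m₀ - s - j)‖ * ‖u j‖ := by
      simpa only [norm_mul] using summable_norm_conv_terms ha u.summable (-m₀ - s)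
    rw [← hvm₁]
    calc v (-m₀ - s) * ‖seqConv a u (-m₀ - s)‖
        ≤ v (-m₀ - s) * ∑' j, ‖a (-m₀ - s - j)‖ * ‖u j‖ :=
          mul_le_mul_of_nonneg_left (norm_seqConv_le ha u.summable _) (hv0 _)
      _ = ∑' j, v (-m₀ - s) * (‖a (-m₀ - s - j)‖ * ‖u j‖) := by rw [tsum_mul_left]
      _ ≤ ∑' j, (n / 4 : ℝ) * (v j * ‖u j‖) := by
          refine (hterm.mul_left _).tsum_le_tsum (fun j => ?_) (hvu.mul_left _)
          calc v (-m₀ - s) * (‖a (-m₀ - s - j)‖ * ‖u j‖)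
              = v (-m₀ - s) * ‖a (-m₀ - s - j)‖ * ‖u j‖ := by ring
            _ ≤ (n / 4 * v j) * ‖u j‖ := by
                refine mul_le_mul_of_nonneg_right ((hvb _ j).trans ?_) (norm_nonneg _)
                exact mul_le_mul_of_nonneg_right (hbk _) (hv0 _)
            _ = _ := by ring
      _ = (n / 4 : ℝ) * ∑' j, v j * ‖u j‖ := tsum_mul_left
      _ ≤ (n / 4 : ℝ) * (4 / 3) := by gcongr
      _ = _ := by ring

/-- An eigenvector is determined by its two modes `±n`, which solve a `2 × 2` system. -/
theorem quasimode_determinant (ha : Summable fun k => ‖a k‖) (hn : 1 ≤ n)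
    (ha2 : Summable fun k => ‖a k‖ ^ 2) (han : ∑' k, ‖a k‖ ^ 2 ≤ (n : ℝ) ^ 2 / 16)
    {s m₀ : ℤ} (hm₀ : 2 * m₀ + s = n) {z : ℂ}
    (hz : |z.re - (n : ℝ) ^ 2 * Real.pi ^ 2| ≤ 4 * n)
    {f u w : ℤ → ℂ} (hf : Summable fun k => ‖f k‖) (hf0 : f ≠ 0)
    (hfe : ∀ k, ((freeEigenvalue s k : ℂ) - z) * f k + seqConv a f k = 0)
    (hu : IsQuasimode a s n z m₀ u) (hw : IsQuasimode a s n z (-m₀ - s) w) :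
    (((freeEigenvalue s m₀ : ℂ) - z) + seqConv a u m₀) *
      (((freeEigenvalue s (-m₀ - s) : ℂ) - z) + seqConv a w (-m₀ - s)) =
    seqConv a u (-m₀ - s) * seqConv a w m₀ := by
  have hwz : w m₀ = 0 := by
    have := hw.eq_zero
    rwa [show -(-m₀ - s) - s = m₀ by ring] at this
  obtain ⟨hr2, -⟩ := summable_reducedResolvent_sq hn s hz
  have hrn := reducedResolvent_sq_le hn s hz
  have hr0 := reducedResolvent_nonneg n s z
  have hu' : Summable fun k => ‖(-f m₀ • u) k‖ := by
    simpa [norm_mul] using hu.summable.mul_left ‖f m₀‖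
  have hw' : Summable fun k => ‖(-f (-m₀ - s) • w) k‖ := by
    simpa [norm_mul] using hw.summable.mul_left ‖f (-m₀ - s)‖
  have huw : Summable fun k => ‖(-f m₀ • u + -f (-m₀ - s) • w) k‖ :=
    Summable.of_nonneg_of_le (fun _ => norm_nonneg _) (fun k => norm_add_le _ _) (hu'.add hw')
  have hg : Summable fun k => ‖(f + (-f m₀ • u + -f (-m₀ - s) • w)) k‖ :=
    Summable.of_nonneg_of_le (fun _ => norm_nonneg _) (fun k => norm_add_le _ _) (hf.add huw)
  have hconv : ∀ k, seqConv a (f + (-f m₀ • u + -f (-m₀ - s) • w)) k =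
      seqConv a f k - f m₀ * seqConv a u k - f (-m₀ - s) * seqConv a w k := by
    intro k
    rw [seqConv_add ha hf huw, seqConv_add ha hu' hw', seqConv_smul, seqConv_smul]
    simp only [Pi.add_apply, Pi.smul_apply, smul_eq_mul]
    ring
  -- Subtracting the quasimodes with the right amplitudes removes both modes `±n`, and the remainder
  -- solves the homogeneous equation elsewhere.
  have h0 : f + (-f m₀ • u + -f (-m₀ - s) • w) = 0 := by
    refine eq_zero_of_resolvent_bound ha hg (d := fun k => (freeEigenvalue s k : ℂ) - z)
      (r := reducedResolvent n s z) (t := 1) (by simp) hr0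
      (fun j => (schur_bound_of_sq hn hr0 (fun _ => norm_nonneg _) hr2 hrn ha2 han j).1)
      (fun j => (schur_bound_of_sq hn hr0 (fun _ => norm_nonneg _) hr2 hrn ha2 han j).2)
      fun k => ?_
    by_cases hk1 : 2 * k + s = n
    · left
      obtain rfl : k = m₀ := by omega
      simp [hu.eq_one, hwz]
    by_cases hk2 : 2 * k + s = -n
    · left
      obtain rfl : k = -m₀ - s := by omega
      simp [hu.eq_zero, hw.eq_one]
    right
    constructor
    · rw [reducedResolvent, if_neg (by tauto)]
      have := (inv_norm_freeEigenvalue_sub_sq_le hn hz hk1 hk2).1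
      rw [inv_mul_cancel₀ this.ne']
    · rw [hconv]
      simp only [Pi.add_apply, Pi.smul_apply, smul_eq_mul]
      linear_combination hfe k - f m₀ * hu.equation k hk1 hk2
        - f (-m₀ - s) * hw.equation k hk1 hk2
  have hval : ∀ k, f k = f m₀ * u k + f (-m₀ - s) * w k := fun k => by
    have := congrFun h0 k
    simp only [Pi.add_apply, Pi.smul_apply, smul_eq_mul, Pi.zero_apply] at this
    linear_combination this
  have hcval : ∀ k, seqConv a f k = f m₀ * seqConv a u k + f (-m₀ - s) * seqConv a w k := by
    intro k
    have := hconv k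
    rw [h0] at this
    have hz0 : seqConv a 0 k = 0 := by simp [seqConv]
    rw [hz0] at this
    linear_combination -this
  have e1 := hfe m₀
  have e2 := hfe (-m₀ - s)
  rw [hcval] at e1 e2
  -- The amplitudes at `±n` form a nonzero kernel vector of the 2 × 2 system. Cramer's rule
  -- multiplied by a nonzero amplitude gives the vanishing determinant.
  by_cases hA : f m₀ = 0
  · have hB : f (-m₀ - s) ≠ 0 := by
      intro hB
      apply hf0
      ext k
      rw [hval k, hA, hB]; simp
    apply mul_left_cancel₀ hB
    rw [hA] at e1 e2
    linear_combination (((freeEigenvalue s m₀ : ℂ) - z) + seqConv a u m₀) * e2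
      - seqConv a u (-m₀ - s) * e1
  · apply mul_left_cancel₀ hA
    linear_combination (((freeEigenvalue s (-m₀ - s) : ℂ) - z) + seqConv a w (-m₀ - s)) * e1
      - seqConv a w m₀ * e2

theorem freeEigenvalue_reflect (s k : ℤ) : freeEigenvalue s (-k - s) = freeEigenvalue s k := by
  simp only [freeEigenvalue]; push_cast; ring

/-- The pairing of quasimodes at opposite modes. -/
theorem quasimode_pairing (ha : Summable fun k => ‖a k‖) {s m₀ : ℤ} (hn : 1 ≤ n)
    (hm₀ : 2 * m₀ + s = n) {z₁ z₂ : ℂ} {u w : ℤ → ℂ}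
    (hu : IsQuasimode a s n z₁ m₀ u) (hw : IsQuasimode a s n z₂ (-m₀ - s) w) :
    (((freeEigenvalue s m₀ : ℂ) - z₁) + seqConv a u m₀) -
      (((freeEigenvalue s (-m₀ - s) : ℂ) - z₂) + seqConv a w (-m₀ - s)) =
      (z₂ - z₁) * ∑' k, u k * w (-k - s) := by
  have hwz : w m₀ = 0 := by
    have := hw.eq_zero
    rwa [show -(-m₀ - s) - s = m₀ by ring] at this
  have hne : m₀ ≠ -m₀ - s := by omega
  have hwr : Summable fun k => ‖w (-k - s)‖ :=
    (reflectEquiv s).summable_iff (f := fun k => ‖w k‖) |>.2 hw.summable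
  have hcw : Summable fun k => ‖seqConv a w (-k - s)‖ :=
    (reflectEquiv s).summable_iff (f := fun k => ‖seqConv a w k‖) |>.2
      (summable_norm_seqConv ha hw.summable)
  have mulS : ∀ {x y : ℤ → ℂ}, (Summable fun k => ‖x k‖) → (Summable fun k => ‖y k‖) →
      Summable fun k => x k * y k := fun {x y} hx hy =>
    (summable_norm_mul_bounded (g := x) (fun k => hx.bounded_norm k) hy).of_norm
  have s1 : Summable fun k => u k * w (-k - s) := mulS hu.summable hwr
  have s2 : Summable fun k => seqConv a u k * w (-k - s) :=
    mulS (summable_norm_seqConv ha hu.summable) hwr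
  have s3 : Summable fun k => u k * seqConv a w (-k - s) := mulS hu.summable hcw
  -- Off `±n` the two equations cancel, and at `-m₀ - s` both quasimodes contribute zero; only `k =
  -- m₀` survives. On summation the convolution terms drop out by `seqConv_pairing`.
  have key : ∀ k, (z₂ - z₁) * (u k * w (-k - s)) + (seqConv a u k * w (-k - s)
      - u k * seqConv a w (-k - s)) = if k = m₀ then
      (((freeEigenvalue s m₀ : ℂ) - z₁) + seqConv a u m₀) -
      (((freeEigenvalue s (-m₀ - s) : ℂ) - z₂) + seqConv a w (-m₀ - s)) else 0 := by
    intro k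
    split_ifs with h
    · subst h
      rw [hu.eq_one, hw.eq_one, freeEigenvalue_reflect]; ring
    · by_cases h' : k = -m₀ - s
      · subst h'
        rw [hu.eq_zero, show -(-m₀ - s) - s = m₀ by ring, hwz]; ring
      · have e1 := hu.equation k (by omega) (by omega)
        have e2 := hw.equation (-k - s) (by omega) (by omega)
        rw [freeEigenvalue_reflect] at e2
        linear_combination w (-k - s) * e1 - u k * e2
  have := congrArg (fun g : ℤ → ℂ => ∑' k, g k) (funext key)
  beta_reduce at this
  rw [tsum_ite_eq, (s1.mul_left _).tsum_add (s2.sub s3), s2.tsum_sub s3,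
    seqConv_pairing ha hu.summable hw.summable, sub_self, add_zero, tsum_mul_left] at this
  exact this.symm

/-- The term `k = m₀` equals `1`. Off their normalized modes both quasimodes have `ℓ¹` mass at most
`4/3 - 1 = 1/3`, so the other terms add up to at most `1/9`. -/
theorem quasimode_pairing_lower {s m₀ : ℤ}
    {z₁ z₂ : ℂ} {u w : ℤ → ℂ}
    (hu : IsQuasimode a s n z₁ m₀ u) (hw : IsQuasimode a s n z₂ (-m₀ - s) w) :
    8 / 9 ≤ ‖∑' k, u k * w (-k - s)‖ := by
  have hwr : Summable fun k => ‖w (-k - s)‖ :=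
    (reflectEquiv s).summable_iff (f := fun k => ‖w k‖) |>.2 hw.summable
  have s1 : Summable fun k => ‖u k * w (-k - s)‖ :=
    summable_norm_mul_bounded (fun k => hu.summable.bounded_norm k) hwr
  have hu3 : ∑' k, (if k = m₀ then 0 else ‖u k‖) ≤ 1 / 3 := by
    have := hu.summable.tsum_eq_add_tsum_ite m₀
    rw [hu.eq_one, norm_one] at this
    linarith [hu.tsum_le]
  have hus : Summable fun k => if k = m₀ then 0 else ‖u k‖ :=
    Summable.of_nonneg_of_le (fun k => by split_ifs <;> positivity)
      (fun k => by split_ifs <;> simp) hu.summable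
  have hw3 : ∀ k, k ≠ -m₀ - s → ‖w k‖ ≤ 1 / 3 := fun k hk => by
    have h1 := hw.summable.tsum_eq_add_tsum_ite (-m₀ - s)
    rw [hw.eq_one, norm_one] at h1
    have hws : Summable fun k => if k = -m₀ - s then 0 else ‖w k‖ :=
      Summable.of_nonneg_of_le (fun k => by split_ifs <;> positivity)
        (fun k => by split_ifs <;> simp) hw.summable
    have h2 := hws.le_tsum k fun j _ => by split_ifs <;> positivity
    rw [if_neg hk] at h2
    linarith [hw.tsum_le]
  have e := s1.of_norm.tsum_eq_add_tsum_ite m₀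
  rw [hu.eq_one, hw.eq_one, mul_one] at e
  have hle : ∀ k, ‖(if k = m₀ then 0 else u k * w (-k - s))‖ ≤
      1 / 3 * (if k = m₀ then 0 else ‖u k‖) := fun k => by
    split_ifs with h
    · simp
    · rw [norm_mul, mul_comm]
      exact mul_le_mul_of_nonneg_right (hw3 _ (by omega)) (norm_nonneg _)
  have h9 : ‖∑' k, (if k = m₀ then 0 else u k * w (-k - s))‖ ≤ 1 / 9 := by
    refine (tsum_of_norm_bounded (hus.mul_left (1 / 3)).hasSum hle).trans ?_
    rw [tsum_mul_left]; linarith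
  rw [e]
  have := norm_sub_le_norm_add (1 : ℂ) (∑' k, (if k = m₀ then 0 else u k * w (-k - s)))
  rw [norm_one] at this
  linarith

/-- Two eigenvalues in the same strip are exponentially close. -/
theorem norm_sub_le_of_eigenvalues (ha : Summable fun k => ‖a k‖) (hα : 0 ≤ α) (hn : 1 ≤ n)
    (hb : Summable fun k : ℤ => (Real.exp (α * |(k : ℝ)|) * ‖a k‖) ^ 2)
    (hbn : ∑' k : ℤ, (Real.exp (α * |(k : ℝ)|) * ‖a k‖) ^ 2 ≤ (n : ℝ) ^ 2 / 16)
    {s m₀ : ℤ} (hm₀ : 2 * m₀ + s = n) {z : Fin 2 → ℂ}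
    (hz : ∀ i, |(z i).re - (n : ℝ) ^ 2 * Real.pi ^ 2| ≤ 4 * n)
    {f : Fin 2 → ℤ → ℂ} (hf : ∀ i, Summable fun k => ‖f i k‖) (hf0 : ∀ i, f i ≠ 0)
    (hfe : ∀ i k, ((freeEigenvalue s k : ℂ) - z i) * f i k + seqConv a (f i) k = 0) :
    ‖z 1 - z 0‖ ≤ 2 * n * Real.exp (-(α * n)) := by
  obtain ⟨ha2, han⟩ := summable_sq_of_exp hα hb hbn
  have hm₁ : 2 * (-m₀ - s) + s = -n := by omega
  have hrefl : -(-m₀ - s) - s = m₀ := by ring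
  choose u hu huc using fun i => exists_quasimode ha hα hn (Or.inl hm₀) (hz i) hb hbn
  choose w hw hwc using fun i => exists_quasimode ha hα hn (Or.inr hm₁) (hz i) hb hbn
  rw [hrefl] at hwc
  set ε : ℝ := n / 3 * Real.exp (-(α * n)) with hε
  have hcb : ∀ {x : ℝ}, Real.exp (α * n) * x ≤ n / 3 → x ≤ ε := fun {x} h => by
    rw [hε, Real.exp_neg, ← div_eq_mul_inv, le_div_iff₀ (Real.exp_pos _)]
    linarith
  set β : Fin 2 → ℂ := fun i => ((freeEigenvalue s m₀ : ℂ) - z i) + seqConv a (u i) m₀ with hβ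
  set β' : Fin 2 → ℂ := fun i =>
    ((freeEigenvalue s (-m₀ - s) : ℂ) - z i) + seqConv a (w i) (-m₀ - s) with hβ'
  -- Pairing two quasimodes for the same `z` gives zero, so the diagonal entries agree and the
  -- determinant relation reads `β² = c c'`.
  have heq : ∀ i, β i = β' i := fun i => by
    have := quasimode_pairing ha hn hm₀ (hu i) (hw i)
    rw [sub_self, zero_mul] at this
    exact sub_eq_zero.1 this
  have hβε : ∀ i, ‖β i‖ ≤ ε := fun i => by
    have h := quasimode_determinant ha hn ha2 han hm₀ (hz i) (hf i) (hf0 i) (hfe i) (hu i) (hw i)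
    have h' : β i * β i = seqConv a (u i) (-m₀ - s) * seqConv a (w i) m₀ := by
      conv_lhs => rw [heq i]
      rw [← h]
      change β' i * β' i = β i * β' i
      rw [heq i]
    have h2 := congrArg norm h'
    rw [norm_mul, norm_mul] at h2
    have hε0 : 0 ≤ ε := by positivity
    refine abs_le_of_sq_le_sq' ?_ hε0 |>.2
    calc ‖β i‖ ^ 2 = ‖seqConv a (u i) (-m₀ - s)‖ * ‖seqConv a (w i) m₀‖ := by rw [sq, h2]
      _ ≤ ε * ε := mul_le_mul (hcb (huc i)) (hcb (hwc i)) (norm_nonneg _) hε0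
      _ = ε ^ 2 := (sq ε).symm
  have hp := quasimode_pairing ha hn hm₀ (hu 0) (hw 1)
  have hl := quasimode_pairing_lower (hu 0) (hw 1)
  have hp' : β 0 - β' 1 = (z 1 - z 0) * ∑' k, u 0 k * w 1 (-k - s) := hp
  -- Pairing quasimodes for the two different eigenvalues compares `β` at both. The resulting
  -- constant is `(9/8) · 2 · (1/3) = 3/4`, below the claimed `2`.
  have h3 : ‖z 1 - z 0‖ * (8 / 9) ≤ ε + ε := by
    calc ‖z 1 - z 0‖ * (8 / 9) ≤ ‖z 1 - z 0‖ * ‖∑' k, u 0 k * w 1 (-k - s)‖ := by gcongr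
      _ = ‖β 0 - β' 1‖ := by rw [hp', norm_mul]
      _ ≤ ‖β 0‖ + ‖β' 1‖ := norm_sub_le _ _
      _ ≤ ε + ε := add_le_add (hβε 0) (heq 1 ▸ hβε 1)
  have hpos : 0 ≤ (n : ℝ) * Real.exp (-(α * n)) := by positivity
  rw [hε] at h3
  nlinarith

end Weights

/-- No eigenvalues on a line, or in the strip for the other parity. -/
theorem eigenvector_eq_zero_of_inv_sq_le {a f : ℤ → ℂ} {n : ℕ} (ha : Summable fun k => ‖a k‖)
    (hn : 1 ≤ n) (ha2 : Summable fun k => ‖a k‖ ^ 2) (han : ∑' k, ‖a k‖ ^ 2 ≤ (n : ℝ) ^ 2 / 16)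
    {s : ℤ} {z : ℂ} (hz : |z.re - (n : ℝ) ^ 2 * Real.pi ^ 2| ≤ 4 * n)
    (hz' : |z.re - (n : ℝ) ^ 2 * Real.pi ^ 2| = 4 * n ∨ ∀ k : ℤ, 2 * k + s ≠ n) {t : ℂ}
    (ht : ‖t‖ ≤ 1) (hf : Summable fun k => ‖f k‖)
    (hfe : ∀ k, ((freeEigenvalue s k : ℂ) - z) * f k + t * seqConv a f k = 0) : f = 0 := by
  have hn' : (1 : ℝ) ≤ n := by exact_mod_cast hn
  obtain ⟨hr2, hrn⟩ := summable_reducedResolvent_sq hn s hz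
  -- On the boundary of the strip the modes `±n` need not be left out, as `D - z` has size at least
  -- `4 n` there. Each adds `1 / (16 n²)` to the square sum, and `8/25 + 1/16 + 1/16 < 1/2`. For the
  -- other parity these modes do not exist and `e`, `e'` vanish.
  set e : ℤ → ℝ := fun k => (if 2 * k + s = n ∧ |z.re - (n : ℝ) ^ 2 * Real.pi ^ 2| = 4 * n then
    1 / (4 * (n : ℝ)) else 0) with he
  set e' : ℤ → ℝ := fun k => (if 2 * k + s = -n ∧ |z.re - (n : ℝ) ^ 2 * Real.pi ^ 2| = 4 * n then
    1 / (4 * (n : ℝ)) else 0) with he'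
  have he0 : ∀ k, 0 ≤ e k := fun k => by simp only [he]; split_ifs <;> positivity
  have he0' : ∀ k, 0 ≤ e' k := fun k => by simp only [he']; split_ifs <;> positivity
  have hr0 := reducedResolvent_nonneg n s z
  have hsing : ∀ (g : ℤ → ℝ) (p : ℤ), (∀ k, g k ≠ 0 → 2 * k + s = p) → (∀ k, 0 ≤ g k) →
      (∀ k, g k ≤ 1 / (4 * (n : ℝ))) →
      (Summable fun k => g k ^ 2) ∧ ∑' k, g k ^ 2 ≤ 1 / (16 * (n : ℝ) ^ 2) := by
    intro g p hg hg0 hg1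
    have hsq : ∀ k, g k ^ 2 ≤ 1 / (16 * (n : ℝ) ^ 2) := fun k => by
      calc g k ^ 2 ≤ (1 / (4 * (n : ℝ))) ^ 2 := by have := hg0 k; have := hg1 k; gcongr
        _ = _ := by rw [div_pow, mul_pow]; norm_num
    by_cases h : ∃ k₀, 2 * k₀ + s = p
    · obtain ⟨k₀, hk₀⟩ := h
      have hz : ∀ k, k ≠ k₀ → g k ^ 2 = 0 := fun k hk => by
        by_contra hne
        have := hg k (fun h0 => hne (by rw [h0]; simp))
        omega
      exact ⟨(hasSum_single k₀ hz).summable, by rw [(hasSum_single k₀ hz).tsum_eq]; exact hsq k₀⟩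
    · have hz : ∀ k, g k ^ 2 = 0 := fun k => by
        by_contra hne
        exact h ⟨k, hg k (fun h0 => hne (by rw [h0]; simp))⟩
      simp only [hz]
      exact ⟨summable_zero, by rw [tsum_zero]; positivity⟩
  obtain ⟨hes, hen⟩ := hsing e n (fun k hk => by
    by_contra h; exact hk (by simp [he, h])) he0 (fun k => by
      simp only [he]; split_ifs; exacts [le_rfl, by positivity])
  obtain ⟨hes', hen'⟩ := hsing e' (-n) (fun k hk => by
    by_contra h; exact hk (by simp [he', h])) he0' (fun k => by
      simp only [he']; split_ifs; exacts [le_rfl, by positivity])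
  set r : ℤ → ℝ := fun k => reducedResolvent n s z k + e k + e' k with hr
  have hrr0 : ∀ k, 0 ≤ r k := fun k => add_nonneg (add_nonneg (hr0 k) (he0 k)) (he0' k)
  have hsq : ∀ k, r k ^ 2 = reducedResolvent n s z k ^ 2 + e k ^ 2 + e' k ^ 2 := by
    intro k
    simp only [hr, he, he', reducedResolvent]
    by_cases h1 : 2 * k + s = n
    · rw [if_pos (Or.inl h1), if_neg (show ¬(2 * k + s = -(n : ℤ) ∧ _) from fun h => by omega)]
      ring
    · by_cases h2 : 2 * k + s = -n
      · rw [if_pos (Or.inr h2), if_neg (show ¬(2 * k + s = (n : ℤ) ∧ _) from fun h => h1 h.1)]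
        ring
      · simp [h1, h2]
  have hrs : Summable fun k => r k ^ 2 := by
    simp only [hsq]; exact (hr2.add hes).add hes'
  have hrb : ∑' k, r k ^ 2 ≤ 1 / (2 * (n : ℝ) ^ 2) := by
    simp only [hsq]
    rw [(hr2.add hes).tsum_add hes', hr2.tsum_add hes]
    refine (add_le_add (add_le_add hrn hen) hen').trans ?_
    have : 8 / (25 * (n : ℝ) ^ 2) + 1 / (16 * (n : ℝ) ^ 2) + 1 / (16 * (n : ℝ) ^ 2) =
      (8 / 25 + 1 / 16 + 1 / 16) * (1 / (n : ℝ) ^ 2) := by field_simp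
    rw [this, show 1 / (2 * (n : ℝ) ^ 2) = (1 / 2) * (1 / (n : ℝ) ^ 2) by field_simp]
    gcongr
    norm_num
  refine eq_zero_of_resolvent_bound ha hf (d := fun k => (freeEigenvalue s k : ℂ) - z)
      (r := r) (t := t) ht hrr0
      (fun j => (schur_bound_of_sq hn hrr0 (fun _ => norm_nonneg _) hrs hrb ha2 han j).1)
      (fun j => (schur_bound_of_sq hn hrr0 (fun _ => norm_nonneg _) hrs hrb ha2 han j).2)
      fun k => Or.inr ⟨?_, hfe k⟩
  have hline : ∀ k, ((2 * k + s : ℤ) : ℝ) ^ 2 = (n : ℝ) ^ 2 →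
      |z.re - (n : ℝ) ^ 2 * Real.pi ^ 2| = 4 * n →
      4 * (n : ℝ) ≤ ‖(freeEigenvalue s k : ℂ) - z‖ := by
    intro k hk hl
    have h1 := Complex.abs_re_le_norm ((freeEigenvalue s k : ℂ) - z)
    have hfk : freeEigenvalue s k = (n : ℝ) ^ 2 * Real.pi ^ 2 := by
      rw [freeEigenvalue, hk, mul_comm]
    rw [hfk] at h1 ⊢
    rwa [Complex.sub_re, Complex.ofReal_re, abs_sub_comm, hl] at h1
  have h4 : ∀ x : ℝ, 4 * (n : ℝ) ≤ x → 1 ≤ 1 / (4 * (n : ℝ)) * x := fun x hx => by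
    rw [one_div, ← div_eq_inv_mul, one_le_div (by positivity)]; exact hx
  by_cases hk1 : 2 * k + s = n
  · have hl : |z.re - (n : ℝ) ^ 2 * Real.pi ^ 2| = 4 * n := hz'.resolve_right fun h => h k hk1
    have : 1 / (4 * (n : ℝ)) ≤ r k := by
      simp only [hr]
      have h3 : e k = 1 / (4 * (n : ℝ)) := by simp only [he]; rw [if_pos ⟨hk1, hl⟩]
      linarith [hr0 k, he0' k]
    refine (h4 _ (hline k (by rw [hk1]; simp) hl)).trans ?_
    gcongr
  by_cases hk2 : 2 * k + s = -n
  · have hl : |z.re - (n : ℝ) ^ 2 * Real.pi ^ 2| = 4 * n :=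
      hz'.resolve_right fun h => h (-k - s) (by omega)
    have : 1 / (4 * (n : ℝ)) ≤ r k := by
      simp only [hr]
      have h3 : e' k = 1 / (4 * (n : ℝ)) := by simp only [he']; rw [if_pos ⟨hk2, hl⟩]
      linarith [hr0 k, he0 k]
    refine (h4 _ (hline k (by rw [hk2]; simp) hl)).trans ?_
    gcongr
  · have hpos := (inv_norm_freeEigenvalue_sub_sq_le hn hz hk1 hk2).1
    have h3 : reducedResolvent n s z k = ‖(freeEigenvalue s k : ℂ) - z‖⁻¹ := by
      rw [reducedResolvent, if_neg (by tauto)]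
    calc 1 = ‖(freeEigenvalue s k : ℂ) - z‖⁻¹ * ‖(freeEigenvalue s k : ℂ) - z‖ :=
          (inv_mul_cancel₀ hpos.ne').symm
      _ ≤ r k * _ := by
          gcongr
          simp only [hr]
          linarith [he0 k, he0' k]

end

/-! ### Invariant graphs over finitely many low modes -/

noncomputable section

section InvariantGraph

variable {a : ℤ → ℂ} {s : ℤ} {P : Finset ℤ}

/-- The linear combination of the members of a finite family with coefficients from a sequence. -/
def seqComb (Z : SeqSpace) (X : P → SeqSpace) : SeqSpace := ∑ i : P, Z (i : ℤ) • X i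

theorem sum_norm_apply_le (Z : SeqSpace) : ∑ i : P, ‖Z (i : ℤ)‖ ≤ ‖Z‖ := by
  rw [SeqSpace.norm_eq, Finset.sum_coe_sort P fun k => ‖Z k‖]
  exact Z.summable.sum_le_tsum P fun _ _ => norm_nonneg _

theorem norm_seqComb_le (Z : SeqSpace) (X : P → SeqSpace) : ‖seqComb Z X‖ ≤ ‖Z‖ * ‖X‖ := by
  calc ‖seqComb Z X‖ ≤ ∑ i : P, ‖Z (i : ℤ)‖ * ‖X‖ := by
        refine norm_sum_le_of_le _ fun i _ => ?_
        rw [norm_smul]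
        exact mul_le_mul_of_nonneg_left (norm_le_pi_norm X i) (norm_nonneg _)
    _ = (∑ i : P, ‖Z (i : ℤ)‖) * ‖X‖ := (Finset.sum_mul _ _ _).symm
    _ ≤ _ := mul_le_mul_of_nonneg_right (sum_norm_apply_le Z) (norm_nonneg _)

theorem seqComb_sub (Z Z' : SeqSpace) (X X' : P → SeqSpace) :
    seqComb Z X - seqComb Z' X' = seqComb (Z - Z') X + seqComb Z' (X - X') := by
  simp only [seqComb, ← Finset.sum_sub_distrib, ← Finset.sum_add_distrib]
  refine Finset.sum_congr rfl fun i _ => ?_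
  rw [lp.coeFn_sub, Pi.sub_apply, Pi.sub_apply, sub_smul, smul_sub]
  abel

/-- The inverse spectral gaps. -/
def gapMultiplier (s : ℤ) (P : Finset ℤ) (j k : ℤ) : ℂ :=
  if k ∈ P then 0 else ((freeEigenvalue s k - freeEigenvalue s j : ℝ) : ℂ)⁻¹

theorem norm_gapMultiplier_le {δ : ℝ} (hδ : 0 < δ)
    (hP : ∀ k ∉ P, ∀ j ∈ P, δ ≤ freeEigenvalue s k - freeEigenvalue s j) (j : P) (k : ℤ) :
    ‖gapMultiplier s P j k‖ ≤ δ⁻¹ := by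
  unfold gapMultiplier
  split_ifs with h
  · rw [norm_zero]; positivity
  · have := hP k h j j.2
    rw [norm_inv, Complex.norm_real, Real.norm_of_nonneg (hδ.le.trans this)]
    gcongr

/-- The map whose fixed points describe invariant graphs. -/
def riccatiMap (ha : Summable fun k => ‖a k‖) {δ : ℝ} (hδ : 0 < δ)
    (hP : ∀ k ∉ P, ∀ j ∈ P, δ ≤ freeEigenvalue s k - freeEigenvalue s j) (t : ℂ)
    (X : P → SeqSpace) : P → SeqSpace := fun j =>
  -- With `Y j = δ_j + X j`, invariance at `k ∉ P` reads `(λ_k - λ_j) X_j(k) = t (∑_i (V Y_j)_i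
  -- X_i(k) - (V Y_j)_k)`. The multiplier divides by the gap and is zero on `P`, so fixed points
  -- have `X j` supported off `P`.
  t • diagCLM (gapMultiplier s P j) δ⁻¹ (norm_gapMultiplier_le hδ hP j)
    (seqComb (convCLM a ha (lp.single 1 (j : ℤ) 1 + X j)) X -
      convCLM a ha (lp.single 1 (j : ℤ) 1 + X j))

variable (ha : Summable fun k => ‖a k‖) {δ : ℝ} (hδ : 0 < δ)
    (hP : ∀ k ∉ P, ∀ j ∈ P, δ ≤ freeEigenvalue s k - freeEigenvalue s j)

theorem norm_convCLM_single_add_le {X : P → SeqSpace} (hX : ‖X‖ ≤ 1) (j : P) :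
    ‖convCLM a ha (lp.single 1 (j : ℤ) 1 + X j)‖ ≤ 2 * ∑' k, ‖a k‖ := by
  have h1 : ‖(lp.single 1 (j : ℤ) 1 + X j : SeqSpace)‖ ≤ 1 + 1 := by
    refine (norm_add_le _ _).trans (add_le_add ?_ ((norm_le_pi_norm X j).trans hX))
    rw [lp.norm_single (by simp)]; simp
  have hM : 0 ≤ ∑' k, ‖a k‖ := tsum_nonneg fun _ => norm_nonneg _
  refine (norm_convCLM_le a ha _).trans ?_
  nlinarith

theorem norm_riccati_inner_le {X : P → SeqSpace} (hX : ‖X‖ ≤ 1) (j : P) :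
    ‖diagCLM (gapMultiplier s P j) δ⁻¹ (norm_gapMultiplier_le hδ hP j)
    (seqComb (convCLM a ha (lp.single 1 (j : ℤ) 1 + X j)) X -
      convCLM a ha (lp.single 1 (j : ℤ) 1 + X j))‖ ≤ δ⁻¹ * (4 * ∑' k, ‖a k‖) := by
  have h1 := norm_convCLM_single_add_le ha hX j
  have h2 := norm_seqComb_le (convCLM a ha (lp.single 1 (j : ℤ) 1 + X j)) X
  have hM : 0 ≤ ∑' k, ‖a k‖ := tsum_nonneg fun _ => norm_nonneg _
  refine (ContinuousLinearMap.le_of_opNorm_le _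
    (norm_diagCLM_le _ _ (by positivity) _) _).trans ?_
  gcongr
  refine (norm_sub_le _ _).trans ?_
  nlinarith [norm_nonneg (convCLM a ha (lp.single 1 (j : ℤ) 1 + X j)), norm_nonneg X]

theorem norm_riccatiMap_le (hM : 8 * ∑' k, ‖a k‖ ≤ δ) {t : ℂ} (ht : ‖t‖ ≤ 1) {X : P → SeqSpace}
    (hX : ‖X‖ ≤ 1) : ‖riccatiMap ha hδ hP t X‖ ≤ 1 := by
  rw [pi_norm_le_iff_of_nonneg zero_le_one]
  intro j
  have h := norm_riccati_inner_le ha hδ hP hX j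
  have h2 : δ⁻¹ * (4 * ∑' k, ‖a k‖) ≤ 1 := by
    rw [inv_mul_le_iff₀ hδ]; linarith
  rw [riccatiMap, norm_smul]
  exact mul_le_one₀ ht (norm_nonneg _) (h.trans h2)

/-- The map is quadratic in `X`. On the unit ball its difference is controlled by `M + 2 M + M`,
where `M = ‖a‖₁`, and division by a gap `δ ≥ 8 M` leaves the factor `1/2`. -/
theorem norm_riccatiMap_sub_le (hM : 8 * ∑' k, ‖a k‖ ≤ δ) {t : ℂ} (ht : ‖t‖ ≤ 1)
    {X X' : P → SeqSpace} (hX : ‖X‖ ≤ 1) (hX' : ‖X'‖ ≤ 1) :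
    ‖riccatiMap ha hδ hP t X - riccatiMap ha hδ hP t X'‖ ≤ 1 / 2 * ‖X - X'‖ := by
  rw [pi_norm_le_iff_of_nonneg (by positivity)]
  intro j
  have hM0 : 0 ≤ ∑' k, ‖a k‖ := tsum_nonneg fun _ => norm_nonneg _
  rw [Pi.sub_apply, riccatiMap, riccatiMap, ← smul_sub, ← map_sub, norm_smul]
  set Z := convCLM a ha (lp.single 1 (j : ℤ) 1 + X j) with hZ
  set Z' := convCLM a ha (lp.single 1 (j : ℤ) 1 + X' j) with hZ'
  have hZ2 : ‖Z'‖ ≤ 2 * ∑' k, ‖a k‖ := norm_convCLM_single_add_le ha hX' j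
  have hZZ : ‖Z - Z'‖ ≤ (∑' k, ‖a k‖) * ‖X - X'‖ := by
    rw [hZ, hZ', ← map_sub, add_sub_add_left_eq_sub]
    refine (norm_convCLM_le a ha _).trans ?_
    gcongr
    exact norm_le_pi_norm (X - X') j
  have hin : ‖seqComb Z X - Z - (seqComb Z' X' - Z')‖ ≤ 4 * (∑' k, ‖a k‖) * ‖X - X'‖ := by
    have e : seqComb Z X - Z - (seqComb Z' X' - Z') =
        seqComb (Z - Z') X + seqComb Z' (X - X') - (Z - Z') := by
      rw [← seqComb_sub]; abel
    rw [e]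
    refine (norm_sub_le _ _).trans ((add_le_add (norm_add_le _ _) le_rfl).trans ?_)
    have h1 := norm_seqComb_le (Z - Z') X
    have h2 := norm_seqComb_le Z' (X - X')
    have h3 : ‖Z - Z'‖ * ‖X‖ ≤ ‖Z - Z'‖ * 1 := by gcongr
    have h4 : ‖Z'‖ * ‖X - X'‖ ≤ (2 * ∑' k, ‖a k‖) * ‖X - X'‖ := by gcongr
    linarith
  have hd := ContinuousLinearMap.le_of_opNorm_le _
    (norm_diagCLM_le _ _ (by positivity) (norm_gapMultiplier_le hδ hP j))
    (seqComb Z X - Z - (seqComb Z' X' - Z'))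
  calc _ ≤ 1 * (δ⁻¹ * (4 * (∑' k, ‖a k‖) * ‖X - X'‖)) := by
        gcongr
        exact hd.trans (by gcongr)
    _ = (δ⁻¹ * (4 * ∑' k, ‖a k‖)) * ‖X - X'‖ := by ring
    _ ≤ 1 / 2 * ‖X - X'‖ := by
        gcongr
        rw [inv_mul_le_iff₀ hδ]; linarith

theorem norm_riccatiMap_sub_param_le (hM : 8 * ∑' k, ‖a k‖ ≤ δ) (t t' : ℂ)
    {X : P → SeqSpace} (hX : ‖X‖ ≤ 1) :
    ‖riccatiMap ha hδ hP t X - riccatiMap ha hδ hP t' X‖ ≤ 1 / 2 * ‖t - t'‖ := by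
  rw [pi_norm_le_iff_of_nonneg (by positivity)]
  intro j
  rw [Pi.sub_apply, riccatiMap, riccatiMap, ← sub_smul, norm_smul, mul_comm]
  have h := norm_riccati_inner_le ha hδ hP hX j
  have h2 : δ⁻¹ * (4 * ∑' k, ‖a k‖) ≤ 1 / 2 := by
    rw [inv_mul_le_iff₀ hδ]; linarith
  exact mul_le_mul_of_nonneg_right (h.trans h2) (norm_nonneg _)

theorem exists_riccati_fixedPoint (hM : 8 * ∑' k, ‖a k‖ ≤ δ) {t : ℂ} (ht : ‖t‖ ≤ 1) :
    ∃ X : P → SeqSpace, ‖X‖ ≤ 1 ∧ riccatiMap ha hδ hP t X = X := by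
  have hcl : IsComplete (Metric.closedBall (0 : P → SeqSpace) 1) :=
    Metric.isClosed_closedBall.isComplete
  have hmaps : Set.MapsTo (riccatiMap ha hδ hP t) (Metric.closedBall 0 1)
      (Metric.closedBall 0 1) := fun X hX => by
    rw [mem_closedBall_zero_iff] at hX ⊢
    exact norm_riccatiMap_le ha hδ hP hM ht hX
  have hcontr : ContractingWith (1 / 2 : NNReal) (hmaps.restrict _ _ _) := by
    refine ⟨by rw [← NNReal.coe_lt_coe]; norm_num, LipschitzWith.of_dist_le_mul fun X X' => ?_⟩
    have hX := mem_closedBall_zero_iff.1 X.2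
    have hX' := mem_closedBall_zero_iff.1 X'.2
    have := norm_riccatiMap_sub_le ha hδ hP hM ht hX hX'
    rw [Subtype.dist_eq, Subtype.dist_eq, dist_eq_norm, dist_eq_norm]
    simpa using this
  obtain ⟨X, hX, hfix, -⟩ := hcontr.exists_fixedPoint' hcl hmaps
    (x := 0) (by simp) (edist_ne_top _ _)
  exact ⟨X, mem_closedBall_zero_iff.1 hX, hfix⟩

/-- The matrix of the operator on an invariant graph. -/
def reducedMatrix (a : ℤ → ℂ) (s : ℤ) (t : ℂ) (Y : P → SeqSpace) : Matrix P P ℂ :=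
  Matrix.of fun i j => (if i = j then (freeEigenvalue s i : ℂ) else 0) + t * seqConv a (Y j) i

/-- The span of `Y` is a graph over the modes in `P` that is invariant under `D + t V`. -/
structure IsInvariantGraph (a : ℤ → ℂ) (s : ℤ) (t : ℂ) (Y : P → SeqSpace) : Prop where
  apply_eq : ∀ i j : P, Y j (i : ℤ) = if i = j then 1 else 0
  norm_le : ∀ j : P, ‖Y j - lp.single 1 (j : ℤ) 1‖ ≤ 1
  invariant : ∀ (j : P) (k : ℤ), (freeEigenvalue s k : ℂ) * Y j k + t * seqConv a (Y j) k =
    ∑ i : P, reducedMatrix a s t Y i j * Y i k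

theorem seqSpace_sum_apply {ι : Type*} (S : Finset ι) (f : ι → SeqSpace) (k : ℤ) :
    (∑ i ∈ S, f i : SeqSpace) k = ∑ i ∈ S, f i k := by
  rw [lp.coeFn_sum, Finset.sum_apply]

theorem isInvariantGraph_of_fixedPoint {t : ℂ} {X : P → SeqSpace} (hX1 : ‖X‖ ≤ 1)
    (hX : riccatiMap ha hδ hP t X = X) :
    IsInvariantGraph a s t fun j : P => lp.single 1 (j : ℤ) 1 + X j := by
  set Y : P → SeqSpace := fun j : P => lp.single 1 (j : ℤ) 1 + X j with hY
  have hXk : ∀ (j : P) (k : ℤ), X j k = t * (gapMultiplier s P j k *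
      (∑ i : P, seqConv a (Y j) i * X i k - seqConv a (Y j) k)) := by
    intro j k
    conv_lhs => rw [← hX]
    rw [riccatiMap, lp.coeFn_smul, Pi.smul_apply, smul_eq_mul, diagCLM_apply, lp.coeFn_sub,
      Pi.sub_apply, seqComb, seqSpace_sum_apply]
    rfl
  have hXP : ∀ (i j : P), X j (i : ℤ) = 0 := fun i j => by
    rw [hXk, gapMultiplier, if_pos i.2]; ring
  have hsing : ∀ (j : P) (k : ℤ), (lp.single 1 (j : ℤ) 1 : SeqSpace) k = if k = j then 1 else 0 := by
    intro j k
    rw [lp.single_apply]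
    by_cases h : k = j
    · subst h; simp
    · simp [h]
  have hYk : ∀ (j : P) (k : ℤ), Y j k = (if k = j then 1 else 0) + X j k := fun j k => by
    rw [← hsing]; rfl
  have happ : ∀ i j : P, Y j (i : ℤ) = if i = j then 1 else 0 := fun i j => by
    rw [hYk, hXP, add_zero]
    simp only [Subtype.ext_iff]
  refine ⟨happ, fun j => ?_, fun j k => ?_⟩
  · rw [hY]
    simp only [add_sub_cancel_left]
    exact (norm_le_pi_norm X j).trans hX1
  · by_cases hk : k ∈ P
    · have : ∀ i : P, reducedMatrix a s t Y i j * Y i k =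
          if (⟨k, hk⟩ : P) = i then reducedMatrix a s t Y i j else 0 := fun i => by
        have := happ ⟨k, hk⟩ i
        simp only at this
        rw [this, mul_ite, mul_one, mul_zero]
      rw [Finset.sum_congr rfl fun i _ => this i, Finset.sum_ite_eq, if_pos (Finset.mem_univ _)]
      have h2 := happ ⟨k, hk⟩ j
      simp only at h2
      rw [reducedMatrix, Matrix.of_apply, h2, mul_ite, mul_one, mul_zero]
    · have hkj : ∀ i : P, k ≠ i := fun i h => hk (h ▸ i.2)
      have hYX : ∀ i : P, Y i k = X i k := fun i => by
        rw [hYk, if_neg (hkj i), zero_add]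
      have hgap : ((freeEigenvalue s k - freeEigenvalue s j : ℝ) : ℂ) ≠ 0 := by
        have := hP k hk j j.2
        rw [Ne, Complex.ofReal_eq_zero]
        linarith
      have h1 := hXk j k
      rw [gapMultiplier, if_neg hk] at h1
      have h2 : ((freeEigenvalue s k - freeEigenvalue s j : ℝ) : ℂ) * X j k =
          t * (∑ i : P, seqConv a (Y j) i * X i k - seqConv a (Y j) k) := by
        rw [h1]; field_simp
      have h3 : ∑ i : P, reducedMatrix a s t Y i j * Y i k =
          (freeEigenvalue s j : ℂ) * X j k + t * ∑ i : P, seqConv a (Y j) i * X i k := by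
        simp only [reducedMatrix, Matrix.of_apply, hYX, add_mul, Finset.sum_add_distrib, ite_mul,
          zero_mul, Finset.sum_ite_eq', Finset.mem_univ, if_true, Finset.mul_sum, mul_assoc]
      rw [h3, hYX]
      push_cast at h2
      linear_combination h2

theorem exists_invariantGraph (hM : 8 * ∑' k, ‖a k‖ ≤ δ) (ha : Summable fun k => ‖a k‖)
    (hδ : 0 < δ) (hP : ∀ k ∉ P, ∀ j ∈ P, δ ≤ freeEigenvalue s k - freeEigenvalue s j) :
    ∃ Y : unitInterval → P → SeqSpace, Continuous Y ∧
      ∀ t : unitInterval, IsInvariantGraph a s ((t : ℝ) : ℂ) (Y t) := by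
  have ht1 : ∀ t : unitInterval, ‖((t : ℝ) : ℂ)‖ ≤ 1 := fun t => by
    rw [Complex.norm_real, Real.norm_of_nonneg t.2.1]; exact t.2.2
  choose X hX1 hX using fun t : unitInterval => exists_riccati_fixedPoint ha hδ hP hM (ht1 t)
  refine ⟨fun t j => lp.single 1 (j : ℤ) 1 + X t j, ?_,
    fun t => isInvariantGraph_of_fixedPoint ha hδ hP (hX1 t) (hX t)⟩
  -- Contraction in `X` and the Lipschitz bound in the parameter give `d ≤ d / 2 + |t - t'| / 2` for
  -- the distance `d` of two fixed points.
  have hlip : LipschitzWith 1 X := by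
    refine LipschitzWith.of_dist_le_mul fun t t' => ?_
    rw [dist_eq_norm, NNReal.coe_one, one_mul]
    have h1 := norm_riccatiMap_sub_le ha hδ hP hM (ht1 t) (hX1 t) (hX1 t')
    have h2 := norm_riccatiMap_sub_param_le ha hδ hP hM ((t : ℝ) : ℂ) ((t' : ℝ) : ℂ) (hX1 t')
    have h3 : ‖X t - X t'‖ ≤ ‖riccatiMap ha hδ hP ((t : ℝ) : ℂ) (X t) -
          riccatiMap ha hδ hP ((t : ℝ) : ℂ) (X t')‖ + ‖riccatiMap ha hδ hP ((t : ℝ) : ℂ) (X t') -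
          riccatiMap ha hδ hP ((t' : ℝ) : ℂ) (X t')‖ := by
      conv_lhs => rw [← hX t, ← hX t']
      exact norm_sub_le_norm_sub_add_norm_sub _ _ _
    have h4 := h3.trans (add_le_add h1 h2)
    rw [← Complex.ofReal_sub, Complex.norm_real] at h4
    have h5 : dist t t' = ‖(t : ℝ) - t'‖ := rfl
    rw [h5]; linarith
  exact continuous_pi fun j => continuous_const.add ((continuous_apply j).comp hlip.continuous)

theorem continuous_reducedMatrix {Y : unitInterval → P → SeqSpace} (hY : Continuous Y)
    (ha : Summable fun k => ‖a k‖) :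
    Continuous fun t : unitInterval => reducedMatrix a s ((t : ℝ) : ℂ) (Y t) := by
  refine continuous_matrix fun i j => ?_
  simp only [reducedMatrix, Matrix.of_apply]
  refine continuous_const.add (Continuous.mul (by fun_prop) ?_)
  have h1 : Continuous fun t => convCLM a ha (Y t j) :=
    (convCLM a ha).continuous.comp ((continuous_apply j).comp hY)
  exact (lp.evalCLM ℂ (fun _ : ℤ => ℂ) 1 (i : ℤ)).continuous.comp h1

variable {t : ℂ} {Y : P → SeqSpace}

/-- The embedding of the coefficient space onto the graph. -/
def graphMap (Y : P → SeqSpace) : (P → ℂ) →ₗ[ℂ] SeqSpace := Fintype.linearCombination ℂ Y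

theorem graphMap_apply (Y : P → SeqSpace) (p : P → ℂ) (k : ℤ) :
    graphMap Y p k = ∑ i, p i * Y i k := by
  rw [graphMap, Fintype.linearCombination_apply, seqSpace_sum_apply]
  rfl

theorem IsInvariantGraph.graphMap_apply_mem (hY : IsInvariantGraph a s t Y) (p : P → ℂ) (i : P) :
    graphMap Y p i = p i := by
  rw [graphMap_apply]
  simp [hY.apply_eq]

theorem IsInvariantGraph.graphMap_injective (hY : IsInvariantGraph a s t Y) :
    Function.Injective (graphMap Y) := fun p p' h => by
  ext i
  rw [← hY.graphMap_apply_mem p i, ← hY.graphMap_apply_mem p' i, h]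

theorem seqConv_graphMap (ha : Summable fun k => ‖a k‖) (Y : P → SeqSpace) (p : P → ℂ) (k : ℤ) :
    seqConv a (graphMap Y p) k = ∑ i, p i * seqConv a (Y i) k := by
  rw [← convCLM_apply a ha, graphMap, Fintype.linearCombination_apply, map_sum, seqSpace_sum_apply]
  simp only [map_smul]
  rfl

theorem IsInvariantGraph.apply_graphMap (hY : IsInvariantGraph a s t Y)
    (ha : Summable fun k => ‖a k‖) (p : P → ℂ) (k : ℤ) :
    (freeEigenvalue s k : ℂ) * graphMap Y p k + t * seqConv a (graphMap Y p) k =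
      graphMap Y ((reducedMatrix a s t Y).mulVec p) k := by
  rw [seqConv_graphMap ha, graphMap_apply, graphMap_apply]
  simp only [Matrix.mulVec, dotProduct, Finset.sum_mul, Finset.mul_sum]
  rw [Finset.sum_comm, ← Finset.sum_add_distrib]
  refine Finset.sum_congr rfl fun j _ => ?_
  have := hY.invariant j k
  calc _ = p j * ((freeEigenvalue s k : ℂ) * Y j k + t * seqConv a (Y j) k) := by ring
    _ = _ := by
      rw [this, Finset.mul_sum]
      exact Finset.sum_congr rfl fun i _ => by ring

/-- Solutions of `(D + t V - z) u = v` with `v` on the graph lie on the graph if `z` is to the left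
of the remaining spectrum. -/
theorem IsInvariantGraph.exists_of_equation (hY : IsInvariantGraph a s t Y)
    (ha : Summable fun k => ‖a k‖) (ht : ‖t‖ ≤ 1) {z : ℂ}
    (hz : ∀ k ∉ P, z.re + ∑' j, ‖a j‖ < freeEigenvalue s k) {u : SeqSpace} {p' : P → ℂ}
    (hu : ∀ k, (freeEigenvalue s k : ℂ) * u k + t * seqConv a u k =
      z * u k + graphMap Y p' k) :
    ∃ p : P → ℂ, u = graphMap Y p ∧ (reducedMatrix a s t Y).mulVec p = z • p + p' := by
  set p : P → ℂ := fun i => u i with hp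
  set y : SeqSpace := u - graphMap Y p with hy
  set ω : P → ℂ := z • p + p' - (reducedMatrix a s t Y).mulVec p with hω
  have hyP : ∀ k ∈ P, y k = 0 := fun k hk => by
    have := hY.graphMap_apply_mem p ⟨k, hk⟩
    simp only [hp] at this
    rw [hy, lp.coeFn_sub, Pi.sub_apply, this, sub_self]
  have hconv : ∀ k, seqConv a y k = seqConv a u k - seqConv a (graphMap Y p) k := fun k => by
    rw [← convCLM_apply a ha, hy, map_sub, lp.coeFn_sub]; rfl
  have heq : ∀ k, (freeEigenvalue s k : ℂ) * y k + t * seqConv a y k =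
      z * y k + graphMap Y ω k := fun k => by
    have h1 := hY.apply_graphMap ha p k
    have h2 : graphMap Y ω k = z * graphMap Y p k + graphMap Y p' k
        - graphMap Y ((reducedMatrix a s t Y).mulVec p) k := by
      rw [hω, map_sub, map_add, map_smul]; rfl
    have h3 : y k = u k - graphMap Y p k := rfl
    rw [hconv, h2, h3]
    linear_combination hu k - h1
  -- The defect `y = u - graphMap Y p` vanishes on `P`, so its equation at the modes of `P`
  -- expresses the source `ω` by the convolution `V y`.
  have hωP : ∀ i : P, ω i = t * seqConv a y i := fun i => by
    have := heq i
    rw [hyP i i.2, hY.graphMap_apply_mem] at this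
    linear_combination -this
  set M := ∑' j, ‖a j‖ with hM
  -- the graph part off `P`
  have htail : ∀ k ∉ P, ‖graphMap Y ω k‖ ≤ ∑ i : P, ‖ω i‖ * ‖(Y i - lp.single 1 (i : ℤ) 1 : SeqSpace) k‖ := by
    intro k hk
    rw [graphMap_apply]
    refine norm_sum_le_of_le _ fun i _ => ?_
    have : (Y i - lp.single 1 (i : ℤ) 1 : SeqSpace) k = Y i k := by
      rw [lp.coeFn_sub, Pi.sub_apply, lp.single_apply_ne, sub_zero]
      rintro rfl
      exact hk i.2
    rw [this, norm_mul]
  have hSX : ∀ i : P, Summable fun k => ‖(Y i - lp.single 1 (i : ℤ) 1 : SeqSpace) k‖ :=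
    fun i => (Y i - lp.single 1 (i : ℤ) 1).summable
  have hcs : Summable fun k => ‖seqConv a y k‖ := summable_norm_seqConv ha y.summable
  by_cases hy0 : y = 0
  · refine ⟨p, sub_eq_zero.1 hy0, ?_⟩
    have : ω = 0 := by
      ext i
      rw [hωP, hy0]
      have : seqConv a (0 : SeqSpace) i = 0 := by
        rw [← convCLM_apply a ha, map_zero]; rfl
      rw [this, mul_zero]; rfl
    exact (sub_eq_zero.1 this).symm
  exfalso
  have hposk : ∀ k, y k ≠ 0 → k ∉ P := fun k hk hkP => hk (hyP k hkP)
  obtain ⟨k₀, hk₀⟩ : ∃ k, y k ≠ 0 := by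
    by_contra! h
    exact hy0 (by ext k; exact h k)
  have hterm : ∀ k ∉ P, M * ‖y k‖ ≤ ‖seqConv a y k‖ +
      ∑ i : P, ‖ω i‖ * ‖(Y i - lp.single 1 (i : ℤ) 1 : SeqSpace) k‖ ∧ (y k ≠ 0 → M * ‖y k‖ < ‖seqConv a y k‖ +
      ∑ i : P, ‖ω i‖ * ‖(Y i - lp.single 1 (i : ℤ) 1 : SeqSpace) k‖) := by
    intro k hk
    have hD : M < ‖(freeEigenvalue s k : ℂ) - z‖ := by
      have h1 := Complex.abs_re_le_norm ((freeEigenvalue s k : ℂ) - z)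
      have h2 := le_abs_self ((freeEigenvalue s k : ℂ) - z).re
      rw [Complex.sub_re, Complex.ofReal_re] at h1 h2
      linarith [hz k hk]
    have h1 : ‖(freeEigenvalue s k : ℂ) - z‖ * ‖y k‖ ≤ ‖seqConv a y k‖ +
      ∑ i : P, ‖ω i‖ * ‖(Y i - lp.single 1 (i : ℤ) 1 : SeqSpace) k‖ := by
      rw [← norm_mul]
      have : ((freeEigenvalue s k : ℂ) - z) * y k = graphMap Y ω k - t * seqConv a y k := by
        linear_combination heq k
      rw [this]
      refine (norm_sub_le _ _).trans ?_
      rw [add_comm, norm_mul]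
      refine add_le_add ?_ (htail k hk)
      exact mul_le_of_le_one_left (norm_nonneg _) ht
    refine ⟨le_trans ?_ h1, fun hyk => lt_of_lt_of_le ?_ h1⟩
    · gcongr
    · have := norm_pos_iff.2 hyk
      gcongr
  set b : ℤ → ℝ := fun k => if k ∈ P then 0 else ‖seqConv a y k‖ +
      ∑ i : P, ‖ω i‖ * ‖(Y i - lp.single 1 (i : ℤ) 1 : SeqSpace) k‖ with hb
  have hsumX : Summable fun k => ∑ i : P, ‖ω i‖ * ‖(Y i - lp.single 1 (i : ℤ) 1 : SeqSpace) k‖ :=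
    summable_sum fun i _ => (hSX i).mul_left _
  have hcQ : Summable fun k => if k ∈ P then 0 else ‖seqConv a y k‖ :=
    Summable.of_nonneg_of_le (fun k => by split_ifs <;> positivity)
      (fun k => by split_ifs <;> simp) hcs
  have hXQ : Summable fun k => if k ∈ P then 0 else
      ∑ i : P, ‖ω i‖ * ‖(Y i - lp.single 1 (i : ℤ) 1 : SeqSpace) k‖ :=
    Summable.of_nonneg_of_le (fun k => by split_ifs <;> positivity)
      (fun k => by split_ifs; exacts [by positivity, le_rfl]) hsumX
  have hbe : ∀ k, b k = (if k ∈ P then 0 else ‖seqConv a y k‖) + if k ∈ P then 0 else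
      ∑ i : P, ‖ω i‖ * ‖(Y i - lp.single 1 (i : ℤ) 1 : SeqSpace) k‖ := fun k => by
    simp only [hb]; split_ifs <;> simp
  have hbs : Summable b := by
    rw [funext hbe]; exact hcQ.add hXQ
  -- Off `P` one has `|λ_k - z| > M`, hence strict inequality when `y ≠ 0`. The graph part off `P`
  -- has mass at most `∑ |ω i|`, since `‖Y i - δ_i‖ ≤ 1`, and this is at most the mass of `V y` on
  -- `P`. Altogether `M ‖y‖ < ‖V y‖ ≤ M ‖y‖`, a contradiction.
  have hlt : ∑' k, M * ‖y k‖ < ∑' k, b k := by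
    refine Summable.tsum_lt_tsum (i := k₀) (fun k => ?_) ?_ (y.summable.mul_left M) hbs
    · by_cases hk : k ∈ P
      · simp only [hb, if_pos hk, hyP k hk, norm_zero, mul_zero]; exact le_rfl
      · simp only [hb, if_neg hk]; exact (hterm k hk).1
    · simp only [hb, if_neg (hposk k₀ hk₀)]
      exact (hterm k₀ (hposk k₀ hk₀)).2 hk₀
  have hcQsum : ∑' k, (if k ∈ P then 0 else ‖seqConv a y k‖) =
      ∑' k, ‖seqConv a y k‖ - ∑ k ∈ P, ‖seqConv a y k‖ := by
    have h1 : ∑' k, ‖seqConv a y k‖ = ∑' k, ((if k ∈ P then ‖seqConv a y k‖ else 0) +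
        if k ∈ P then 0 else ‖seqConv a y k‖) := tsum_congr fun k => by split_ifs <;> simp
    have h2 : HasSum (fun k => if k ∈ P then ‖seqConv a y k‖ else 0)
        (∑ k ∈ P, ‖seqConv a y k‖) := by
      have : HasSum (fun k => if k ∈ P then ‖seqConv a y k‖ else 0)
          (∑ k ∈ P, if k ∈ P then ‖seqConv a y k‖ else 0) :=
        hasSum_sum_of_ne_finset_zero fun k hk => if_neg hk
      rwa [Finset.sum_congr rfl fun k hk => if_pos hk] at this
    rw [h1, h2.summable.tsum_add hcQ, h2.tsum_eq]; ring
  have hXQsum : ∑' k, (if k ∈ P then 0 else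
      ∑ i : P, ‖ω i‖ * ‖(Y i - lp.single 1 (i : ℤ) 1 : SeqSpace) k‖) ≤ ∑ i : P, ‖ω i‖ := by
    calc _ ≤ ∑' k, ∑ i : P, ‖ω i‖ * ‖(Y i - lp.single 1 (i : ℤ) 1 : SeqSpace) k‖ :=
          hXQ.tsum_le_tsum (fun k => by split_ifs; exacts [by positivity, le_rfl]) hsumX
      _ = ∑ i : P, ‖ω i‖ * ‖(Y i - lp.single 1 (i : ℤ) 1 : SeqSpace)‖ := by
          rw [Summable.tsum_finsetSum fun i _ => (hSX i).mul_left _]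
          refine Finset.sum_congr rfl fun i _ => ?_
          rw [tsum_mul_left, SeqSpace.norm_eq]
      _ ≤ ∑ i : P, ‖ω i‖ * 1 := by
          gcongr with i
          exact hY.norm_le i
      _ = _ := by simp
  have hωsum : ∑ i : P, ‖ω i‖ ≤ ∑ k ∈ P, ‖seqConv a y k‖ := by
    rw [← Finset.sum_coe_sort P fun k => ‖seqConv a y k‖]
    refine Finset.sum_le_sum fun i _ => ?_
    rw [hωP, norm_mul]
    exact mul_le_of_le_one_left (norm_nonneg _) ht
  have hfin : ∑' k, b k ≤ ∑' k, ‖seqConv a y k‖ := by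
    rw [funext hbe, hcQ.tsum_add hXQ, hcQsum]
    linarith
  have hlast := tsum_norm_seqConv_le ha y.summable
  rw [tsum_mul_left] at hlt
  linarith

end InvariantGraph

end

/-! ### Hill's equation and absolutely convergent Fourier series -/

noncomputable section

/-- The wave number `π (2 m + s)`. -/
def waveNumber (s m : ℤ) : ℝ := Real.pi * ((2 * m + s : ℤ) : ℝ)

theorem waveNumber_sq (s m : ℤ) : waveNumber s m ^ 2 = freeEigenvalue s m := by
  rw [waveNumber, freeEigenvalue, mul_pow]

/-- The exponential `e^{iπ(2m+s)x}`. -/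
def mode (s m : ℤ) (x : ℝ) : ℂ := Complex.exp ((waveNumber s m * x : ℝ) * Complex.I)

theorem norm_mode (s m : ℤ) (x : ℝ) : ‖mode s m x‖ = 1 := Complex.norm_exp_ofReal_mul_I _

theorem mode_zero (s m : ℤ) : mode s m 0 = 1 := by simp [mode]

theorem mode_add (s m : ℤ) (x y : ℝ) : mode s m (x + y) = mode s m x * mode s m y := by
  rw [mode, mode, mode, ← Complex.exp_add]
  congr 1; push_cast; ring

theorem mode_mul_neg (s m : ℤ) (x : ℝ) : mode s m x * mode s m (-x) = 1 := by
  rw [← mode_add, add_neg_cancel, mode_zero]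

theorem mode_mul_mode (s l j : ℤ) (x : ℝ) : mode 0 l x * mode s j x = mode s (l + j) x := by
  rw [mode, mode, mode, ← Complex.exp_add]
  congr 1; simp only [waveNumber]; push_cast; ring

theorem mode_eq_fourier_mul (s m : ℤ) (x : ℝ) :
    mode s m x = fourier m (x : UnitAddCircle) * mode s 0 x := by
  rw [fourier_coe_apply, mode, mode, ← Complex.exp_add]
  congr 1; simp only [waveNumber]; push_cast; ring

theorem mode_one (s m : ℤ) : mode s m 1 = mode s 0 1 := by
  have h := mode_eq_fourier_mul s m 1
  have h1 : ((1 : ℝ) : UnitAddCircle) = 0 := by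
    have := AddCircle.coe_period (1 : ℝ); exact this
  rw [h, h1, fourier_eval_zero, one_mul]

theorem continuous_mode (s m : ℤ) : Continuous (mode s m) := by
  unfold mode; fun_prop

theorem hasDerivAt_mode (s m : ℤ) (x : ℝ) :
    HasDerivAt (mode s m) (waveNumber s m * Complex.I * mode s m x) x := by
  have h1 : HasDerivAt (fun x : ℝ => ((waveNumber s m * x : ℝ) : ℂ) * Complex.I)
      ((waveNumber s m : ℂ) * Complex.I) x := by
    have h2 : HasDerivAt (fun x : ℝ => waveNumber s m * x) (waveNumber s m) x := by
      simpa using (hasDerivAt_id x).const_mul (waveNumber s m)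
    exact (h2.ofReal_comp).mul_const Complex.I
  have := h1.cexp
  exact this.congr_deriv (by unfold mode; ring)

theorem hasDerivAt_mode_neg (s m : ℤ) (x : ℝ) :
    HasDerivAt (fun x => mode s m (-x)) (-(waveNumber s m * Complex.I * mode s m (-x))) x := by
  have := (hasDerivAt_mode s m (-x)).scomp x (hasDerivAt_neg x)
  exact this.congr_deriv (by simp)

/-- The function with the Fourier coefficients `u`. -/
def synth (s : ℤ) : SeqSpace →ₗ[ℂ] (ℝ → ℂ) where
  toFun u x := ∑' m, u m * mode s m x
  map_add' u v := by
    ext x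
    have h : ∀ u : SeqSpace, Summable fun m => u m * mode s m x := fun u =>
      Summable.of_norm (by simpa only [norm_mul, norm_mode, mul_one] using u.summable)
    simp only [Pi.add_apply]
    rw [← (h u).tsum_add (h v)]
    exact tsum_congr fun m => by rw [lp.coeFn_add, Pi.add_apply, add_mul]
  map_smul' c u := by
    ext x
    simp only [Pi.smul_apply, RingHom.id_apply, smul_eq_mul]
    rw [← tsum_mul_left]
    exact tsum_congr fun m => by rw [lp.coeFn_smul, Pi.smul_apply, smul_eq_mul, mul_assoc]

theorem synth_apply (s : ℤ) (u : SeqSpace) (x : ℝ) : synth s u x = ∑' m, u m * mode s m x := rfl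

theorem norm_mul_mode (s : ℤ) (c : ℂ) (m : ℤ) (x : ℝ) : ‖c * mode s m x‖ = ‖c‖ := by
  rw [norm_mul, norm_mode, mul_one]

theorem summable_mul_mode (s : ℤ) (u : SeqSpace) (x : ℝ) :
    Summable fun m => u m * mode s m x :=
  Summable.of_norm (by simpa only [norm_mul_mode] using u.summable)

theorem continuous_synth (s : ℤ) (u : SeqSpace) : Continuous (synth s u) :=
  continuous_tsum (fun m => continuous_const.mul (continuous_mode s m)) u.summable
    fun m x => (norm_mul_mode s _ m x).le

theorem synth_add_one (s : ℤ) (u : SeqSpace) (x : ℝ) :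
    synth s u (x + 1) = mode s 0 1 * synth s u x := by
  rw [synth_apply, synth_apply, ← tsum_mul_left]
  exact tsum_congr fun m => by rw [mode_add, mode_one]; ring

theorem hasDerivAt_synth (s : ℤ) (u v : SeqSpace)
    (h : ∀ m, v m = waveNumber s m * Complex.I * u m) (x : ℝ) :
    HasDerivAt (synth s u) (synth s v x) x := by
  have := hasDerivAt_tsum (g := fun m x => u m * mode s m x) (g' := fun m x => v m * mode s m x)
    v.summable (fun m y => ?_) (fun m y => (norm_mul_mode s _ m y).le)
    (summable_mul_mode s u 0) x
  · exact this
  · have := (hasDerivAt_mode s m y).const_mul (u m)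
    exact this.congr_deriv (by rw [h]; ring)

theorem synth_mul_synth (a : ℤ → ℂ) (ha : Summable fun k => ‖a k‖) (s : ℤ) (u : SeqSpace) (x : ℝ) :
    synth 0 (SeqSpace.mk a ha) x * synth s u x = synth s (convCLM a ha u) x := by
  set A : ℤ → ℂ := fun l => a l * mode 0 l x with hA
  set U : ℤ → ℂ := fun j => u j * mode s j x with hU
  have hAs : Summable fun l => ‖A l‖ := by simpa only [hA, norm_mul_mode] using ha
  have hUs : Summable fun l => ‖U l‖ := by simpa only [hU, norm_mul_mode] using u.summable
  have hprod : Summable fun p : ℤ × ℤ => A p.1 * U p.2 :=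
    Summable.of_norm (by simpa only [norm_mul] using summable_norm_mul_norm_prod hAs hUs)
  have hsh : Summable fun p : ℤ × ℤ => A (p.1 - p.2) * U p.2 :=
    shearEquiv.summable_iff (f := fun p : ℤ × ℤ => A p.1 * U p.2) |>.2 hprod
  have hterm : ∀ m j, A (m - j) * U j = a (m - j) * u j * mode s m x := by
    intro m j
    have := mode_mul_mode s (m - j) j x
    rw [sub_add_cancel] at this
    simp only [hA, hU]
    rw [← this]; ring
  calc synth 0 (SeqSpace.mk a ha) x * synth s u x = (∑' l, A l) * ∑' j, U j := rfl
    _ = ∑' p : ℤ × ℤ, A p.1 * U p.2 := tsum_mul_tsum_of_summable_norm hAs hUs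
    _ = ∑' p : ℤ × ℤ, A (p.1 - p.2) * U p.2 :=
        (shearEquiv.tsum_eq (fun p : ℤ × ℤ => A p.1 * U p.2)).symm
    _ = ∑' m, ∑' j, A (m - j) * U j := hsh.tsum_prod
    _ = synth s (convCLM a ha u) x := by
        rw [synth_apply]
        refine tsum_congr fun m => ?_
        simp only [hterm]
        rw [tsum_mul_right]
        rfl

/-- The absolutely convergent Fourier series defines a continuous function with the same `L²` class.
It replaces `q` in the equation, which is only imposed almost everywhere. -/
theorem potential_ae_eq (q : Potential) (ha : Summable fun k => ‖fourierCoeff q k‖) :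
    ∀ᵐ x : ℝ ∂(volume.restrict (Set.Ioc (0 : ℝ) 1)), q (x : UnitAddCircle) =
      synth 0 (SeqSpace.mk (fourierCoeff q) ha) x := by
  set a := fourierCoeff q with hadef
  have hs : Summable fun i => a i • (fourier i : C(UnitAddCircle, ℂ)) :=
    Summable.of_norm (by simpa only [norm_smul, fourier_norm, mul_one] using ha)
  set F : C(UnitAddCircle, ℂ) := ∑' i, a i • fourier i with hF
  have h1 : HasSum (fun i => a i • fourierLp 2 i)
      (ContinuousMap.toLp (E := ℂ) 2 AddCircle.haarAddCircle ℂ F) := by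
    have := hs.hasSum.mapL (ContinuousMap.toLp (E := ℂ) 2 (AddCircle.haarAddCircle (T := 1)) ℂ)
    simpa only [map_smul] using this
  have hq : q = ContinuousMap.toLp (E := ℂ) 2 AddCircle.haarAddCircle ℂ F :=
    (hasSum_fourier_series_L2 q).unique h1
  have h2 : ∀ᵐ y ∂(AddCircle.haarAddCircle : Measure UnitAddCircle), q y = F y := by
    have := ContinuousMap.coeFn_toLp (p := 2) (𝕜 := ℂ)
      (AddCircle.haarAddCircle : Measure UnitAddCircle) F
    rw [← hq] at this
    exact this
  have hvol : (volume : Measure UnitAddCircle) = AddCircle.haarAddCircle := by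
    rw [AddCircle.volume_eq_smul_haarAddCircle]; simp
  have hmp := UnitAddCircle.measurePreserving_mk 0
  rw [zero_add, hvol] at hmp
  have h3 := hmp.quasiMeasurePreserving.ae h2
  filter_upwards [h3] with x hx
  rw [hx, synth_apply, hF]
  have h4 := ContinuousMap.tsum_apply hs (x : UnitAddCircle)
  rw [← h4]
  refine tsum_congr fun m => ?_
  have h5 := mode_eq_fourier_mul 0 m x
  have h6 : mode 0 0 x = 1 := by simp [mode, waveNumber]
  rw [h6, mul_one] at h5
  rw [h5]; rfl

/-- A solution of the equation for the Fourier coefficients is a solution of Hill's equation. -/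
theorem isHillImage_synth (q : Potential) (ha : Summable fun k => ‖fourierCoeff q k‖) {s : ℤ}
    {σ : ℂ} (hσ : σ = mode s 0 1) {u v : SeqSpace}
    (h : ∀ k, (freeEigenvalue s k : ℂ) * u k + seqConv (fourierCoeff q) u k = v k) :
    IsHillImage q σ (synth s u) (synth s v) := by
  -- The equation itself places the coefficients of `u''` in `ℓ¹`; those of `u'` follow from `|κ| ≤
  -- 1 + κ²`.
  set d2 : SeqSpace := convCLM (fourierCoeff q) ha u - v with hd2
  have hd2k : ∀ k, d2 k = -(freeEigenvalue s k : ℂ) * u k := fun k => by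
    have : d2 k = seqConv (fourierCoeff q) u k - v k := rfl
    rw [this, ← h k]; ring
  have hs1 : Summable fun k => ‖(waveNumber s k * Complex.I * u k : ℂ)‖ := by
    refine Summable.of_nonneg_of_le (fun _ => norm_nonneg _) (fun k => ?_)
      (u.summable.add d2.summable)
    rw [hd2k, norm_mul, norm_mul, Complex.norm_I, mul_one, norm_mul, norm_neg, Complex.norm_real,
      Complex.norm_real, ← waveNumber_sq, Real.norm_eq_abs, Real.norm_eq_abs, abs_pow]
    have h1 : |waveNumber s k| ≤ 1 + |waveNumber s k| ^ 2 := by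
      nlinarith [sq_nonneg (|waveNumber s k| - 1), abs_nonneg (waveNumber s k)]
    nlinarith [norm_nonneg (u k)]
  set d1 : SeqSpace := SeqSpace.mk _ hs1 with hd1
  have hD1 : ∀ x, HasDerivAt (synth s u) (synth s d1 x) x :=
    hasDerivAt_synth s u d1 fun m => rfl
  have hD2 : ∀ x, HasDerivAt (synth s d1) (synth s d2 x) x := by
    refine hasDerivAt_synth s d1 d2 fun m => ?_
    have : d1 m = waveNumber s m * Complex.I * u m := rfl
    rw [hd2k, this, ← waveNumber_sq]
    push_cast
    linear_combination -(waveNumber s m : ℂ) ^ 2 * u m * Complex.I_sq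
  have hcont := continuous_synth s d2
  refine ⟨fun x => by rw [hσ, synth_add_one], fun x => (hD1 x).differentiableAt,
    synth s d2, ?_, fun x hx => ?_, ?_⟩
  · obtain ⟨C, hC⟩ := (isCompact_Icc (a := (0 : ℝ)) (b := 1)).exists_bound_of_continuousOn
      hcont.continuousOn
    refine MemLp.of_bound hcont.aestronglyMeasurable C ?_
    filter_upwards [ae_restrict_mem measurableSet_Ioc] with x hx
    exact hC x (Set.Ioc_subset_Icc_self hx)
  · rw [(hD1 x).deriv, (hD1 0).deriv,
      intervalIntegral.integral_eq_sub_of_hasDerivAt (fun y _ => hD2 y)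
        (hcont.intervalIntegrable 0 x)]
    ring
  · filter_upwards [potential_ae_eq q ha] with x hx
    rw [hx, synth_mul_synth, hd2, map_sub]
    simp only [Pi.sub_apply]
    ring

/-- The Fourier coefficients of a function on the unit interval. -/
def modeCoeff (s : ℤ) (f : ℝ → ℂ) (m : ℤ) : ℂ := ∫ x in (0 : ℝ)..1, f x * mode s m (-x)

theorem integral_mode (s j m : ℤ) :
    ∫ x in (0 : ℝ)..1, mode s j x * mode s m (-x) = if j = m then 1 else 0 := by
  have e : ∀ x : ℝ, mode s j x * mode s m (-x) =
      Complex.exp ((2 * Real.pi * Complex.I * ((j - m : ℤ) : ℂ)) * x) := fun x => by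
    rw [mode, mode, ← Complex.exp_add]
    congr 1; simp only [waveNumber]; push_cast; ring
  simp only [e]
  split_ifs with h
  · simp [h]
  · have hc : (2 * Real.pi * Complex.I * ((j - m : ℤ) : ℂ)) ≠ 0 := by
      have : ((j - m : ℤ) : ℂ) ≠ 0 := by exact_mod_cast sub_ne_zero.2 h
      exact mul_ne_zero Complex.two_pi_I_ne_zero this
    rw [integral_exp_mul_complex hc]
    have : Complex.exp (2 * Real.pi * Complex.I * ((j - m : ℤ) : ℂ)) = 1 := by
      rw [mul_comm]; exact Complex.exp_int_mul_two_pi_mul_I _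
    simp only [Complex.ofReal_one, mul_one, Complex.ofReal_zero, mul_zero, Complex.exp_zero]
    rw [this, sub_self, zero_div]

theorem integral_tsum_of_summable {b : ℤ → ℂ} (hb : Summable fun k => ‖b k‖) {G : ℤ → ℝ → ℂ}
    (hG : ∀ l, Continuous (G l)) {C : ℝ} (hC : ∀ l, ∀ x ∈ Set.Icc (0 : ℝ) 1, ‖G l x‖ ≤ C) :
    ∫ x in (0 : ℝ)..1, ∑' l, b l * G l x = ∑' l, b l * ∫ x in (0 : ℝ)..1, G l x := by
  have hbound : ∀ l, ∀ x ∈ Set.uIoc (0 : ℝ) 1, ‖b l * G l x‖ ≤ ‖b l‖ * C := fun l x hx => by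
    rw [Set.uIoc_of_le zero_le_one] at hx
    rw [norm_mul]
    exact mul_le_mul_of_nonneg_left (hC l x (Set.Ioc_subset_Icc_self hx)) (norm_nonneg _)
  have hbs : Summable fun l => ‖b l‖ * C := hb.mul_right C
  have := intervalIntegral.hasSum_integral_of_dominated_convergence (μ := volume) (a := 0) (b := 1)
    (F := fun l x => b l * G l x) (f := fun x => ∑' l, b l * G l x) (fun l _ => ‖b l‖ * C)
    (fun l => (continuous_const.mul (hG l)).aestronglyMeasurable)
    (fun l => Eventually.of_forall (hbound l))
    (Eventually.of_forall fun x _ => hbs)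
    intervalIntegrable_const
    (Eventually.of_forall fun x hx => by
      exact (Summable.of_norm_bounded hbs fun l => hbound l x hx).hasSum)
  rw [← this.tsum_eq]
  exact tsum_congr fun l => intervalIntegral.integral_const_mul _ _

theorem modeCoeff_synth (s : ℤ) (u : SeqSpace) (m : ℤ) : modeCoeff s (synth s u) m = u m := by
  have h := integral_tsum_of_summable u.summable (G := fun l x => mode s l x * mode s m (-x))
    (fun l => (continuous_mode s l).mul ((continuous_mode s m).comp continuous_neg)) (C := 1)
    (fun l x _ => by rw [norm_mul, norm_mode, norm_mode, one_mul])
  rw [modeCoeff]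
  calc _ = ∫ x in (0 : ℝ)..1, ∑' l, u l * (mode s l x * mode s m (-x)) := by
        congr 1; ext x
        rw [synth_apply, ← tsum_mul_right]
        exact tsum_congr fun l => mul_assoc _ _ _
    _ = _ := by
        rw [h]
        simp only [integral_mode, mul_ite, mul_one, mul_zero]
        exact tsum_ite_eq m _

theorem synth_injective (s : ℤ) : Function.Injective (synth s) := fun u v h => by
  ext m
  rw [← modeCoeff_synth s u m, ← modeCoeff_synth s v m, h]

theorem modeCoeff_synth_mul {a : ℤ → ℂ} (ha : Summable fun k => ‖a k‖) (s : ℤ) {f : ℝ → ℂ}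
    (hf : Continuous f) (m : ℤ) :
    modeCoeff s (fun x => synth 0 (SeqSpace.mk a ha) x * f x) m = seqConv a (modeCoeff s f) m := by
  obtain ⟨C, hC⟩ := (isCompact_Icc (a := (0 : ℝ)) (b := 1)).exists_bound_of_continuousOn
    hf.continuousOn
  have h := integral_tsum_of_summable ha
    (G := fun l x => mode 0 l x * (f x * mode s m (-x)))
    (fun l => (continuous_mode 0 l).mul
      (hf.mul ((continuous_mode s m).comp continuous_neg))) (C := C)
    (fun l x hx => by rw [norm_mul, norm_mul, norm_mode, norm_mode, one_mul, mul_one]; exact hC x hx)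
  have e : ∀ l x, mode 0 l x * (f x * mode s m (-x)) = f x * mode s (m - l) (-x) := fun l x => by
    have h1 := mode_mul_mode s l (m - l) (-x)
    rw [add_sub_cancel] at h1
    have h2 := mode_mul_neg 0 l x
    rw [← h1]
    linear_combination f x * mode s (m - l) (-x) * h2
  rw [modeCoeff]
  calc _ = ∫ x in (0 : ℝ)..1, ∑' l, a l * (mode 0 l x * (f x * mode s m (-x))) := by
        congr 1; ext x
        rw [synth_apply, mul_assoc, ← tsum_mul_right]
        exact tsum_congr fun l => mul_assoc _ _ _
    _ = ∑' l, a l * modeCoeff s f (m - l) := by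
        rw [h]
        simp only [e]
        rfl
    _ = _ := by
        rw [seqConv, ← (Equiv.subLeft m).tsum_eq]
        exact tsum_congr fun l => by simp

/-- Fourier inversion for quasi-periodic functions. -/
theorem eq_synth_of_summable {s : ℤ} {f : ℝ → ℂ} (hf : Continuous f)
    (hq : ∀ x, f (x + 1) = mode s 0 1 * f x) (hs : Summable fun k => ‖modeCoeff s f k‖) :
    f = synth s (SeqSpace.mk (modeCoeff s f) hs) := by
  -- Removing the factor `mode s 0` makes the function periodic, so Fourier inversion on the circle
  -- applies.
  set F : ℝ → ℂ := fun x => f x * mode s 0 (-x) with hF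
  have hper : Function.Periodic F 1 := fun x => by
    simp only [hF]
    rw [hq, neg_add, mode_add]
    linear_combination f x * mode s 0 (-x) * mode_mul_neg s 0 1
  have hFc : Continuous F := hf.mul ((continuous_mode s 0).comp continuous_neg)
  have hlc : Continuous (hper.lift : UnitAddCircle → ℂ) :=
    continuous_coinduced_dom.mpr hFc
  set Φ : C(UnitAddCircle, ℂ) := ⟨hper.lift, hlc⟩ with hΦ
  have hcoef : ∀ m, fourierCoeff Φ m = modeCoeff s f m := fun m => by
    rw [fourierCoeff_eq_intervalIntegral _ m 0, modeCoeff, zero_add, one_div, inv_one, one_smul]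
    congr 1; ext x
    have h1 : Φ (x : UnitAddCircle) = F x := Function.Periodic.lift_coe hper x
    rw [h1, hF]
    simp only [smul_eq_mul]
    rw [mode_eq_fourier_mul s m (-x)]
    have : fourier (-m) (x : UnitAddCircle) = fourier m ((-x : ℝ) : UnitAddCircle) := by
      rw [fourier_coe_apply, fourier_coe_apply]; push_cast; ring_nf
    rw [this]; ring
  have hsum : Summable (fourierCoeff Φ) := by
    rw [funext hcoef]; exact hs.of_norm
  ext x
  have h := has_pointwise_sum_fourier_series_of_summable hsum (x : UnitAddCircle)
  have h1 : Φ (x : UnitAddCircle) = F x := Function.Periodic.lift_coe hper x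
  rw [h1] at h
  have h2 := h.mul_right (mode s 0 x)
  have h3 : F x * mode s 0 x = f x := by
    simp only [hF]
    linear_combination f x * mode_mul_neg s 0 x
  rw [h3] at h2
  rw [synth_apply, ← h2.tsum_eq]
  refine tsum_congr fun m => ?_
  rw [hcoef, smul_eq_mul, SeqSpace.mk_apply, mode_eq_fourier_mul s m x]
  ring

/-- Integration by parts, where the boundary condition kills the boundary terms. The derivative is
required on `[0, 1]` only, because the equation gives no other information on `f'`. -/
theorem modeCoeff_deriv {s : ℤ} {f f' : ℝ → ℂ} (hf : ∀ x ∈ Set.Icc (0 : ℝ) 1, HasDerivAt f (f' x) x)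
    (hc : Continuous f') (h1 : f 1 = mode s 0 1 * f 0) (m : ℤ) :
    modeCoeff s f' m = waveNumber s m * Complex.I * modeCoeff s f m := by
  have hE : Continuous fun x => mode s m (-x) := (continuous_mode s m).comp continuous_neg
  have h := intervalIntegral.integral_deriv_mul_eq_sub (a := 0) (b := 1)
    (u := f) (u' := f') (v := fun x => mode s m (-x))
    (v' := fun x => -(waveNumber s m * Complex.I * mode s m (-x)))
    (by rw [Set.uIcc_of_le zero_le_one]; exact hf)
    (fun x _ => hasDerivAt_mode_neg s m x) (hc.intervalIntegrable _ _)
    ((continuous_const.mul hE).neg.intervalIntegrable _ _)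
  have hfc : ContinuousOn f (Set.uIcc 0 1) := by
    rw [Set.uIcc_of_le zero_le_one]
    exact fun x hx => (hf x hx).continuousAt.continuousWithinAt
  have e1 : f 1 * mode s m (-1) - f 0 * mode s m (-0) = 0 := by
    rw [h1, neg_zero, mode_zero, ← mode_one s m]
    linear_combination f 0 * mode_mul_neg s m 1
  have i1 : IntervalIntegrable (fun x => f' x * mode s m (-x)) volume 0 1 :=
    (hc.mul hE).intervalIntegrable _ _
  have i2 : IntervalIntegrable
      (fun x => f x * -(waveNumber s m * Complex.I * mode s m (-x))) volume 0 1 :=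
    (hfc.mul (continuous_const.mul hE).neg.continuousOn).intervalIntegrable
  rw [e1, intervalIntegral.integral_add i1 i2] at h
  have e2 : ∫ x in (0 : ℝ)..1, f x * -(waveNumber s m * Complex.I * mode s m (-x)) =
      -(waveNumber s m * Complex.I) * modeCoeff s f m := by
    rw [modeCoeff, ← intervalIntegral.integral_const_mul]
    congr 1; ext x; ring
  rw [e2] at h
  rw [modeCoeff]
  linear_combination h

/-- Solutions of Hill's equation with continuous right-hand side are given by absolutely convergent
Fourier series. -/
theorem IsHillImage.exists_synth {q : Potential} (ha : Summable fun k => ‖fourierCoeff q k‖)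
    {s : ℤ} {σ : ℂ} (hσ : σ = mode s 0 1) {f g : ℝ → ℂ} (h : IsHillImage q σ f g)
    (hg : Continuous g) : ∃ u : SeqSpace, f = synth s u ∧
      ∀ k, (freeEigenvalue s k : ℂ) * u k + seqConv (fourierCoeff q) u k = modeCoeff s g k := by
  obtain ⟨hper, hdiff, h, hmem, hint, hae⟩ := h
  set Q := synth 0 (SeqSpace.mk (fourierCoeff q) ha) with hQ
  have hfc : Continuous f := hdiff.continuous
  set H : ℝ → ℂ := fun x => Q x * f x - g x with hH
  have hHc : Continuous H := ((continuous_synth 0 _).mul hfc).sub hg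
  have hHae : ∀ᵐ x ∂(volume.restrict (Set.Ioc (0 : ℝ) 1)), h x = H x := by
    filter_upwards [hae, potential_ae_eq q ha] with x h1 h2
    simp only [hH, hQ]
    rw [← h2, ← h1]; ring
  -- A representative of `f'` on `[0, 1]` that is continuously differentiable, since `h` agrees
  -- almost everywhere with the continuous function `H`.
  set φ : ℝ → ℂ := fun x => deriv f 0 + ∫ t in (0 : ℝ)..x, H t with hφ
  have hφd : ∀ x, HasDerivAt φ (H x) x := fun x =>
    (intervalIntegral.integral_hasDerivAt_right (hHc.intervalIntegrable _ _)
      (hHc.stronglyMeasurableAtFilter _ _) hHc.continuousAt).const_add _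
  have hφc : Continuous φ := continuous_iff_continuousAt.2 fun x => (hφd x).continuousAt
  have hfφ : ∀ x ∈ Set.Icc (0 : ℝ) 1, deriv f x = φ x := fun x hx => by
    rw [hint x hx, hφ]
    congr 1
    refine intervalIntegral.integral_congr_ae ?_
    rw [Set.uIoc_of_le hx.1]
    have h1 := (ae_restrict_iff' measurableSet_Ioc).1 hHae
    filter_upwards [h1] with y hy hy'
    exact hy ⟨hy'.1, hy'.2.trans hx.2⟩
  have hfd : ∀ x ∈ Set.Icc (0 : ℝ) 1, HasDerivAt f (φ x) x := fun x hx => by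
    rw [← hfφ x hx]; exact (hdiff x).hasDerivAt
  have hf1 : f 1 = mode s 0 1 * f 0 := by
    have := hper 0
    rwa [zero_add, hσ] at this
  -- The boundary condition for the derivative comes from differentiating the quasiperiodicity of
  -- `f` on the whole line.
  have hφ1 : φ 1 = mode s 0 1 * φ 0 := by
    rw [← hfφ 1 (by simp), ← hfφ 0 (by simp)]
    have h1 : deriv (fun x => f (x + 1)) 0 = deriv f 1 := by
      rw [deriv_comp_add_const, zero_add]
    rw [← h1, funext hper, deriv_const_mul _ (hdiff 0), hσ]
  have hcf : ∀ m, modeCoeff s H m = -(freeEigenvalue s m : ℂ) * modeCoeff s f m := fun m => by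
    rw [modeCoeff_deriv (fun x _ => hφd x) hHc hφ1 m, modeCoeff_deriv hfd hφc hf1 m,
      ← waveNumber_sq]
    push_cast
    linear_combination (waveNumber s m : ℂ) ^ 2 * modeCoeff s f m * Complex.I_sq
  obtain ⟨C, hC⟩ := (isCompact_Icc (a := (0 : ℝ)) (b := 1)).exists_bound_of_continuousOn
    hHc.continuousOn
  have hHb : ∀ m, ‖modeCoeff s H m‖ ≤ C := fun m => by
    have := intervalIntegral.norm_integral_le_of_norm_le_const (a := (0 : ℝ)) (b := 1) (C := C)
      (f := fun x => H x * mode s m (-x)) fun x hx => by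
        rw [Set.uIoc_of_le zero_le_one] at hx
        rw [norm_mul_mode]
        exact hC x (Set.Ioc_subset_Icc_self hx)
    simpa [modeCoeff] using this
  -- The coefficients of `f''` are bounded, so those of `f` decay quadratically; the possible mode
  -- `2 k + s = 0` is set aside.
  have hs : Summable fun k => ‖modeCoeff s f k‖ := by
    have hsum : Summable fun k : ℤ => C * (1 / ((2 * k + s : ℤ) : ℝ) ^ 2) :=
      (summable_shifted_inv_sq s).1.mul_left C
    refine Summable.of_norm_bounded_eventually hsum ?_
    have hfin : {k : ℤ | 2 * k + s = 0}.Finite :=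
      Set.Subsingleton.finite fun x hx y hy => by
        have h1 : 2 * x + s = 0 := hx
        have h2 : 2 * y + s = 0 := hy
        omega
    filter_upwards [hfin.compl_mem_cofinite] with k hk
    have hk0 : 2 * k + s ≠ 0 := hk
    have hk1 : (0 : ℝ) < ((2 * k + s : ℤ) : ℝ) ^ 2 := by
      have : ((2 * k + s : ℤ) : ℝ) ≠ 0 := by exact_mod_cast hk0
      positivity
    rw [norm_norm, mul_one_div, le_div_iff₀ hk1]
    have h1 := hHb k
    rw [hcf, norm_mul, norm_neg, Complex.norm_real, freeEigenvalue, Real.norm_of_nonneg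
      (by positivity)] at h1
    have hpi : (1 : ℝ) ≤ Real.pi ^ 2 := by nlinarith [Real.pi_gt_three]
    have h2 : 0 ≤ ((2 * k + s : ℤ) : ℝ) ^ 2 * ‖modeCoeff s f k‖ := by positivity
    nlinarith
  refine ⟨SeqSpace.mk (modeCoeff s f) hs,
    eq_synth_of_summable hfc (fun x => by rw [hper, hσ]) hs, fun k => ?_⟩
  have h1 := hcf k
  have h2 := modeCoeff_synth_mul ha s hfc k
  have hE : Continuous fun x => mode s k (-x) := (continuous_mode s k).comp continuous_neg
  have h3 : modeCoeff s H k = modeCoeff s (fun x => Q x * f x) k - modeCoeff s g k := by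
    simp only [modeCoeff, hH, sub_mul]
    exact intervalIntegral.integral_sub
      ((((continuous_synth 0 _).mul hfc).mul hE).intervalIntegrable _ _)
      ((hg.mul hE).intervalIntegrable _ _)
  have h4 : seqConv (fourierCoeff q) (SeqSpace.mk (modeCoeff s f) hs) k =
      seqConv (fourierCoeff q) (modeCoeff s f) k := rfl
  rw [h4, SeqSpace.mk_apply]
  linear_combination h1 - h3 - h2

end

/-! ### Root spaces and the reduced matrix -/

noncomputable section

section RootSpaces

variable {q : Potential} {s : ℤ} {σ : ℂ} {P : Finset ℤ} {Y : P → SeqSpace} {z : ℂ}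

theorem mem_hillKernel_succ {k : ℕ} {f : ℝ → ℂ} : f ∈ hillKernel q σ z (k + 1) ↔
    ∃ g ∈ hillKernel q σ z k, IsHillImage q σ f (z • f + g) := Iff.rfl

/-- The kernels of `(L - z)^k` are parametrized by the kernels of the reduced matrix. -/
theorem hillKernel_eq_map (ha : Summable fun k => ‖fourierCoeff q k‖) (hσ : σ = mode s 0 1)
    (hY : IsInvariantGraph (fourierCoeff q) s 1 Y)
    (hz : ∀ k ∉ P, z.re + ∑' j, ‖fourierCoeff q j‖ < freeEigenvalue s k) (k : ℕ) :
    hillKernel q σ z k = Submodule.map (synth s ∘ₗ graphMap Y)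
      (Module.End.genEigenspace (Matrix.toLin' (reducedMatrix (fourierCoeff q) s 1 Y)) z k) := by
  set φ : Module.End ℂ (P → ℂ) := Matrix.toLin' (reducedMatrix (fourierCoeff q) s 1 Y) with hφ
  have hstep : ∀ (k : ℕ) (p : P → ℂ), p ∈ φ.genEigenspace z ((k + 1 : ℕ) : ℕ∞) ↔
      φ p - z • p ∈ φ.genEigenspace z (k : ℕ∞) := by
    intro k p
    rw [Module.End.mem_genEigenspace_nat, Module.End.mem_genEigenspace_nat, LinearMap.mem_ker,
      LinearMap.mem_ker, pow_succ]
    rfl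
  induction k with
  | zero =>
    rw [Nat.cast_zero, Module.End.genEigenspace_zero, Submodule.map_bot]
    rfl
  | succ k ih =>
    ext f
    rw [mem_hillKernel_succ, ih]
    constructor
    · rintro ⟨g, ⟨p', hp', rfl⟩, hf⟩
      have hfc : Continuous f := hf.differentiable.continuous
      -- By induction the previous kernel consists of synthesized functions. This supplies the
      -- continuity needed to expand `f` in an `ℓ¹` Fourier series.
      have hgc : Continuous (z • f + (synth s ∘ₗ graphMap Y) p') :=
        (hfc.const_smul z).add (continuous_synth s _)
      obtain ⟨u, rfl, hu⟩ := hf.exists_synth ha hσ hgc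
      have hg : z • synth s u + (synth s ∘ₗ graphMap Y) p' = synth s (z • u + graphMap Y p') := by
        rw [map_add, map_smul]; rfl
      have hu' : ∀ k, (freeEigenvalue s k : ℂ) * u k + 1 * seqConv (fourierCoeff q) u k =
          z * u k + graphMap Y p' k := fun k => by
        rw [one_mul, hu, hg, modeCoeff_synth]; rfl
      obtain ⟨p, rfl, hp⟩ := hY.exists_of_equation ha (by simp) hz hu'
      refine ⟨p, ?_, rfl⟩
      have : φ p - z • p = p' := by
        rw [hφ, Matrix.toLin'_apply, hp, add_sub_cancel_left]
      exact (hstep k p).2 (this ▸ hp')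
    · rintro ⟨p, hp, rfl⟩
      refine ⟨(synth s ∘ₗ graphMap Y) (φ p - z • p), ⟨_, (hstep k p).1 hp, rfl⟩, ?_⟩
      have e : z • (synth s ∘ₗ graphMap Y) p + (synth s ∘ₗ graphMap Y) (φ p - z • p) =
          synth s (graphMap Y (φ p)) := by
        rw [map_sub, map_smul, add_sub_cancel]; rfl
      rw [e]
      refine isHillImage_synth q ha hσ fun k => ?_
      have := hY.apply_graphMap ha p k
      rwa [one_mul] at this

/-- The injective map `synth s ∘ₗ graphMap Y` carries the generalized eigenspace of the matrix onto
the root space, and the dimension of the former is the multiplicity of the characteristic root. -/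
theorem rank_hillRootSpace (ha : Summable fun k => ‖fourierCoeff q k‖) (hσ : σ = mode s 0 1)
    (hY : IsInvariantGraph (fourierCoeff q) s 1 Y)
    (hz : ∀ k ∉ P, z.re + ∑' j, ‖fourierCoeff q j‖ < freeEigenvalue s k) :
    Module.rank ℂ (hillRootSpace q σ z) =
      (reducedMatrix (fourierCoeff q) s 1 Y).charpoly.roots.count z := by
  have hinj : Function.Injective (synth s ∘ₗ graphMap Y) :=
    (synth_injective s).comp hY.graphMap_injective
  have h : hillRootSpace q σ z = Submodule.map (synth s ∘ₗ graphMap Y)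
      (Module.End.maxGenEigenspace (Matrix.toLin' (reducedMatrix (fourierCoeff q) s 1 Y)) z) := by
    rw [hillRootSpace, ← Module.End.iSup_genEigenspace_eq, Submodule.map_iSup]
    exact iSup_congr fun k => hillKernel_eq_map ha hσ hY hz k
  rw [h, ← (Submodule.equivMapOfInjective _ hinj _).rank_eq, ← Module.finrank_eq_rank,
    LinearMap.finrank_maxGenEigenspace_eq, Matrix.charpoly_toLin', Polynomial.count_roots]

/-- A nontrivial root space contains an eigenfunction, and thus an `ℓ¹` eigenvector. -/
theorem exists_eigenvector (ha : Summable fun k => ‖fourierCoeff q k‖) (hσ : σ = mode s 0 1)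
    (h : Module.rank ℂ (hillRootSpace q σ z) ≠ 0) : ∃ u : SeqSpace, u ≠ 0 ∧
      ∀ k, ((freeEigenvalue s k : ℂ) - z) * u k + seqConv (fourierCoeff q) u k = 0 := by
  have h1 : hillKernel q σ z 1 ≠ ⊥ := by
    intro h1
    apply h
    have hall : ∀ k, hillKernel q σ z k = ⊥ := by
      intro k
      induction k with
      | zero => rfl
      | succ k ih =>
        rw [eq_bot_iff, ← h1]
        rintro f ⟨g, hg, hf⟩
        rw [ih] at hg
        exact ⟨g, hg, hf⟩
    have : hillRootSpace q σ z = ⊥ := by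
      rw [hillRootSpace, iSup_congr hall, iSup_bot]
    rw [this, rank_bot]
  obtain ⟨f, ⟨g, hg, hf⟩, hf0⟩ := Submodule.exists_mem_ne_zero_of_ne_bot h1
  have hg0 : g = 0 := hg
  rw [hg0, add_zero] at hf
  obtain ⟨u, rfl, hu⟩ := hf.exists_synth ha hσ (hf.differentiable.continuous.const_smul z)
  refine ⟨u, fun h0 => hf0 (by rw [h0, map_zero]), fun k => ?_⟩
  have := hu k
  rw [← map_smul, modeCoeff_synth] at this
  have e : (z • u) k = z * u k := rfl
  rw [e] at this
  linear_combination this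

end RootSpaces

/-! ### Counting eigenvalues to the left of a vertical line -/

/-- The modes `m` with `|2 m + s| ≤ K`. -/
def lowModes (s : ℤ) (K : ℕ) : Finset ℤ :=
  (Finset.Icc (-(K + |s| : ℤ)) (K + |s|)).filter fun m => |2 * m + s| ≤ K

theorem mem_lowModes {s : ℤ} {K : ℕ} {m : ℤ} : m ∈ lowModes s K ↔ |2 * m + s| ≤ K := by
  rw [lowModes, Finset.mem_filter, Finset.mem_Icc, and_iff_right_iff_imp]
  intro h
  have h1 := abs_le.1 h
  have h2 := le_abs_self s
  have h3 := neg_abs_le s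
  constructor <;> omega

/-- The maps `m ↦ 2 m` and `m ↦ 2 m + 1` identify the two sets with the even and the odd integers in
`[-K, K]`. -/
theorem card_lowModes_add (K : ℕ) : (lowModes 0 K).card + (lowModes 1 K).card = 2 * K + 1 := by
  have h0 : (lowModes 0 K).image (fun m => 2 * m + 0) =
      (Finset.Icc (-(K : ℤ)) K).filter fun k => k % 2 = 0 := by
    ext k
    simp only [Finset.mem_image, mem_lowModes, Finset.mem_filter,
      Finset.mem_Icc, abs_le]
    constructor
    · rintro ⟨m, hm, rfl⟩; omega
    · rintro ⟨h1, h2⟩; exact ⟨k / 2, by omega, by omega⟩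
  have h1 : (lowModes 1 K).image (fun m => 2 * m + 1) =
      (Finset.Icc (-(K : ℤ)) K).filter fun k => ¬ k % 2 = 0 := by
    ext k
    simp only [Finset.mem_image, mem_lowModes, Finset.mem_filter,
      Finset.mem_Icc, abs_le]
    constructor
    · rintro ⟨m, hm, rfl⟩; omega
    · rintro ⟨h1, h2⟩; exact ⟨k / 2, by omega, by omega⟩
  have h2 := Finset.card_filter_add_card_filter_not (s := Finset.Icc (-(K : ℤ)) K)
    fun k => k % 2 = 0
  rw [← h0, ← h1, Finset.card_image_of_injective _ fun x y h => by
      have h' : 2 * x + 0 = 2 * y + 0 := h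
      omega, Finset.card_image_of_injective _ fun x y h => by
      have h' : 2 * x + 1 = 2 * y + 1 := h
      omega, Int.card_Icc] at h2
  omega

theorem freeEigenvalue_le_of_abs_le {s m : ℤ} {K : ℕ} (h : |2 * m + s| ≤ K) :
    freeEigenvalue s m ≤ Real.pi ^ 2 * (K : ℝ) ^ 2 := by
  have : |((2 * m + s : ℤ) : ℝ)| ≤ K := by exact_mod_cast h
  rw [freeEigenvalue, ← sq_abs ((2 * m + s : ℤ) : ℝ)]
  gcongr

theorem le_freeEigenvalue_of_lt_abs {s m : ℤ} {K : ℕ} (h : ¬|2 * m + s| ≤ K) :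
    Real.pi ^ 2 * ((K : ℝ) + 1) ^ 2 ≤ freeEigenvalue s m := by
  have h1 : (K : ℤ) + 1 ≤ |2 * m + s| := by omega
  have : (K : ℝ) + 1 ≤ |((2 * m + s : ℤ) : ℝ)| := by exact_mod_cast h1
  rw [freeEigenvalue, ← sq_abs ((2 * m + s : ℤ) : ℝ)]
  gcongr

theorem reducedMatrix_zero (a : ℤ → ℂ) (s : ℤ) {P : Finset ℤ} (Y : P → SeqSpace) :
    reducedMatrix a s 0 Y = Matrix.diagonal fun i : P => (freeEigenvalue s i : ℂ) := by
  ext i j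
  simp [reducedMatrix, Matrix.diagonal_apply]

theorem rootCountBelow_diagonal {P : Finset ℤ} (d : ℤ → ℝ) (c : ℝ) :
    rootCountBelow (Matrix.diagonal fun i : P => (d i : ℂ)).charpoly c =
      (P.filter fun m => d m < c).card := by
  have h : (Matrix.diagonal fun i : P => (d i : ℂ)).charpoly.roots =
      Finset.univ.val.map fun i : P => (d i : ℂ) := by
    apply charpoly_eq_of_eval
    intro x
    have : Matrix.scalar P x - Matrix.diagonal (fun i : P => (d i : ℂ)) =
        Matrix.diagonal fun i : P => x - d i := by
      ext i j
      by_cases h : i = j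
      · subst h; simp
      · simp [h]
    rw [this, Matrix.det_diagonal]
  rw [rootCountBelow, h, Multiset.countP_map]
  simp only [Complex.ofReal_re]
  have h1 : (Multiset.filter (fun i : P => d i < c) Finset.univ.val).card =
      (Finset.univ.filter fun i : P => d i < c).card := rfl
  rw [h1, ← Finset.card_map (Function.Embedding.subtype _)]
  congr 1
  ext m
  simp [and_comm]

/-- Localization of the eigenvalues of one parity to the left of a vertical line. -/
theorem exists_multiset_rank {q : Potential} {s : ℤ} {σ : ℂ} {n ℓ : ℕ}
    (ha : Summable fun k => ‖fourierCoeff q k‖) (hσ : σ = mode s 0 1) (hn : 1 ≤ n)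
    (ha2 : Summable fun k => ‖fourierCoeff q k‖ ^ 2)
    (han : ∑' k, ‖fourierCoeff q k‖ ^ 2 ≤ (n : ℝ) ^ 2 / 16) {c : ℝ}
    (hc : |c - (n : ℝ) ^ 2 * Real.pi ^ 2| = 4 * n) (hℓn : ℓ ≤ n)
    (hℓ : ∀ m, freeEigenvalue s m < c ↔ |2 * m + s| ≤ ℓ) :
    ∃ Z : Multiset ℂ, (∀ z ∈ Z, z.re < c) ∧ Multiset.card Z = (lowModes s ℓ).card ∧
      ∀ z : ℂ, z.re < c → Module.rank ℂ (hillRootSpace q σ z) = Z.count z := by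
  set a := fourierCoeff q with hadef
  set M := ∑' k, ‖a k‖ with hM
  have hM0 : 0 ≤ M := tsum_nonneg fun _ => norm_nonneg _
  obtain ⟨B, hB⟩ := exists_nat_ge M
  -- With `B ≥ M` the gap after `P` is at least `9 (2 K + 1) ≥ 8 M + 1`, and the modes off `P` lie
  -- beyond `c + M`. The summand `1` keeps the gap constant positive when `q = 0`.
  set K := n + B with hK
  set P := lowModes s K with hP
  have hn' : (1 : ℝ) ≤ n := by exact_mod_cast hn
  have hpi : (9 : ℝ) ≤ Real.pi ^ 2 := by nlinarith [Real.pi_gt_three]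
  have hKr : (K : ℝ) = n + B := by rw [hK]; push_cast; rfl
  have hgap : ∀ k ∉ P, ∀ j ∈ P, 8 * M + 1 ≤ freeEigenvalue s k - freeEigenvalue s j := by
    intro k hk j hj
    have h1 := le_freeEigenvalue_of_lt_abs fun h => hk (mem_lowModes.2 h)
    have h2 := freeEigenvalue_le_of_abs_le (mem_lowModes.1 hj)
    have h3 : 9 * (2 * (K : ℝ) + 1) ≤ Real.pi ^ 2 * (2 * K + 1) := by gcongr
    nlinarith
  have hfar : ∀ z : ℂ, z.re < c → ∀ k ∉ P, z.re + ∑' j, ‖a j‖ < freeEigenvalue s k := by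
    intro z hz k hk
    have h1 := le_freeEigenvalue_of_lt_abs fun h => hk (mem_lowModes.2 h)
    have h2 : c ≤ (n : ℝ) ^ 2 * Real.pi ^ 2 + 4 * n := by
      have := le_abs_self (c - (n : ℝ) ^ 2 * Real.pi ^ 2)
      linarith
    have hB0 : (0 : ℝ) ≤ B := by positivity
    have h3 : (n : ℝ) ^ 2 + 2 * n + B ≤ ((K : ℝ) + 1) ^ 2 := by
      rw [hKr]; nlinarith
    have h4 : Real.pi ^ 2 * ((n : ℝ) ^ 2 + 2 * n + B) ≤ Real.pi ^ 2 * ((K : ℝ) + 1) ^ 2 := by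
      gcongr
    have h5 : 9 * (2 * (n : ℝ) + B) ≤ Real.pi ^ 2 * (2 * n + B) := by gcongr
    nlinarith
  obtain ⟨Y, hYc, hY⟩ := exists_invariantGraph (a := a) (s := s) (P := P) (δ := 8 * M + 1)
    (by linarith) ha (by positivity) hgap
  have hGc := continuous_reducedMatrix (s := s) hYc ha
  -- A matrix eigenvector on the line would lift to a nonzero `ℓ¹` eigenvector of `D + t V`, which
  -- is excluded there.
  have hline : ∀ (t : unitInterval) (z : ℂ),
      (reducedMatrix a s ((t : ℝ) : ℂ) (Y t)).charpoly.IsRoot z → z.re ≠ c := by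
    intro t z hz hzc
    have hz' : Module.End.HasEigenvalue
        (Matrix.toLin' (reducedMatrix a s ((t : ℝ) : ℂ) (Y t))) z := by
      rw [Module.End.hasEigenvalue_iff_mem_spectrum, Matrix.spectrum_toLin',
        Matrix.mem_spectrum_iff_isRoot_charpoly]
      exact hz
    obtain ⟨p, hp, hp0⟩ := hz'.exists_hasEigenvector
    rw [Module.End.mem_eigenspace_iff, Matrix.toLin'_apply] at hp
    have ht : ‖((t : ℝ) : ℂ)‖ ≤ 1 := by
      rw [Complex.norm_real, Real.norm_of_nonneg t.2.1]; exact t.2.2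
    have h0 : ((graphMap (Y t) p : SeqSpace) : ℤ → ℂ) = 0 := by
      refine eigenvector_eq_zero_of_inv_sq_le (s := s) (z := z) ha hn ha2 han (by rw [hzc, hc])
        (Or.inl (by rw [hzc, hc])) ht (graphMap (Y t) p).summable fun k => ?_
      have h1 := (hY t).apply_graphMap ha p k
      rw [hp, map_smul] at h1
      have h2 : (z • graphMap (Y t) p) k = z * graphMap (Y t) p k := rfl
      rw [h2] at h1
      linear_combination h1
    apply hp0
    apply (hY t).graphMap_injective
    rw [map_zero]
    exact lp.ext h0
  have hcount := rootCountBelow_charpoly_eq hGc hline 1 0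
  have e1 : (((1 : unitInterval) : ℝ) : ℂ) = 1 := by simp
  have e0 : (((0 : unitInterval) : ℝ) : ℂ) = 0 := by simp
  have hY1 := hY 1
  simp only [e1, e0, reducedMatrix_zero, rootCountBelow_diagonal] at hcount hY1
  refine ⟨(reducedMatrix a s 1 (Y 1)).charpoly.roots.filter fun z => z.re < c,
    fun z hz => (Multiset.mem_filter.1 hz).2, ?_, fun z hz => ?_⟩
  · rw [← Multiset.countP_eq_card_filter]
    refine hcount.trans ?_
    congr 1
    ext m
    rw [Finset.mem_filter, mem_lowModes, mem_lowModes, hℓ]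
    refine ⟨fun h => h.2, fun h => ⟨h.trans ?_, h⟩⟩
    exact_mod_cast hℓn.trans (Nat.le_add_right n B)
  · rw [Multiset.count_filter_of_pos (p := fun z : ℂ => z.re < c) hz]
    exact rank_hillRootSpace ha hσ hY1 (hfar z hz)

theorem mode_zero_zero_one : (1 : ℂ) = mode 0 0 1 := by simp [mode, waveNumber]

theorem mode_one_zero_one : (-1 : ℂ) = mode 1 0 1 := by simp [mode, waveNumber]

/-- Localization of all periodic and antiperiodic eigenvalues to the left of a vertical line. -/
theorem exists_multiset_periodicMultiplicity {q : Potential} {n ℓ : ℕ}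
    (ha : Summable fun k => ‖fourierCoeff q k‖) (hn : 1 ≤ n)
    (ha2 : Summable fun k => ‖fourierCoeff q k‖ ^ 2)
    (han : ∑' k, ‖fourierCoeff q k‖ ^ 2 ≤ (n : ℝ) ^ 2 / 16) {c : ℝ}
    (hc : |c - (n : ℝ) ^ 2 * Real.pi ^ 2| = 4 * n) (hℓn : ℓ ≤ n)
    (hℓ : ∀ s m, freeEigenvalue s m < c ↔ |2 * m + s| ≤ ℓ) :
    ∃ Z : Multiset ℂ, (∀ z ∈ Z, z.re < c) ∧ Multiset.card Z = 2 * ℓ + 1 ∧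
      ∀ z : ℂ, z.re < c → periodicMultiplicity q z = Z.count z := by
  obtain ⟨Z₀, h1, h2, h3⟩ := exists_multiset_rank ha mode_zero_zero_one hn ha2 han hc hℓn (hℓ 0)
  obtain ⟨Z₁, g1, g2, g3⟩ := exists_multiset_rank ha mode_one_zero_one hn ha2 han hc hℓn (hℓ 1)
  refine ⟨Z₀ + Z₁, fun z hz => ?_, ?_, fun z hz => ?_⟩
  · rcases Multiset.mem_add.1 hz with h | h
    exacts [h1 z h, g1 z h]
  · rw [Multiset.card_add, h2, g2, card_lowModes_add]
  · rw [periodicMultiplicity, h3 z hz, g3 z hz, Multiset.count_add, Nat.cast_add]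

/-- The line lies between `π² n²` and `π² (n + 1)²`, because `π² (2 n + 1) > 4 n`. -/
theorem freeEigenvalue_lt_upper {n : ℕ} (hn : 1 ≤ n) (s m : ℤ) :
    freeEigenvalue s m < (n : ℝ) ^ 2 * Real.pi ^ 2 + 4 * n ↔ |2 * m + s| ≤ (n : ℤ) := by
  have hn' : (1 : ℝ) ≤ n := by exact_mod_cast hn
  have hpi : (9 : ℝ) ≤ Real.pi ^ 2 := by nlinarith [Real.pi_gt_three]
  constructor
  · intro h
    by_contra hlt
    have h1 := le_freeEigenvalue_of_lt_abs hlt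
    nlinarith
  · intro h
    have h1 := freeEigenvalue_le_of_abs_le h
    nlinarith

theorem freeEigenvalue_lt_lower {n : ℕ} (hn : 1 ≤ n) (s m : ℤ) :
    freeEigenvalue s m < (n : ℝ) ^ 2 * Real.pi ^ 2 - 4 * n ↔ |2 * m + s| ≤ ((n - 1 : ℕ) : ℤ) := by
  obtain ⟨k, rfl⟩ : ∃ k, n = k + 1 := ⟨n - 1, by omega⟩
  have hpi : (9 : ℝ) ≤ Real.pi ^ 2 := by nlinarith [Real.pi_gt_three]
  have hk : (0 : ℝ) ≤ k := by positivity
  rw [Nat.add_sub_cancel]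
  push_cast
  constructor
  · intro h
    by_contra hlt
    have h1 := le_freeEigenvalue_of_lt_abs hlt
    nlinarith
  · intro h
    have h1 := freeEigenvalue_le_of_abs_le h
    nlinarith

end

noncomputable section

/-! ### Enumeration in lexicographic order -/

/-- The points `z` repeated `cnt z` times, in lexicographic order. -/
abbrev LexIndex (cnt : ℂ → ℕ) : Type :=
  {x : ℝ ×ₗ ℝ ×ₗ ℕ // (ofLex (ofLex x).2).2 < cnt ⟨(ofLex x).1, (ofLex (ofLex x).2).1⟩}

namespace LexIndex

variable {cnt : ℂ → ℕ}

/-- The complex number underlying an index. -/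
def point (x : LexIndex cnt) : ℂ := ⟨(ofLex x.1).1, (ofLex (ofLex x.1).2).1⟩

/-- The number of a copy. -/
def copy (x : LexIndex cnt) : ℕ := (ofLex (ofLex x.1).2).2

theorem copy_lt (x : LexIndex cnt) : x.copy < cnt x.point := x.2

/-- The `i`-th copy of `z`. -/
def mk (z : ℂ) (i : ℕ) (h : i < cnt z) : LexIndex cnt := ⟨toLex (z.re, toLex (z.im, i)), h⟩

theorem ext' {x y : LexIndex cnt} (h1 : x.point = y.point) (h2 : x.copy = y.copy) : x = y := by
  have hre := congrArg Complex.re h1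
  have him := congrArg Complex.im h1
  apply Subtype.ext
  apply ofLex.injective
  refine Prod.ext hre ?_
  apply ofLex.injective
  exact Prod.ext him h2

theorem lexLE_of_le {x y : LexIndex cnt} (h : x ≤ y) : LexLE x.point y.point := by
  have h' : x.1 ≤ y.1 := h
  rw [Prod.Lex.le_iff] at h'
  rcases h' with h' | ⟨h1, h2⟩
  · exact Or.inl h'
  · rw [Prod.Lex.le_iff] at h2
    refine Or.inr ⟨h1, ?_⟩
    rcases h2 with h2 | ⟨h2, -⟩
    · exact h2.le
    · exact h2.le

end LexIndex

/-- The points with numbered copies form an infinite linear order whose initial segments are finite,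
hence one isomorphic to `ℕ`. In `H` the lines move to infinity, which makes initial segments finite;
in `H'` the counts are unbounded, which makes the order infinite. -/
theorem exists_lex_sequence {mult : ℂ → Cardinal}
    (H : ∀ N : ℕ, ∃ (c : ℝ) (Z : Multiset ℂ), (N : ℝ) ≤ c ∧ N ≤ Multiset.card Z ∧
      ∀ z : ℂ, z.re < c → mult z = Z.count z)
    (H' : ∀ N : ℕ, ∃ (c : ℝ) (Z : Multiset ℂ), N ≤ Multiset.card Z ∧ (∀ z ∈ Z, z.re < c) ∧
      ∀ z : ℂ, z.re < c → mult z = Z.count z) :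
    ∃ lam : ℕ → ℂ, (∀ j k : ℕ, j ≤ k → LexLE (lam j) (lam k)) ∧
      ∀ z : ℂ, Cardinal.mk {k : ℕ // lam k = z} = mult z := by
  have hex : ∀ z : ℂ, ∃ m : ℕ, mult z = m := fun z => by
    obtain ⟨N, hN⟩ := exists_nat_gt z.re
    obtain ⟨c, Z, hc, -, hZ⟩ := H N
    exact ⟨_, hZ z (hN.trans_le hc)⟩
  choose cnt hcnt using hex
  have hfin : ∀ x : LexIndex cnt, (Set.Iic x).Finite := by
    intro x
    obtain ⟨N, hN⟩ := exists_nat_gt x.point.re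
    obtain ⟨c, Z, hc, -, hZ⟩ := H N
    have hmaps : Set.MapsTo (fun y : LexIndex cnt => (y.point, y.copy)) (Set.Iic x)
        ((Z.toFinset ×ˢ Finset.range (Multiset.card Z) : Finset (ℂ × ℕ)) : Set (ℂ × ℕ)) := by
      intro y hy
      have hre : y.point.re < c := by
        have : y.point.re ≤ x.point.re := by
          rcases LexIndex.lexLE_of_le hy with h | h
          exacts [h.le, h.1.le]
        exact this.trans_lt (hN.trans_le hc)
      have h1 : cnt y.point = Z.count y.point := by
        exact_mod_cast (hcnt y.point).symm.trans (hZ _ hre)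
      have h2 := y.copy_lt
      rw [h1] at h2
      rw [Finset.mem_coe, Finset.mem_product]
      refine ⟨Multiset.mem_toFinset.2 (Multiset.count_pos.1
        ((Nat.zero_le _).trans_lt h2)), ?_⟩
      exact Finset.mem_range.2 (h2.trans_le (Multiset.count_le_card _ _))
    exact Set.Finite.of_injOn hmaps
      (fun y _ y' _ h => LexIndex.ext' (Prod.ext_iff.1 h).1 (Prod.ext_iff.1 h).2)
      (Finset.finite_toSet _)
  have hinf : Infinite (LexIndex cnt) := by
    by_contra hni
    rw [not_infinite_iff_finite] at hni
    have := Fintype.ofFinite (LexIndex cnt)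
    obtain ⟨c, Z, hcard, hZc, hZ⟩ := H' (Fintype.card (LexIndex cnt) + 1)
    have hcz : ∀ z ∈ Z, Z.count z = cnt z := fun z hz => by
      exact_mod_cast (hZ z (hZc z hz)).symm.trans (hcnt z)
    let F : Z.ToType → LexIndex cnt := fun p => LexIndex.mk p.1 p.2
      (lt_of_lt_of_eq p.2.2 (hcz p.1 (Multiset.count_pos.1 ((Nat.zero_le _).trans_lt p.2.2))))
    have hF : Function.Injective F := by
      rintro ⟨z, i⟩ ⟨z', i'⟩ h
      have h1 : z = z' := congrArg LexIndex.point h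
      have h2 : (i : ℕ) = i' := congrArg LexIndex.copy h
      subst h1
      have : i = i' := Fin.ext h2
      rw [this]
    have := Fintype.card_le_of_injective F hF
    rw [Multiset.card_coe] at this
    omega
  let _ : LocallyFiniteOrder (LexIndex cnt) :=
    LocallyFiniteOrder.ofFiniteIcc fun x y => (hfin y).subset fun _ h => h.2
  let _ : SuccOrder (LexIndex cnt) := LinearLocallyFiniteOrder.succOrder _
  let _ : PredOrder (LexIndex cnt) := LinearLocallyFiniteOrder.predOrder _
  have hbot : ∃ b : LexIndex cnt, ∀ x, b ≤ x := by
    obtain ⟨x₀⟩ : Nonempty (LexIndex cnt) := inferInstance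
    obtain ⟨b, hb, hmin⟩ := (hfin x₀).exists_minimal ⟨x₀, Set.mem_Iic.2 le_rfl⟩
    refine ⟨b, fun x => ?_⟩
    rcases le_total b x with h | h
    · exact h
    · exact hmin (h.trans hb) h
  let _ : OrderBot (LexIndex cnt) :=
    { bot := hbot.choose, bot_le := hbot.choose_spec }
  have : NoMaxOrder (LexIndex cnt) := ⟨fun x => by
    by_contra! h
    exact Set.infinite_univ ((hfin x).subset fun y _ => h y)⟩
  let e : LexIndex cnt ≃o ℕ := orderIsoNatOfLinearSuccPredArch
  refine ⟨fun k => (e.symm k).point, fun j k hjk =>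
    LexIndex.lexLE_of_le (e.symm.monotone hjk), fun z => ?_⟩
  rw [hcnt, ← Cardinal.mk_fin]
  refine Cardinal.mk_congr ⟨fun k => ⟨(e.symm k).copy, ?_⟩,
    fun i => ⟨e (LexIndex.mk z i i.2), ?_⟩, fun k => ?_, fun i => ?_⟩
  · have := (e.symm k).copy_lt
    have hk : (e.symm k).point = z := k.2
    rwa [hk] at this
  · show (e.symm (e (LexIndex.mk z i i.2))).point = z
    rw [OrderIso.symm_apply_apply]
    rfl
  · apply Subtype.ext
    apply e.symm.injective
    simp only [OrderIso.symm_apply_apply]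
    exact LexIndex.ext' k.2.symm rfl
  · apply Fin.ext
    simp only [OrderIso.symm_apply_apply]
    rfl

/-- In a sorted sequence, the points to the left of a line form an initial segment whose length is
their number. -/
theorem re_lt_iff_lt_card {q : Potential} {lam : ℕ → ℂ} (hlam : IsPeriodicEigenvalueSequence q lam)
    {c : ℝ} {Z : Multiset ℂ} (hZc : ∀ z ∈ Z, z.re < c)
    (hZ : ∀ z : ℂ, z.re < c → periodicMultiplicity q z = Z.count z) (k : ℕ) :
    (lam k).re < c ↔ k < Multiset.card Z := by
  have hmono : ∀ {j k}, j ≤ k → (lam j).re ≤ (lam k).re := fun {j k} h => by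
    rcases hlam.1 j k h with h | h
    exacts [h.le, h.1.le]
  have hmk : ∀ z : ℂ, z.re < c → Cardinal.mk {k : ℕ // lam k = z} = Z.count z := fun z hz =>
    (hlam.2 z).trans (hZ z hz)
  have hfib : ∀ z : ℂ, z.re < c → {k : ℕ | lam k = z}.Finite ∧
      {k : ℕ | lam k = z}.ncard = Z.count z := fun z hz => by
    have h := hmk z hz
    have hf : {k : ℕ | lam k = z}.Finite :=
      Cardinal.lt_aleph0_iff_set_finite.1 (h ▸ Cardinal.natCast_lt_aleph0)
    refine ⟨hf, ?_⟩
    have h2 : Nat.card {k : ℕ // lam k = z} = Z.count z := by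
      rw [Nat.card, h, Cardinal.toNat_natCast]
    exact h2
  have hmem : ∀ k, (lam k).re < c → lam k ∈ Z := fun k hk => by
    have h := hfib _ hk
    refine Multiset.count_pos.1 ?_
    rw [← h.2]
    exact (Set.ncard_pos h.1).2 ⟨k, rfl⟩
  have hfin : {k | (lam k).re < c}.Finite := by
    refine ((Z.toFinset.finite_toSet).biUnion
      (t := fun z => {k | lam k = z}) fun z hz => (hfib z (hZc z (by simpa using hz))).1).subset
      fun k hk => ?_
    exact Set.mem_biUnion (x := lam k) (by simpa using hmem k hk) rfl
  have hcard : hfin.toFinset.card = Multiset.card Z := by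
    rw [Finset.card_eq_sum_card_fiberwise (f := lam) (t := Z.toFinset) fun k hk => by
      simpa using hmem k (by simpa using hk), ← Multiset.toFinset_sum_count_eq Z]
    refine Finset.sum_congr rfl fun z hz => ?_
    have hz' : z.re < c := hZc z (by simpa using hz)
    rw [← (hfib z hz').2, ← Set.ncard_coe_finset]
    congr 1
    ext k
    simp only [Finset.coe_filter, Set.Finite.mem_toFinset, Set.mem_ofPred_eq]
    exact ⟨fun h => h.2, fun h => ⟨h ▸ hz', h⟩⟩
  rw [← hcard]
  constructor
  · intro hk
    have : Finset.range (k + 1) ⊆ hfin.toFinset := fun j hj => by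
      rw [Set.Finite.mem_toFinset]
      exact (hmono (Nat.lt_succ_iff.1 (Finset.mem_range.1 hj))).trans_lt hk
    have := Finset.card_le_card this
    rw [Finset.card_range] at this
    omega
  · intro hk
    by_contra hc
    have : hfin.toFinset ⊆ Finset.range k := fun j hj => by
      rw [Set.Finite.mem_toFinset] at hj
      rw [Finset.mem_range]
      by_contra hjk
      exact hc ((hmono (not_lt.1 hjk)).trans_lt hj)
    have := Finset.card_le_card this
    rw [Finset.card_range] at this
    omega

/-! ### Gap lengths -/

/-- In the strip around `n² π²`, each eigenvalue has an eigenvector of the parity of `n`. -/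
theorem exists_eigenvector_of_strip {q : Potential} {n : ℕ}
    (ha : Summable fun k => ‖fourierCoeff q k‖) (hn : 1 ≤ n)
    (ha2 : Summable fun k => ‖fourierCoeff q k‖ ^ 2)
    (han : ∑' k, ‖fourierCoeff q k‖ ^ 2 ≤ (n : ℝ) ^ 2 / 16) {z : ℂ}
    (hz : |z.re - (n : ℝ) ^ 2 * Real.pi ^ 2| ≤ 4 * n) (h : periodicMultiplicity q z ≠ 0) :
    ∃ u : SeqSpace, u ≠ 0 ∧ ∀ k, ((freeEigenvalue ((n : ℤ) % 2) k : ℂ) - z) * u k +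
      seqConv (fourierCoeff q) u k = 0 := by
  have key : ∀ (s : ℤ) (σ : ℂ), s = 0 ∨ s = 1 → σ = mode s 0 1 →
      Module.rank ℂ (hillRootSpace q σ z) ≠ 0 →
      ∃ u : SeqSpace, u ≠ 0 ∧ ∀ k, ((freeEigenvalue ((n : ℤ) % 2) k : ℂ) - z) * u k +
        seqConv (fourierCoeff q) u k = 0 := by
    intro s σ hs hσ hr
    obtain ⟨u, hu0, hu⟩ := exists_eigenvector ha hσ hr
    -- For the parity opposite to that of `n` there is no mode `n`, and the strip contains no
    -- eigenvalue.
    have hsn : s = (n : ℤ) % 2 := by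
      by_contra hne
      apply hu0
      apply lp.ext
      refine eigenvector_eq_zero_of_inv_sq_le (s := s) (z := z) (t := 1) ha hn ha2 han hz
        (Or.inr fun k => by omega) (by simp) u.summable fun k => ?_
      rw [one_mul]; exact hu k
    exact ⟨u, hu0, hsn ▸ hu⟩
  by_cases h0 : Module.rank ℂ (hillRootSpace q 1 z) = 0
  · refine key 1 (-1) (Or.inr rfl) mode_one_zero_one fun h1 => h ?_
    rw [periodicMultiplicity, h0, h1, add_zero]
  · exact key 0 1 (Or.inl rfl) mode_zero_zero_one h0

theorem norm_gapLength_le {q : Potential} {lam : ℕ → ℂ} (hlam : IsPeriodicEigenvalueSequence q lam)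
    {α : ℝ} {n : ℕ} (ha : Summable fun k => ‖fourierCoeff q k‖) (hα : 0 ≤ α) (hn : 1 ≤ n)
    (hb : Summable fun k : ℤ => (Real.exp (α * |(k : ℝ)|) * ‖fourierCoeff q k‖) ^ 2)
    (hbn : ∑' k : ℤ, (Real.exp (α * |(k : ℝ)|) * ‖fourierCoeff q k‖) ^ 2 ≤ (n : ℝ) ^ 2 / 16) :
    ‖gapLength lam n‖ ≤ 2 * n * Real.exp (-(α * n)) := by
  obtain ⟨ha2, han⟩ := summable_sq_of_exp hα hb hbn
  have hn0 : (0 : ℝ) ≤ 4 * n := by positivity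
  obtain ⟨Z, hZc, hZcard, hZ⟩ := exists_multiset_periodicMultiplicity (ℓ := n)
    (c := (n : ℝ) ^ 2 * Real.pi ^ 2 + 4 * n) ha hn ha2 han
    (by rw [add_sub_cancel_left, abs_of_nonneg hn0]) le_rfl
    (fun s m => freeEigenvalue_lt_upper hn s m)
  obtain ⟨Z', hZc', hZcard', hZ'⟩ := exists_multiset_periodicMultiplicity (ℓ := n - 1)
    (c := (n : ℝ) ^ 2 * Real.pi ^ 2 - 4 * n) ha hn ha2 han
    (by rw [sub_sub_cancel_left, abs_neg, abs_of_nonneg hn0]) (Nat.sub_le _ _)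
    (fun s m => freeEigenvalue_lt_lower hn s m)
  -- There are `2 n + 1` eigenvalues left of the upper line and `2 (n - 1) + 1 = 2 n - 1` left of
  -- the lower one. As indices start at `0`, exactly `2 n - 1` and `2 n` remain for the strip.
  have hstrip : ∀ k, 2 * n - 1 ≤ k → k ≤ 2 * n →
      |(lam k).re - (n : ℝ) ^ 2 * Real.pi ^ 2| ≤ 4 * n := by
    intro k hk1 hk2
    have h1 := (re_lt_iff_lt_card hlam hZc hZ k).2 (by omega)
    have h2 := mt (re_lt_iff_lt_card hlam hZc' hZ' k).1 (by omega)
    rw [abs_le]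
    constructor <;> linarith
  have hmult : ∀ k, periodicMultiplicity q (lam k) ≠ 0 := fun k => by
    rw [← hlam.2, Cardinal.mk_ne_zero_iff]
    exact ⟨⟨k, rfl⟩⟩
  set z : Fin 2 → ℂ := ![lam (2 * n - 1), lam (2 * n)] with hz
  have hzs : ∀ i, |(z i).re - (n : ℝ) ^ 2 * Real.pi ^ 2| ≤ 4 * n := fun i => by
    fin_cases i
    · exact hstrip _ le_rfl (by omega)
    · exact hstrip _ (by omega) le_rfl
  have hzm : ∀ i, periodicMultiplicity q (z i) ≠ 0 := fun i => by
    fin_cases i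
    · exact hmult _
    · exact hmult _
  choose u hu0 hu using fun i => exists_eigenvector_of_strip ha hn ha2 han (hzs i) (hzm i)
  exact norm_sub_le_of_eigenvalues (s := (n : ℤ) % 2) (m₀ := (n : ℤ) / 2) ha hα hn hb hbn
    (by omega) hzs (fun i => (u i).summable) (fun i h => hu0 i (lp.ext h)) hu

/-! ### The function `ψ` -/

/-- The term `log r / m` tends to zero, so superexponential growth makes the values tend to infinity
and the infimum is attained. Indices are shifted by one to leave out `m = 0`. -/
theorem isLeast_psi {w : ℤ → ℝ} (hw : IsNormalizedWeight w) (hsup : IsStrictlySuperexponential w)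
    {r : ℝ} (hr : 0 < r) : IsLeast (psiValues w r) (psi w r) := by
  have hlim : Tendsto (fun m : ℕ => Real.log (r * w (m : ℤ)) / (m : ℝ)) atTop atTop := by
    have h1 : Tendsto (fun m : ℕ => Real.log r / (m : ℝ)) atTop (𝓝 0) :=
      tendsto_const_div_atTop_nhds_zero_nat _
    refine (h1.add_atTop hsup).congr fun m => ?_
    rw [Real.log_mul hr.ne' (by linarith [(hw m).2]), add_div]
  have hlim' := (tendsto_add_atTop_iff_nat 1).2 hlim
  rw [← Nat.cofinite_eq_atTop] at hlim'
  obtain ⟨m, hm⟩ := hlim'.exists_forall_le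
  have hleast : IsLeast (psiValues w r) (Real.log (r * w ((m + 1 : ℕ) : ℤ)) / ((m + 1 : ℕ) : ℝ)) := by
    refine ⟨⟨m + 1, by omega, rfl⟩, ?_⟩
    rintro y ⟨k, hk, rfl⟩
    obtain ⟨k, rfl⟩ : ∃ j, k = j + 1 := ⟨k - 1, by omega⟩
    exact hm k
  rw [psi, hleast.csInf_eq]
  exact hleast

theorem psi_nonneg {w : ℤ → ℝ} (hw : IsNormalizedWeight w) (hsup : IsStrictlySuperexponential w)
    {r : ℝ} (hr : 1 ≤ r) : 0 ≤ psi w r := by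
  obtain ⟨m, -, hm⟩ := (isLeast_psi hw hsup (by linarith)).1
  rw [hm]
  refine div_nonneg (Real.log_nonneg ?_) (by positivity)
  nlinarith [(hw m).2]

/-- For `k ≠ 0` this is the minimality of `ψ(r)` at `m = |k|`. The case `k = 0` requires `r w(0) ≥
1`, which is where `r ≥ 1`, that is `n ≥ 4 ‖q‖_w`, enters. -/
theorem exp_psi_le {w : ℤ → ℝ} (hw : IsNormalizedWeight w) (hsup : IsStrictlySuperexponential w)
    {r : ℝ} (hr : 1 ≤ r) (k : ℤ) : Real.exp (psi w r * |(k : ℝ)|) ≤ r * w k := by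
  have hr0 : 0 < r := by linarith
  obtain ⟨m, hm⟩ : ∃ m : ℕ, |k| = m := ⟨k.natAbs, Int.abs_eq_natAbs k⟩
  have hwk : w k = w m := by
    rcases abs_choice k with h | h
    · rw [← hm, h]
    · rw [(hw k).1, ← hm, h]
  have hkm : |(k : ℝ)| = m := by exact_mod_cast hm
  have hpos : 0 < r * w m := mul_pos hr0 (by linarith [(hw m).2])
  rw [hwk, hkm, ← Real.le_log_iff_exp_le hpos]
  rcases Nat.eq_zero_or_pos m with h | h
  · subst h
    rw [Nat.cast_zero, mul_zero]
    refine Real.log_nonneg ?_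
    nlinarith [(hw (0 : ℕ)).2]
  · have h1 := (isLeast_psi hw hsup hr0).2 ⟨m, h, rfl⟩
    rwa [le_div_iff₀ (by exact_mod_cast h)] at h1

section Weighted

variable {w : ℤ → ℝ} {q : Potential}

theorem weightedNorm_sq (w : ℤ → ℝ) (q : Potential) :
    weightedNorm w q ^ 2 = ∑' n : ℤ, w n ^ 2 * ‖fourierCoeff q n‖ ^ 2 :=
  Real.sq_sqrt (tsum_nonneg fun _ => by positivity)

theorem exp_weight_bound (hq : q ∈ weightedSpace w) {α r : ℝ} {n : ℕ} (hr : 0 ≤ r)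
    (h : ∀ k : ℤ, Real.exp (α * |(k : ℝ)|) ≤ r * w k) (hn : r * weightedNorm w q ≤ n / 4) :
    (Summable fun k : ℤ => (Real.exp (α * |(k : ℝ)|) * ‖fourierCoeff q k‖) ^ 2) ∧
      ∑' k : ℤ, (Real.exp (α * |(k : ℝ)|) * ‖fourierCoeff q k‖) ^ 2 ≤ (n : ℝ) ^ 2 / 16 := by
  have hq' : Summable fun n : ℤ => w n ^ 2 * ‖fourierCoeff q n‖ ^ 2 := hq
  have hle : ∀ k : ℤ, (Real.exp (α * |(k : ℝ)|) * ‖fourierCoeff q k‖) ^ 2 ≤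
      r ^ 2 * (w k ^ 2 * ‖fourierCoeff q k‖ ^ 2) := fun k => by
    calc _ ≤ (r * w k * ‖fourierCoeff q k‖) ^ 2 := by have := h k; gcongr
      _ = _ := by ring
  have hs := Summable.of_nonneg_of_le (fun k => sq_nonneg _) hle (hq'.mul_left _)
  refine ⟨hs, (hs.tsum_le_tsum hle (hq'.mul_left _)).trans ?_⟩
  rw [tsum_mul_left, ← weightedNorm_sq, ← mul_pow]
  have h0 : 0 ≤ r * weightedNorm w q := mul_nonneg hr (Real.sqrt_nonneg _)
  calc _ ≤ ((n : ℝ) / 4) ^ 2 := by gcongr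
    _ = _ := by ring

/-- The weight dominates an exponential of rate `ψ(e) > 0`, up to the factor `e`, hence a multiple
of `k²`. Then `|q_k| ≤ w_k |q_k|² + 1 / w_k` is summable; the choice `r = e` makes all logarithms
positive. -/
theorem summable_norm_fourierCoeff (hw : IsNormalizedWeight w)
    (hsup : IsStrictlySuperexponential w) (hq : q ∈ weightedSpace w) :
    Summable fun k => ‖fourierCoeff q k‖ := by
  have hq' : Summable fun n : ℤ => w n ^ 2 * ‖fourierCoeff q n‖ ^ 2 := hq
  have he : (1 : ℝ) < Real.exp 1 := Real.one_lt_exp_iff.2 one_pos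
  have hpos : 0 < psi w (Real.exp 1) := by
    obtain ⟨m, hm1, hm⟩ := (isLeast_psi hw hsup (Real.exp_pos 1)).1
    rw [hm]
    have : (0 : ℝ) < m := by exact_mod_cast hm1
    refine div_pos (Real.log_pos ?_) this
    nlinarith [(hw m).2]
  set μ := psi w (Real.exp 1) with hμ
  have hinv : Summable fun k : ℤ => 2 * Real.exp 1 / μ ^ 2 * (1 / (k : ℝ) ^ 2) :=
    hasSum_int_inv_sq.summable.mul_left _
  refine Summable.of_norm_bounded_eventually (hq'.add hinv) ?_
  filter_upwards [(Set.finite_singleton (0 : ℤ)).compl_mem_cofinite] with k hk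
  have hk0 : (k : ℝ) ≠ 0 := by exact_mod_cast hk
  have hk2 : 0 < (k : ℝ) ^ 2 := by positivity
  have hw1 := (hw k).2
  have h1 := exp_psi_le hw hsup he.le k
  have h2 := Real.quadratic_le_exp_of_nonneg (x := μ * |(k : ℝ)|) (by positivity)
  have h3 : μ ^ 2 * (k : ℝ) ^ 2 ≤ 2 * Real.exp 1 * w k := by
    have : (μ * |(k : ℝ)|) ^ 2 = μ ^ 2 * (k : ℝ) ^ 2 := by rw [mul_pow, sq_abs]
    have h4 : 0 ≤ μ * |(k : ℝ)| := by positivity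
    nlinarith
  have h5 : 1 / w k ≤ 2 * Real.exp 1 / μ ^ 2 * (1 / (k : ℝ) ^ 2) := by
    rw [div_mul_div_comm, mul_one, div_le_div_iff₀ (by linarith) (by positivity)]
    linarith
  rw [norm_norm]
  refine le_trans ?_ (add_le_add le_rfl h5)
  have hwpos : 0 < w k := by linarith
  have hx := norm_nonneg (fourierCoeff q k)
  set x := ‖fourierCoeff q k‖
  have h6 : x ≤ w k * x ^ 2 + 1 / w k := by
    have : 0 ≤ (w k * x - 1) ^ 2 := sq_nonneg _
    rw [← sub_nonneg, show w k * x ^ 2 + 1 / w k - x =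
      ((w k * x - 1) ^ 2 + w k * x) / w k by field_simp; ring]
    positivity
  have h7 : w k * x ^ 2 ≤ w k ^ 2 * x ^ 2 := by
    gcongr
    nlinarith
  linarith

theorem fourierCoeff_zero_potential (k : ℤ) : fourierCoeff (0 : Potential) k = 0 := by
  rw [← fourierBasis_repr, map_zero]
  rfl

theorem weightedNorm_pos (hw : IsNormalizedWeight w) (hq : q ∈ weightedSpace w) (h : q ≠ 0) :
    0 < weightedNorm w q := by
  have hq' : Summable fun n : ℤ => w n ^ 2 * ‖fourierCoeff q n‖ ^ 2 := hq
  refine lt_of_le_of_ne (Real.sqrt_nonneg _) fun h0 => h ?_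
  have h1 := weightedNorm_sq w q
  rw [← h0, zero_pow two_ne_zero] at h1
  have h2 := (hasSum_zero_iff_of_nonneg (fun n => by positivity)).1 (h1 ▸ hq'.hasSum)
  have h3 : ∀ n, fourierCoeff q n = 0 := fun n => by
    have := congrFun h2 n
    have hwn : w n ≠ 0 := by linarith [(hw n).2]
    simpa [hwn] using this
  have h4 := hasSum_fourier_series_L2 q
  simp only [h3, zero_smul] at h4
  exact h4.unique hasSum_zero

end Weighted

end

/-! ### The gap estimate -/

theorem theorem6 (w : ℤ → ℝ) (hw : IsNormalizedWeight w) (hsup : IsStrictlySuperexponential w)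
    (q : Potential) (hq : q ∈ weightedSpace w) :
    -- the minimum that defines `ψ` is attained
    (∀ r : ℝ, 0 < r → IsLeast (psiValues w r) (psi w r)) ∧
    -- the periodic eigenvalues can be listed in lexicographic order
    (∃ lam : ℕ → ℂ, IsPeriodicEigenvalueSequence q lam) ∧
    -- the gap estimate; for `q = 0` one has `ñ = ∞` and the right-hand side is `0`
    ∀ lam : ℕ → ℂ, IsPeriodicEigenvalueSequence q lam →
      ∀ n : ℕ, 1 ≤ n → 4 * weightedNorm w q ≤ (n : ℝ) →
        (q ≠ 0 → ‖gapLength lam n‖ ≤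
          2 * (n : ℝ) * Real.exp (-((n : ℝ) * psi w ((n : ℝ) / (4 * weightedNorm w q))))) ∧
        (q = 0 → gapLength lam n = 0) := by
  have ha := summable_norm_fourierCoeff hw hsup hq
  refine ⟨fun r hr => isLeast_psi hw hsup hr, ?_, fun lam hlam n hn hnq => ⟨fun hq0 => ?_, ?_⟩⟩
  · have H : ∀ N : ℕ, ∃ (c : ℝ) (Z : Multiset ℂ), (N : ℝ) ≤ c ∧ N ≤ Multiset.card Z ∧
        (∀ z ∈ Z, z.re < c) ∧ ∀ z : ℂ, z.re < c → periodicMultiplicity q z = Z.count z := by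
      intro N
      obtain ⟨K, hK⟩ := exists_nat_ge (4 * weightedNorm w q)
      have hn : 1 ≤ N + K + 1 := by omega
      have hNK : ((N + K + 1 : ℕ) : ℝ) = N + K + 1 := by push_cast; rfl
      -- Localization needs no decay: rate `0` and `w ≥ 1` suffice once `n ≥ 4 ‖q‖_w`.
      obtain ⟨hb, hbn⟩ := exp_weight_bound (α := 0) (r := 1) (n := N + K + 1) hq zero_le_one
        (fun k => by rw [zero_mul, Real.exp_zero, one_mul]; exact (hw k).2) (by
          rw [hNK]; have : (0 : ℝ) ≤ N := by positivity
          linarith)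
      obtain ⟨ha2, han⟩ := summable_sq_of_exp le_rfl hb hbn
      obtain ⟨Z, h1, h2, h3⟩ := exists_multiset_periodicMultiplicity (ℓ := N + K + 1)
        (c := ((N + K + 1 : ℕ) : ℝ) ^ 2 * Real.pi ^ 2 + 4 * (N + K + 1 : ℕ)) ha hn ha2 han
        (by rw [add_sub_cancel_left, abs_of_nonneg (by positivity)]) le_rfl
        (fun s m => freeEigenvalue_lt_upper hn s m)
      refine ⟨_, Z, ?_, by omega, h1, h3⟩
      have h4 : 0 ≤ ((N + K + 1 : ℕ) : ℝ) ^ 2 * Real.pi ^ 2 := by positivity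
      have h5 : (N : ℝ) ≤ (N + K + 1 : ℕ) := by exact_mod_cast (by omega : N ≤ N + K + 1)
      have h6 : (0 : ℝ) ≤ N := by positivity
      linarith
    exact exists_lex_sequence
      (fun N => let ⟨c, Z, h1, h2, _, h4⟩ := H N; ⟨c, Z, h1, h2, h4⟩)
      (fun N => let ⟨c, Z, _, h2, h3, h4⟩ := H N; ⟨c, Z, h2, h3, h4⟩)
  · have hpos := weightedNorm_pos hw hq hq0
    have hr1 : 1 ≤ (n : ℝ) / (4 * weightedNorm w q) := by
      rw [one_le_div (by positivity)]; exact hnq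
    -- With `r = ñ` one has `r ‖q‖_w = n / 4` exactly.
    obtain ⟨hb, hbn⟩ := exp_weight_bound (n := n) hq (by linarith) (exp_psi_le hw hsup hr1)
      (le_of_eq (by field_simp))
    rw [mul_comm (n : ℝ) (psi w _)]
    exact norm_gapLength_le hlam ha (psi_nonneg hw hsup hr1) hn hb hbn
  · rintro rfl
    by_contra hg
    have hg0 : 0 < ‖gapLength lam n‖ := norm_pos_iff.2 hg
    set g := ‖gapLength lam n‖
    -- For `q = 0` every rate `α ≥ 0` is admissible. A gap `g > 0` contradicts the estimate at `α =
    -- 2 / g`, since `g e^{2 n / g} ≥ 2 n + g`.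
    have h := norm_gapLength_le (α := 2 / g) hlam ha (by positivity) hn
      (by simp only [fourierCoeff_zero_potential, norm_zero, mul_zero, ne_eq, OfNat.ofNat_ne_zero,
            not_false_eq_true, zero_pow]
          exact summable_zero)
      (by simp only [fourierCoeff_zero_potential, norm_zero, mul_zero, ne_eq, OfNat.ofNat_ne_zero,
            not_false_eq_true, zero_pow, tsum_zero]
          positivity)
    rw [Real.exp_neg, ← div_eq_mul_inv, le_div_iff₀ (Real.exp_pos _)] at h
    have h1 := Real.add_one_le_exp (2 / g * n)
    have h2 : g * (2 / g * n + 1) ≤ g * Real.exp (2 / g * n) := by gcongr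
    have h3 : g * (2 / g * n + 1) = 2 * n + g := by field_simp
    have h4 : g * Real.exp (2 / g * n) ≤ 2 * n := h
    linarith
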